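/- Let $\mathcal O$ be a commutative ring with $\operatorname{Spec}\mathcal O$ connected, and let $G$ be a generalised torus over $\mathcal O$, i.e. a smooth affine $\mathcal O$-group scheme such that the geometric fibres of the identity component $G^0$ are tori and $G/G^0$ is finite over $\mathcal O$. Assume that $G^0$ is split, $G^0=\mathfrak D(M):=\operatorname{Spec}\mathcal O[M]$ with $M$ its character lattice (free of finite rank), so that $G^0(A)=\operatorname{Hom}(M,A^\times)$ for every commutative $\mathcal O$-algebra $A$, and that $G/G^0=\underline\Delta$ is the constant group scheme of a finite group $\Delta$; let $\Pi:G\to\underline\Delta$ be the projection, and let $\Delta$ act on $M$ through the conjugation action of $G$ on $G^0$. Let $\Gamma_1$ be an abstract group, $\pi:\Gamma_1\twoheadrightarrow\Delta$ a surjective homomorphism with kernel $\Gamma_2$; $\Gamma_1$ acts on $M$ and on $\mathfrak D(M)(A)$ through $\pi$. A representation $\rho:\Gamma_1\to G(A)$ is admissible if $\Pi\circ\rho=\pi$; let $\mathrm{Rep}^{\Gamma_1}_{G,\pi}(A)$ be the set of these, on which $\mathfrak D(M)(A)=G^0(A)$ acts by conjugation. A $G$-pseudocharacter of $\Gamma_1$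 over $A$ is a sequence of $\mathcal O$-algebra maps $\Theta_n:\mathcal O[G^n]^{G^0}\to\mathrm{Map}(\Gamma_1^n,A)$ ($n\ge1$), with $G^0$ acting by simultaneous conjugation, such that $\Theta_n(f^\zeta)(\gamma_1,\dots,\gamma_n)=\Theta_m(f)(\gamma_{\zeta(1)},\dots,\gamma_{\zeta(m)})$ for all maps $\zeta:\{1,\dots,m\}\to\{1,\dots,n\}$, and $\Theta_{n+1}(\hat f)(\gamma_1,\dots,\gamma_{n+1})=\Theta_n(f)(\gamma_1,\dots,\gamma_{n-1},\gamma_n\gamma_{n+1})$, where $f^\zeta(g_1,\dots,g_n)=f(g_{\zeta(1)},\dots,g_{\zeta(m)})$ and $\hat f(g_1,\dots,g_{n+1})=f(g_1,\dots,g_{n-1},g_ng_{n+1})$. Every $\rho:\Gamma_1\to G(A)$ gives $\Theta_\rho$, $(\Theta_\rho)_n(f)(\gamma_1,\dots,\gamma_n)=f(\rho(\gamma_1),\dots,\rho(\gamma_n))$. Let $\mathrm{PC}^{\Gamma_1}_{G,\pi}(A)$ be the set of those $\Theta$ that are admissible, i.e. whose image under $\Pi$ is the $\underline\Delta$-pseudocharacter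 of $\pi$. Choose representatives $\bar c\in\Gamma_1$ of the elements $c\in\Delta=\Gamma_1/\Gamma_2$ with $\bar1=1$, let $\kappa(d,c)\in\Gamma_2^{\mathrm{ab}}$ be the class of $\bar d\,\bar c\,\overline{dc}^{-1}$, let $I_\Delta\subset\mathbb Z[\Delta]$ be the augmentation ideal, and let $\mathcal E$ be the group $\Gamma_2^{\mathrm{ab}}\oplus I_\Delta$ with the $\Delta$-action $d*(g,c-1)=(dgd^{-1}\cdot\kappa(d,c),\,dc-d)$. Put $\Phi_{\mathrm{nat}}(\gamma)(m)=[(\gamma\,\overline{\pi(\gamma)}^{-1},\,\pi(\gamma)-1)\otimes m]\in(\mathcal E\otimes M)_\Delta$ (coinvariants for the diagonal action), for $\gamma\in\Gamma_1$ and $m\in M$. Assume that there is an admissible representation $\rho_0\in\mathrm{Rep}^{\Gamma_1}_{G,\pi}(\mathcal O)$. Then: (1) For every commutative $\mathcal O$-algebra $A$ the map $\Phi\mapsto\Phi\rho_0$ is a bijection $Z^1(\Gamma_1,\mathfrak D(M)(A))\to\mathrm{Rep}^{\Gamma_1}_{G,\pi}(A)$, natural in $A$. It is $\mathfrak D(M)(A)$-equivariant,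 where $t\in\mathfrak D(M)(A)$ acts on cocycles by multiplication with the coboundary $\gamma\mapsto t\cdot({}^\gamma t)^{-1}$, and it induces a natural bijection between $H^1(\Gamma_1,\mathfrak D(M)(A))$ and the set of $\mathfrak D(M)(A)$-orbits in $\mathrm{Rep}^{\Gamma_1}_{G,\pi}(A)$. (2) $\mathrm{Rep}^{\Gamma_1}_{G,\pi}$ is represented by the group algebra $\mathcal O[(\mathcal E\otimes M)_\Delta]$; a point $\psi:\mathcal O[(\mathcal E\otimes M)_\Delta]\to A$ corresponds to $(\psi\circ\Phi_{\mathrm{nat}})\,\rho_0$. (3) There is a homomorphism $\varphi_{\mathrm{nat}}:H_1(\Gamma_1,M)\to(\mathcal E\otimes M)_\Delta$ sending the class of a cycle $\sum_i m_i[\gamma_i]$ (i.e. $\sum_i(\gamma_i^{-1}m_i-m_i)=0$) to $\sum_i\Phi_{\mathrm{nat}}(\gamma_i)(m_i)$. The map sending the orbit of $\Phi\rho_0$ to the homomorphism $H_1(\Gamma_1,M)\to A^\times$, $[\sum_i m_i[\gamma_i]]\mapsto\prod_i\Phi(\gamma_i)(m_i)$, is well defined and natural in $A$, and exhibits $\operatorname{Spec}\mathcal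 O[H_1(\Gamma_1,M)]$ as the fpqc sheafification $\mathrm{Rep}^{\Gamma_1}_{G,\pi}/\mathfrak D(M)$ of the presheaf $A\mapsto\mathrm{Rep}^{\Gamma_1}_{G,\pi}(A)/\mathfrak D(M)(A)$. This quotient is also the GIT quotient: $\varphi_{\mathrm{nat}}$ induces an isomorphism of $\mathcal O[H_1(\Gamma_1,M)]$ onto the algebra of invariants $\mathcal O[(\mathcal E\otimes M)_\Delta]^{G^0}=\mathcal O(\mathrm{Rep}^{\Gamma_1}_{G,\pi})^{G^0}$. (4) $\mathrm{PC}^{\Gamma_1}_{G,\pi}$ is represented by $\mathcal O[H_1(\Gamma_1,M)]$, in such a way that the map $\mathrm{Rep}^{\Gamma_1}_{G,\pi}\to\mathrm{PC}^{\Gamma_1}_{G,\pi}$, $\rho\mapsto\Theta_\rho$, corresponds to the algebra homomorphism $\mathcal O[H_1(\Gamma_1,M)]\to\mathcal O[(\mathcal E\otimes M)_\Delta]$ induced by $\varphi_{\mathrm{nat}}$. -/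

import Mathlib

open CategoryTheory TensorProduct WithConv

universe u

namespace GenTorus

noncomputable section

/-! ### Points of affine group schemes -/

section Points

variable (O : Type u) [CommRing O] (H : Type u) [CommRing H] [HopfAlgebra O H]

/-- The `A`-valued points of the affine group scheme `Spec H` over `O`.  This is a group under
convolution: the product, unit and inverse are induced by the comultiplication, counit and antipode
of `H`. -/
def Pt (A : Type u) [CommRing A] [Algebra O A] : Type u := WithConv (H →ₐ[O] A)

instance (A : Type u) [CommRing A] [Algebra O A] : Group (Pt O H A) where
  toMonoid := inferInstanceAs (Monoid (WithConv (H →ₐ[O] A)))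
  inv f := toConv (f.ofConv.comp (HopfAlgebra.antipodeAlgHom O H))
  inv_mul_cancel f := by
    have h0 := (AlgHom.antipode_id_cancel (R := O) (A := H))
    have h1 := AlgHom.comp_convMul_distrib f.ofConv
      (toConv (HopfAlgebra.antipodeAlgHom O H)) (toConv (AlgHom.id O H))
    rw [h0] at h1
    apply ofConv_injective
    refine h1.symm.trans ?_
    ext x
    change f.ofConv ((1 : WithConv (H →ₐ[O] H)) x) = (1 : WithConv (H →ₐ[O] A)) x
    simp [AlgHom.convOne_apply]

variable {O H}
variable {A B : Type u} [CommRing A] [Algebra O A] [CommRing B] [Algebra O B]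

variable (H) in
/-- The map `G(A) → G(B)` induced by a morphism of `O`-algebras `A → B`. -/
def Pt.map (f : A →ₐ[O] B) : Pt O H A →* Pt O H B where
  toFun x := toConv (f.comp x.ofConv)
  map_one' := by
    apply ofConv_injective
    ext x
    change f ((1 : WithConv (H →ₐ[O] A)) x) = (1 : WithConv (H →ₐ[O] B)) x
    simp [AlgHom.convOne_apply]
  map_mul' x y := by
    apply ofConv_injective
    exact AlgHom.comp_convMul_distrib f x y

/-- The map `G(A) → G'(A)` induced by a homomorphism of group schemes `G → G'`, the latter being
given by the bialgebra homomorphism `φ : O[G'] → O[G]`. -/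
def Pt.push {H' : Type u} [CommRing H'] [HopfAlgebra O H'] (φ : H' →ₐc[O] H) :
    Pt O H A →* Pt O H' A where
  toFun x := toConv (x.ofConv.comp (φ : H' →ₐ[O] H))
  map_one' := by
    apply ofConv_injective
    ext x
    change (1 : WithConv (H →ₐ[O] A)) (φ x) = (1 : WithConv (H' →ₐ[O] A)) x
    simp [AlgHom.convOne_apply]
  map_mul' x y := by
    apply ofConv_injective
    exact AlgHom.convMul_comp_bialgHom_distrib x y φ

/-- A point of `G` with values in a field `K`, as a point of the topological space underlying the
fibre `G_K = Spec (K ⊗ H)`. -/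
def fibrePt {K : Type u} [Field K] [Algebra O K] (x : Pt O H K) : PrimeSpectrum (K ⊗[O] H) :=
  ⟨RingHom.ker (Algebra.TensorProduct.lift (AlgHom.id O K) x.ofConv (fun _ _ => Commute.all _ _)),
    RingHom.ker_isPrime _⟩

variable (O H A) in
/-- `G⁰(A)` for the relative identity component `G⁰` of the group scheme `G = Spec H`: the points of
`G(A)` which, on every geometric fibre, lie in the connected component of the identity. -/
def identityComponent : Set (Pt O H A) :=
  {g | ∀ (K : Type u) [Field K] [IsAlgClosed K] [Algebra O K] (φ : A →ₐ[O] K),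
    fibrePt (Pt.map H φ g) ∈ connectedComponent (fibrePt (1 : Pt O H K))}

theorem push_mem_identityComponent {H' : Type u} [CommRing H'] [HopfAlgebra O H']
    (φ : H' →ₐc[O] H) {g : Pt O H A} (hg : g ∈ identityComponent O H A) :
    Pt.push φ g ∈ identityComponent O H' A := by
  intro K _ _ _ ψ
  let F : K ⊗[O] H' →ₐ[O] K ⊗[O] H := Algebra.TensorProduct.map (AlgHom.id O K) (φ : H' →ₐ[O] H)
  have hF : ∀ x : Pt O H K, PrimeSpectrum.comap F.toRingHom (fibrePt x) = fibrePt (Pt.push φ x) := by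
    intro x
    have hc : (Algebra.TensorProduct.lift (AlgHom.id O K) x.ofConv
        (fun _ _ => Commute.all _ _)).comp F = Algebra.TensorProduct.lift (AlgHom.id O K)
          (Pt.push φ x).ofConv (fun _ _ => Commute.all _ _) := by
      ext y
      · simp [F]
      · simp only [F, AlgHom.comp_apply, AlgHom.restrictScalars_apply,
          Algebra.TensorProduct.includeRight_apply, Algebra.TensorProduct.map_tmul,
          Algebra.TensorProduct.lift_tmul, map_one, one_mul]
        rfl
    apply PrimeSpectrum.ext
    ext y
    have := DFunLike.congr_fun hc y
    simp only [fibrePt, PrimeSpectrum.comap_asIdeal, Ideal.mem_comap, RingHom.mem_ker]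
    rw [← this]
    rfl
  have h1 := (PrimeSpectrum.continuous_comap F.toRingHom).image_connectedComponent_subset
    (fibrePt (1 : Pt O H K)) ⟨_, hg K ψ, rfl⟩
  rw [hF, hF, map_one] at h1
  exact h1

variable (O H) in
/-- The coordinate ring of `Gⁿ`. -/
abbrev CoordPow (n : ℕ) : Type u := ⨂[O] _ : Fin n, H

/-- Evaluation of functions on `Gⁿ` at an `n`-tuple of points of `G`. -/
def evalAt {n : ℕ} (g : Fin n → Pt O H A) : CoordPow O H n →ₐ[O] A :=
  PiTensorProduct.liftAlgHom
    ((MultilinearMap.mkPiAlgebra O (Fin n) A).compLinearMap fun i => (g i).ofConv.toLinearMap)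
    (by simp) (fun x y => by simp [Finset.prod_mul_distrib])

theorem evalAt_tprod {n : ℕ} (g : Fin n → Pt O H A) (x : Fin n → H) :
    evalAt g (PiTensorProduct.tprod O x) = ∏ i, (g i).ofConv (x i) :=
  (PiTensorProduct.lift.tprod x).trans (by simp)

variable (O H) in
/-- The `i`-th projection `Gⁿ → G`, as a point of `G` with values in the coordinate ring of `Gⁿ`. -/
def coordPt (n : ℕ) (i : Fin n) : Pt O H (CoordPow O H n) :=
  toConv (PiTensorProduct.singleAlgHom (R := O) (A := fun _ : Fin n => H) i)

theorem map_evalAt_coordPt {n : ℕ} (g : Fin n → Pt O H A) (i : Fin n) :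
    Pt.map H (evalAt g) (coordPt O H n i) = g i := by
  apply ofConv_injective
  ext x
  change evalAt g (PiTensorProduct.tprod O (MonoidHom.mulSingle (fun _ : Fin n => H) i x)) = _
  rw [evalAt_tprod]
  rw [Finset.prod_eq_single i]
  · simp
  · intro j _ hj
    simp [Pi.mulSingle_eq_of_ne hj]
  · simp

theorem algHom_comp_evalAt {n : ℕ} (f : A →ₐ[O] B) (g : Fin n → Pt O H A) :
    f.comp (evalAt g) = evalAt fun i => Pt.map H f (g i) := by
  apply AlgHom.toLinearMap_injective
  apply PiTensorProduct.ext
  ext x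
  change f (evalAt g (PiTensorProduct.tprod O x)) =
    evalAt (fun i => Pt.map H f (g i)) (PiTensorProduct.tprod O x)
  rw [evalAt_tprod, evalAt_tprod, map_prod]
  rfl

variable (O H) in
/-- The algebra `O[Gⁿ]^{G⁰}` of functions on `Gⁿ` which are invariant under simultaneous
conjugation by `G⁰`. -/
def invariants (n : ℕ) : Subalgebra O (CoordPow O H n) where
  carrier := {f | ∀ (A : Type u) [CommRing A] [Algebra O A], ∀ h ∈ identityComponent O H A,
    ∀ g : Fin n → Pt O H A, evalAt (fun i => h * g i * h⁻¹) f = evalAt g f}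
  mul_mem' hx hy A _ _ h hh g := by rw [map_mul, map_mul, hx A h hh g, hy A h hh g]
  add_mem' hx hy A _ _ h hh g := by rw [map_add, map_add, hx A h hh g, hy A h hh g]
  algebraMap_mem' r A _ _ h hh g := by rw [AlgHom.commutes, AlgHom.commutes]

/-- For `ζ : {1,…,m} → {1,…,n}` the function `f^ζ(g₁,…,gₙ) = f(g_{ζ(1)},…,g_{ζ(m)})`. -/
def reindex {m n : ℕ} (ζ : Fin m → Fin n) (f : invariants O H m) : invariants O H n :=
  ⟨evalAt (fun i => coordPt O H n (ζ i)) f.1, by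
    intro A _ _ h hh g
    have key : ∀ g : Fin n → Pt O H A,
        evalAt g (evalAt (fun i => coordPt O H n (ζ i)) f.1) = evalAt (fun i => g (ζ i)) f.1 := by
      intro g
      rw [← AlgHom.comp_apply, algHom_comp_evalAt]
      simp only [map_evalAt_coordPt]
    rw [key, key]
    exact f.2 A h hh fun i => g (ζ i)⟩

/-- `(x₁,…,xₙ₊₁) ↦ (x₁,…,xₙ₋₁,xₙxₙ₊₁)`, where `n ≥ 1`. -/
def mulLast {X : Type*} [Mul X] {n : ℕ} (x : Fin (n + 2) → X) : Fin (n + 1) → X :=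
  Fin.contractNth (Fin.last n).castSucc (· * ·) x

theorem map_mulLast {X Y : Type*} [Monoid X] [Monoid Y] (f : X →* Y) {n : ℕ}
    (x : Fin (n + 2) → X) (i : Fin (n + 1)) :
    f (mulLast x i) = mulLast (fun j => f (x j)) i := by
  simp only [mulLast, Fin.contractNth]
  split_ifs <;> simp

/-- The function `f̂(g₁,…,gₙ₊₁) = f(g₁,…,gₙ₋₁,gₙgₙ₊₁)`, where `n ≥ 1`. -/
def hat {n : ℕ} (f : invariants O H (n + 1)) : invariants O H (n + 2) :=
  ⟨evalAt (mulLast (coordPt O H (n + 2))) f.1, by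
    intro A _ _ h hh g
    have key : ∀ g : Fin (n + 2) → Pt O H A,
        evalAt g (evalAt (mulLast (coordPt O H (n + 2))) f.1) = evalAt (mulLast g) f.1 := by
      intro g
      rw [← AlgHom.comp_apply, algHom_comp_evalAt]
      congr 2
      ext1 i
      rw [map_mulLast]
      simp only [map_evalAt_coordPt]
    rw [key, key, ← f.2 A h hh (mulLast g)]
    congr 2
    ext1 i
    exact (map_mulLast (MulAut.conj h).toMonoidHom g i).symm⟩

theorem evalAt_reindex {m n : ℕ} (ζ : Fin m → Fin n) (f : invariants O H m)
    (g : Fin n → Pt O H A) :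
    evalAt g (reindex ζ f).1 = evalAt (fun i => g (ζ i)) f.1 := by
  change evalAt g (evalAt (fun i => coordPt O H n (ζ i)) f.1) = _
  rw [← AlgHom.comp_apply, algHom_comp_evalAt]
  simp only [map_evalAt_coordPt]

theorem evalAt_hat {n : ℕ} (f : invariants O H (n + 1)) (g : Fin (n + 2) → Pt O H A) :
    evalAt g (hat f).1 = evalAt (mulLast g) f.1 := by
  change evalAt g (evalAt (mulLast (coordPt O H (n + 2))) f.1) = _
  rw [← AlgHom.comp_apply, algHom_comp_evalAt]
  congr 2
  ext1 i
  rw [map_mulLast]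
  simp only [map_evalAt_coordPt]

/-- Pullback of invariant functions along the morphism `Gⁿ → G'ⁿ` induced by a homomorphism of
group schemes `G → G'`. -/
def pullback {H' : Type u} [CommRing H'] [HopfAlgebra O H'] (φ : H' →ₐc[O] H) (n : ℕ) :
    invariants O H' n →ₐ[O] invariants O H n :=
  ((evalAt fun i => Pt.push φ (coordPt O H n i)).comp (invariants O H' n).val).codRestrict _ (by
    intro f A _ _ h hh g
    have key : ∀ g : Fin n → Pt O H A,
        evalAt g (evalAt (fun i => Pt.push φ (coordPt O H n i)) f.1) =
          evalAt (fun i => Pt.push φ (g i)) f.1 := by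
      intro g
      rw [← AlgHom.comp_apply, algHom_comp_evalAt]
      congr 2
      ext1 i
      rw [← map_evalAt_coordPt g i]
      rfl
    change evalAt _ (evalAt _ f.1) = evalAt _ (evalAt _ f.1)
    rw [key, key]
    simp only [map_mul, map_inv]
    exact f.2 A _ (push_mem_identityComponent φ hh) _)

end Points

/-! ### Pseudocharacters -/

section Pseudocharacters

variable (O : Type u) [CommRing O] (H : Type u) [CommRing H] [HopfAlgebra O H]
variable (Γ : Type u) [Group Γ]

/-- Lafforgue's `G`-pseudocharacters of `Γ` over `A`, for `G = Spec H`.  The component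
`Θ n` is the map `Θ_{n+1} : O[G^{n+1}]^{G⁰} → Map(Γ^{n+1}, A)`, so that `n + 1` runs through the
integers `≥ 1`. -/
@[ext]
structure PseudoChar (A : Type u) [CommRing A] [Algebra O A] where
  Θ : ∀ n : ℕ, invariants O H (n + 1) →ₐ[O] ((Fin (n + 1) → Γ) → A)
  reindex' : ∀ (m n : ℕ) (ζ : Fin (m + 1) → Fin (n + 1)) (f : invariants O H (m + 1))
    (γ : Fin (n + 1) → Γ), Θ n (reindex ζ f) γ = Θ m f (fun i => γ (ζ i))
  hat' : ∀ (n : ℕ) (f : invariants O H (n + 1)) (γ : Fin (n + 2) → Γ),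
    Θ (n + 1) (hat f) γ = Θ n f (mulLast γ)

variable {O H Γ}
variable {A B : Type u} [CommRing A] [Algebra O A] [CommRing B] [Algebra O B]

/-- Extension of scalars of pseudocharacters along `A → B`. -/
def PseudoChar.map (f : A →ₐ[O] B) (T : PseudoChar O H Γ A) : PseudoChar O H Γ B where
  Θ n := (f.compLeft (Fin (n + 1) → Γ)).comp (T.Θ n)
  reindex' m n ζ x γ := congrArg f (T.reindex' m n ζ x γ)
  hat' n x γ := congrArg f (T.hat' n x γ)

/-- The pseudocharacter `(γ₁,…,γₙ) ↦ f(ρ(γ₁),…,ρ(γₙ))` attached to a representation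
`ρ : Γ → G(A)`. -/
def PseudoChar.ofRep (ρ : Γ →* Pt O H A) : PseudoChar O H Γ A where
  Θ n := AlgHom.pi fun γ =>
    (evalAt fun i => ρ (γ i)).comp (invariants O H (n + 1)).val
  reindex' m n ζ f γ := evalAt_reindex ζ f _
  hat' n f γ := by
    refine (evalAt_hat f _).trans ?_
    have : mulLast (fun i => ρ (γ i)) = fun i => ρ (mulLast γ i) := by
      ext1 i
      exact (map_mulLast ρ γ i).symm
    rw [this]
    rfl

/-- The image of a pseudocharacter under a homomorphism of group schemes `G → G'`. -/
def PseudoChar.push {H' : Type u} [CommRing H'] [HopfAlgebra O H'] (φ : H' →ₐc[O] H)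
    (T : PseudoChar O H Γ A) : PseudoChar O H' Γ A where
  Θ n := (T.Θ n).comp (pullback φ (n + 1))
  reindex' m n ζ f γ := by
    have h : pullback φ (n + 1) (reindex ζ f) = reindex ζ (pullback φ (m + 1) f) := by
      apply Subtype.ext
      change evalAt _ (reindex ζ f).1 = evalAt _ (evalAt _ f.1)
      rw [evalAt_reindex, ← AlgHom.comp_apply, algHom_comp_evalAt]
      congr 2
      ext1 i
      exact congrArg (Pt.push φ)
        (map_evalAt_coordPt (fun i => coordPt O H (n + 1) (ζ i)) i).symm
    exact (congrArg (fun z => T.Θ n z γ) h).trans (T.reindex' m n ζ _ γ)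
  hat' n f γ := by
    have h : pullback φ (n + 2) (hat f) = hat (pullback φ (n + 1) f) := by
      apply Subtype.ext
      change evalAt _ (hat f).1 = evalAt _ (evalAt _ f.1)
      rw [evalAt_hat, ← AlgHom.comp_apply, algHom_comp_evalAt]
      congr 2
      ext1 i
      rw [← map_mulLast]
      exact congrArg (Pt.push φ) (map_evalAt_coordPt (mulLast (coordPt O H (n + 2))) i).symm
    exact (congrArg (fun z => T.Θ (n + 1) z γ) h).trans (T.hat' n _ γ)

theorem PseudoChar.map_ofRep (f : A →ₐ[O] B) (ρ : Γ →* Pt O H A) :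
    (PseudoChar.ofRep ρ).map f = PseudoChar.ofRep ((Pt.map H f).comp ρ) := by
  refine PseudoChar.ext (funext fun n => AlgHom.ext fun x => funext fun γ => ?_)
  exact DFunLike.congr_fun (algHom_comp_evalAt f fun i => ρ (γ i)) x.1

theorem PseudoChar.push_ofRep {H' : Type u} [CommRing H'] [HopfAlgebra O H'] (φ : H' →ₐc[O] H)
    (ρ : Γ →* Pt O H A) :
    (PseudoChar.ofRep ρ).push φ = PseudoChar.ofRep ((Pt.push φ).comp ρ) := by
  refine PseudoChar.ext (funext fun n => AlgHom.ext fun x => funext fun γ => ?_)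
  change evalAt (fun i => ρ (γ i)) (evalAt (fun i => Pt.push φ (coordPt O H (n + 1) i)) x.1) =
    evalAt (fun i => Pt.push φ (ρ (γ i))) x.1
  rw [← AlgHom.comp_apply, algHom_comp_evalAt]
  congr 2
  ext1 i
  exact congrArg (Pt.push φ) (map_evalAt_coordPt (fun i => ρ (γ i)) i)

end Pseudocharacters

/-! ### Constant group schemes -/

section Constant

/-- The coordinate ring `Map(Δ, O)` of the constant group scheme attached to a finite group `Δ`.
(A synonym of `Δ → O`, since the comultiplication depends on the group `Δ`.) -/
def ConstAlg (O Δ : Type u) : Type u := Δ → O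

namespace ConstAlg

variable {O Δ : Type u} [CommRing O]

instance : CommRing (ConstAlg O Δ) := inferInstanceAs (CommRing (Δ → O))

instance : Algebra O (ConstAlg O Δ) := inferInstanceAs (Algebra O (Δ → O))

open scoped Classical in
/-- The indicator function of an element of `Δ`. -/
def ind (s : Δ) : ConstAlg O Δ := fun t => if t = s then 1 else 0

/-- Evaluation at `s ∈ Δ`. -/
def ev (s : Δ) : ConstAlg O Δ →ₐ[O] O := Pi.evalAlgHom O (fun _ : Δ => O) s

theorem ext_ev {f g : ConstAlg O Δ} (h : ∀ s, ev s f = ev s g) : f = g := funext h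

open scoped Classical in
theorem ev_ind (s t : Δ) : ev (O := O) t (ind s) = if t = s then 1 else 0 := rfl

open scoped Classical in
theorem ind_mul_ind (s t : Δ) :
    (ind s * ind t : ConstAlg O Δ) = if s = t then ind s else 0 := by
  apply ext_ev
  intro r
  rw [map_mul, ev_ind, ev_ind]
  split_ifs with h1 h2 h3 h4 h5 <;> simp_all [ev_ind]

theorem sum_ind [Fintype Δ] (f : ConstAlg O Δ) : ∑ s, ev s f • ind s = f := by
  classical
  apply ext_ev
  intro r
  simp [map_sum, ev_ind]

variable [Group Δ]

/-- The antipode `f ↦ (s ↦ f s⁻¹)`. -/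
def antipodeMap : ConstAlg O Δ →ₗ[O] ConstAlg O Δ where
  toFun f := fun s => f s⁻¹
  map_add' _ _ := rfl
  map_smul' _ _ := rfl

theorem ev_antipodeMap (s : Δ) (f : ConstAlg O Δ) : ev s (antipodeMap f) = ev s⁻¹ f := rfl

variable [Finite Δ]

/-- The comultiplication of `Map(Δ, O)`: it sends `f` to `(s, t) ↦ f (s * t)` under the
identification of `Map(Δ, O) ⊗ Map(Δ, O)` with `Map(Δ × Δ, O)`. -/
def comulHom : ConstAlg O Δ →ₐ[O] ConstAlg O Δ ⊗[O] ConstAlg O Δ :=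
  letI := Fintype.ofFinite Δ
  AlgHom.ofLinearMap
    { toFun := fun f => ∑ s : Δ, ∑ t : Δ, ev (s * t) f • (ind s ⊗ₜ[O] ind t)
      map_add' := fun f g => by simp [add_smul, Finset.sum_add_distrib]
      map_smul' := fun r f => by simp [mul_smul, Finset.smul_sum] }
    (by
      have h : ∑ s : Δ, (ind s : ConstAlg O Δ) = 1 := by simpa using sum_ind (1 : ConstAlg O Δ)
      simp only [LinearMap.coe_mk, AddHom.coe_mk, map_one, one_smul]
      simp_rw [← TensorProduct.tmul_sum, ← TensorProduct.sum_tmul, h]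
      rfl)
    (fun f g => by
      classical
      simp only [LinearMap.coe_mk, AddHom.coe_mk, map_mul, Finset.sum_mul, Finset.mul_sum,
        smul_mul_smul_comm, Algebra.TensorProduct.tmul_mul_tmul, ind_mul_ind]
      refine Finset.sum_congr rfl fun s _ => Finset.sum_congr rfl fun t _ => ?_
      rw [Finset.sum_eq_single s, Finset.sum_eq_single t]
      · simp
      · intro b _ hb
        rw [if_neg hb, TensorProduct.tmul_zero, smul_zero]
      · simp
      · intro b _ hb
        refine Finset.sum_eq_zero fun c _ => ?_
        rw [if_neg hb, TensorProduct.zero_tmul, smul_zero]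
      · simp)

theorem comulHom_apply (f : ConstAlg O Δ) :
    letI := Fintype.ofFinite Δ
    comulHom f = ∑ s : Δ, ∑ t : Δ, ev (s * t) f • (ind s ⊗ₜ[O] ind t) := rfl

instance : Bialgebra O (ConstAlg O Δ) :=
  letI := Fintype.ofFinite Δ
  Bialgebra.ofAlgHom comulHom (ev 1)
    (by
      classical
      ext f
      have h1 : (Algebra.TensorProduct.map comulHom (AlgHom.id O (ConstAlg O Δ))) (comulHom f) =
          ∑ a : Δ, ∑ b : Δ, ∑ t : Δ, ev (a * b * t) f • ((ind a ⊗ₜ[O] ind b) ⊗ₜ[O] ind t) := by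
        rw [comulHom_apply f]
        simp only [map_sum, map_smul, Algebra.TensorProduct.map_tmul, AlgHom.id_apply,
          comulHom_apply (ind _), TensorProduct.sum_tmul, ev_ind, ite_smul, one_smul, zero_smul,
          TensorProduct.ite_tmul, Finset.smul_sum, smul_ite, smul_zero]
        trans ∑ t : Δ, ∑ a : Δ, ∑ b : Δ, ev (a * b * t) f • ((ind a ⊗ₜ[O] ind b) ⊗ₜ[O] ind t)
        · rw [Finset.sum_comm]
          refine Finset.sum_congr rfl fun t _ => ?_
          rw [Finset.sum_comm]
          refine Finset.sum_congr rfl fun a _ => ?_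
          rw [Finset.sum_comm]
          refine Finset.sum_congr rfl fun b _ => ?_
          simp
        · rw [Finset.sum_comm]
          refine Finset.sum_congr rfl fun a _ => ?_
          exact Finset.sum_comm
      have h2 : (Algebra.TensorProduct.map (AlgHom.id O (ConstAlg O Δ)) comulHom) (comulHom f) =
          ∑ a : Δ, ∑ b : Δ, ∑ t : Δ, ev (a * b * t) f • (ind a ⊗ₜ[O] (ind b ⊗ₜ[O] ind t)) := by
        rw [comulHom_apply f]
        simp only [map_sum, map_smul, Algebra.TensorProduct.map_tmul, AlgHom.id_apply,
          comulHom_apply (ind _), TensorProduct.tmul_sum, ev_ind, ite_smul, one_smul, zero_smul,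
          TensorProduct.tmul_ite, Finset.smul_sum, smul_ite, smul_zero]
        refine Finset.sum_congr rfl fun a _ => ?_
        rw [Finset.sum_comm]
        refine Finset.sum_congr rfl fun b _ => ?_
        rw [Finset.sum_comm]
        simp [mul_assoc]
      simp only [AlgHom.comp_apply, h1, h2, map_sum, map_smul]
      rfl)
    (by
      classical
      ext f
      have : (Algebra.TensorProduct.map (ev 1) (AlgHom.id O (ConstAlg O Δ))) (comulHom f) =
          1 ⊗ₜ[O] f := by
        rw [comulHom_apply f]
        simp only [map_sum, map_smul, Algebra.TensorProduct.map_tmul, AlgHom.id_apply, ev_ind]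
        rw [Finset.sum_eq_single 1]
        · conv_rhs => rw [← sum_ind f]
          simp [TensorProduct.tmul_sum]
        · intro b _ hb
          simp [Ne.symm hb]
        · simp
      simpa using this)
    (by
      classical
      ext f
      have : (Algebra.TensorProduct.map (AlgHom.id O (ConstAlg O Δ)) (ev 1)) (comulHom f) =
          f ⊗ₜ[O] 1 := by
        rw [comulHom_apply f]
        simp only [map_sum, map_smul, Algebra.TensorProduct.map_tmul, AlgHom.id_apply, ev_ind]
        conv_rhs => rw [← sum_ind f]
        rw [TensorProduct.sum_tmul]
        refine Finset.sum_congr rfl fun s _ => ?_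
        rw [Finset.sum_eq_single 1]
        · simp [TensorProduct.smul_tmul']
        · intro b _ hb
          simp [Ne.symm hb]
        · simp
      simpa using this)

theorem comul_apply (f : ConstAlg O Δ) : Coalgebra.comul (R := O) f = comulHom f := rfl

theorem counit_apply (f : ConstAlg O Δ) : Coalgebra.counit (R := O) f = ev 1 f := rfl

instance : HopfAlgebra O (ConstAlg O Δ) where
  antipode := antipodeMap
  mul_antipode_rTensor_comul := by
    classical
    let _ := Fintype.ofFinite Δ
    ext f
    apply ext_ev
    intro r
    simp only [LinearMap.comp_apply, comul_apply, comulHom_apply, counit_apply, map_sum, map_smul,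
      LinearMap.rTensor_tmul, LinearMap.mul'_apply, map_mul, ev_antipodeMap, ev_ind]
    rw [Finset.sum_eq_single r⁻¹, Finset.sum_eq_single r]
    · simp
    · intro b _ hb
      simp [Ne.symm hb]
    · simp
    · intro b _ hb
      simp [Ne.symm hb]
    · simp
  mul_antipode_lTensor_comul := by
    classical
    let _ := Fintype.ofFinite Δ
    ext f
    apply ext_ev
    intro r
    simp only [LinearMap.comp_apply, comul_apply, comulHom_apply, counit_apply, map_sum, map_smul,
      LinearMap.lTensor_tmul, LinearMap.mul'_apply, map_mul, ev_antipodeMap, ev_ind]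
    rw [Finset.sum_eq_single r, Finset.sum_eq_single r⁻¹]
    · simp
    · intro b _ hb
      simp [Ne.symm hb]
    · simp
    · intro b _ hb
      simp [Ne.symm hb]
    · simp

end ConstAlg

end Constant

/-! ### Split generalised tori -/

section Torus

variable {O M Δ A B : Type u} [CommRing O] [AddCommGroup M] [Group Δ]
  [CommRing A] [Algebra O A] [CommRing B] [Algebra O B]

variable (O) in
/-- The `A`-point of the constant group scheme given by an element of `Δ`. -/
def constPt [Finite Δ] (A : Type u) [CommRing A] [Algebra O A] :
    Δ →* Pt O (ConstAlg O Δ) A where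
  toFun s := toConv ((Algebra.ofId O A).comp (ConstAlg.ev s))
  map_one' := rfl
  map_mul' s t := by
    classical
    let _ := Fintype.ofFinite Δ
    apply ofConv_injective
    ext f
    change _ = (WithConv.toConv ((Algebra.ofId O A).comp (ConstAlg.ev s)) *
      WithConv.toConv ((Algebra.ofId O A).comp (ConstAlg.ev t)) :
        WithConv (ConstAlg O Δ →ₐ[O] A)).ofConv f
    rw [AlgHom.convMul_def]
    simp only [AlgHom.comp_apply, Bialgebra.comulAlgHom_apply, ConstAlg.comul_apply,
      ConstAlg.comulHom_apply, map_sum, map_smul, Algebra.TensorProduct.map_tmul,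
      Algebra.TensorProduct.lmul'_apply_tmul, ConstAlg.ev_ind]
    rw [Finset.sum_eq_single s, Finset.sum_eq_single t]
    · simp [Algebra.ofId_apply, Algebra.algebraMap_eq_smul_one]
    · intro b _ hb
      simp [Ne.symm hb]
    · simp
    · intro b _ hb
      simp [Ne.symm hb]
    · simp

theorem map_constPt [Finite Δ] (f : A →ₐ[O] B) (s : Δ) :
    Pt.map (ConstAlg O Δ) f (constPt O A s) = constPt O B s := by
  apply ofConv_injective
  ext x
  exact f.commutes _

/-- The group `𝔇(M)(A) = Hom(M, Aˣ)` of `A`-points of the diagonalisable group scheme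
`𝔇(M) = Spec O[M]`. -/
def TorusPt (M A : Type u) [AddCommGroup M] [CommRing A] : Type u := Multiplicative M →* Aˣ

instance : CommGroup (TorusPt M A) := inferInstanceAs (CommGroup (Multiplicative M →* Aˣ))

/-- The value of `t ∈ Hom(M, Aˣ)` at `m ∈ M`. -/
def TorusPt.val (t : TorusPt M A) (m : M) : Aˣ :=
  (show Multiplicative M →* Aˣ from t) (Multiplicative.ofAdd m)

/-- The map `Hom(M, Aˣ) → Hom(M, Bˣ)` induced by `A → B`. -/
def TorusPt.map (f : A →ₐ[O] B) : TorusPt M A →* TorusPt M B where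
  toFun t := (Units.map (f : A →* B)).comp (show Multiplicative M →* Aˣ from t)
  map_one' := MonoidHom.comp_one _
  map_mul' _ _ := MonoidHom.comp_mul _ _ _

/-- `Δ` acts on `Hom(M, Aˣ)` by `(δ • t)(m) = t(δ⁻¹ m)`. -/
instance [DistribMulAction Δ M] : MulDistribMulAction Δ (TorusPt M A) where
  smul δ t := (show Multiplicative M →* Aˣ from t).comp
    (AddMonoidHom.toMultiplicative (DistribSMul.toAddMonoidHom M δ⁻¹))
  one_smul t := MonoidHom.ext fun m => by
    change t.val ((1 : Δ)⁻¹ • m.toAdd) = t.val m.toAdd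
    rw [inv_one, one_smul]
  mul_smul δ ε t := MonoidHom.ext fun m => by
    change t.val ((δ * ε)⁻¹ • m.toAdd) = t.val (ε⁻¹ • δ⁻¹ • m.toAdd)
    rw [mul_inv_rev, mul_smul]
  smul_mul _ _ _ := rfl
  smul_one _ := rfl

theorem TorusPt.smul_val [DistribMulAction Δ M] (δ : Δ) (t : TorusPt M A) (m : M) :
    (δ • t).val m = t.val (δ⁻¹ • m) := rfl

theorem TorusPt.map_smul [DistribMulAction Δ M] (f : A →ₐ[O] B) (δ : Δ) (t : TorusPt M A) :
    TorusPt.map f (δ • t) = δ • TorusPt.map f t := rfl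

variable (O) in
/-- The identification of `Hom(M, Aˣ)` with the group of `A`-points of `Spec O[M]`. -/
def TorusPt.toPt : TorusPt M A →* Pt O (AddMonoidAlgebra O M) A where
  toFun t := AddMonoidAlgebra.liftMulEquiv O A M ((Units.coeHom A).comp t)
  map_one' := map_one (AddMonoidAlgebra.liftMulEquiv O A M)
  map_mul' s t := map_mul (AddMonoidAlgebra.liftMulEquiv O A M)
    ((Units.coeHom A).comp s) ((Units.coeHom A).comp t)

theorem TorusPt.toPt_map (f : A →ₐ[O] B) (t : TorusPt M A) :
    TorusPt.toPt O (TorusPt.map f t) = Pt.map _ f (TorusPt.toPt O t) := by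
  apply ofConv_injective
  refine AddMonoidAlgebra.algHom_ext (fun m => ?_) (Subsingleton.elim _ _)
  change AddMonoidAlgebra.lift O B M ((Units.coeHom B).comp ((Units.map (f : A →* B)).comp t))
    (AddMonoidAlgebra.single m 1) =
      f (AddMonoidAlgebra.lift O A M ((Units.coeHom A).comp t) (AddMonoidAlgebra.single m 1))
  rw [AddMonoidAlgebra.lift_single, AddMonoidAlgebra.lift_single, one_smul, one_smul]
  rfl

variable (O M Δ) in
/-- A generalised torus `G = Spec H` over `O` (a smooth affine group scheme) whose identity
component `G⁰` is the split torus `𝔇(M)`, where `M` is a free abelian group of finite rank, and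
whose component group `G/G⁰` is the constant group scheme attached to the finite group `Δ`.

* `incl` is the inclusion `𝔇(M) → G`; it identifies `𝔇(M)` with `G⁰`.
* `proj` is the projection `Π : G → G/G⁰`; it has kernel `G⁰` and is surjective as a map of fpqc
  sheaves. -/
structure SplitGeneralisedTorus (H : Type u) [CommRing H] [HopfAlgebra O H] [Finite Δ] where
  smooth : Algebra.Smooth O H
  free : Module.Free ℤ M
  finite : Module.Finite ℤ M
  incl : H →ₐc[O] AddMonoidAlgebra O M
  incl_injective : ∀ (A : Type u) [CommRing A] [Algebra O A],
    Function.Injective fun t : TorusPt M A => Pt.push incl (TorusPt.toPt O t)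
  range_incl : ∀ (A : Type u) [CommRing A] [Algebra O A],
    (Set.range fun t : TorusPt M A => Pt.push incl (TorusPt.toPt O t)) = identityComponent O H A
  proj : ConstAlg O Δ →ₐc[O] H
  proj_eq_one_iff : ∀ (A : Type u) [CommRing A] [Algebra O A] (g : Pt O H A),
    Pt.push proj g = 1 ↔ g ∈ identityComponent O H A
  proj_surjective : ∀ (A : Type u) [CommRing A] [Algebra O A] (x : Pt O (ConstAlg O Δ) A),
    ∃ (B : Type u) (_ : CommRing B) (_ : Algebra O B) (f : A →ₐ[O] B) (g : Pt O H B),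
      f.toRingHom.FaithfullyFlat ∧ Pt.push proj g = Pt.map _ f x

namespace SplitGeneralisedTorus

variable {H : Type u} [CommRing H] [HopfAlgebra O H] [Finite Δ]
  (G : SplitGeneralisedTorus O M Δ H)

/-- The inclusion `𝔇(M)(A) → G(A)`. -/
def ι (A : Type u) [CommRing A] [Algebra O A] : TorusPt M A →* Pt O H A :=
  (Pt.push G.incl).comp (TorusPt.toPt O)

/-- The projection `Π : G(A) → (G/G⁰)(A)`. -/
def Proj (A : Type u) [CommRing A] [Algebra O A] : Pt O H A →* Pt O (ConstAlg O Δ) A :=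
  Pt.push G.proj

theorem Proj_ι (t : TorusPt M A) : G.Proj A (G.ι A t) = 1 :=
  (G.proj_eq_one_iff A _).2 (G.range_incl A ▸ ⟨t, rfl⟩)

theorem ι_map (f : A →ₐ[O] B) (t : TorusPt M A) :
    G.ι B (TorusPt.map f t) = Pt.map H f (G.ι A t) := by
  simp only [ι, MonoidHom.comp_apply, TorusPt.toPt_map]
  rfl

/-- The given action of `Δ` on the character lattice `M` of `G⁰` is the one induced by the
conjugation action of `G` on `G⁰`: if `g ∈ G(A)` lies over `δ ∈ Δ`, then conjugation by `g` is the
automorphism `t ↦ δ • t` of `G⁰(A) = Hom(M, Aˣ)`, where `(δ • t)(m) = t(δ⁻¹ m)`. -/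
def IsConjugationAction [DistribMulAction Δ M] : Prop :=
  ∀ (A : Type u) [CommRing A] [Algebra O A] (g : Pt O H A) (δ : Δ),
    G.Proj A g = constPt O A δ → ∀ t : TorusPt M A, g * G.ι A t * g⁻¹ = G.ι A (δ • t)

/-! ### Admissible representations and admissible pseudocharacters -/

variable {Γ : Type u} [Group Γ] (π : Γ →* Δ)

/-- The set of admissible representations `ρ : Γ → G(A)`, i.e. those with `Π ∘ ρ = π`. -/
def Rep (A : Type u) [CommRing A] [Algebra O A] : Type u :=
  {ρ : Γ →* Pt O H A // ∀ γ, G.Proj A (ρ γ) = constPt O A (π γ)}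

variable {π}

/-- Extension of scalars of admissible representations. -/
def Rep.map (f : A →ₐ[O] B) (ρ : G.Rep π A) : G.Rep π B :=
  ⟨(Pt.map H f).comp ρ.1, fun γ =>
    (congrArg (Pt.map (ConstAlg O Δ) f) (ρ.2 γ)).trans (map_constPt f (π γ))⟩

/-- The group `𝔇(M)(A) = G⁰(A)` acts on the admissible representations by conjugation. -/
instance : MulAction (TorusPt M A) (G.Rep π A) where
  smul t ρ := ⟨(MulAut.conj (G.ι A t)).toMonoidHom.comp ρ.1, fun γ => by
    change G.Proj A (G.ι A t * ρ.1 γ * (G.ι A t)⁻¹) = _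
    rw [map_mul, map_mul, map_inv, Proj_ι, one_mul, inv_one, mul_one, ρ.2 γ]⟩
  one_smul ρ := Subtype.ext (MonoidHom.ext fun γ => by
    change G.ι A 1 * ρ.1 γ * (G.ι A 1)⁻¹ = ρ.1 γ
    simp)
  mul_smul s t ρ := Subtype.ext (MonoidHom.ext fun γ => by
    change G.ι A (s * t) * ρ.1 γ * (G.ι A (s * t))⁻¹ =
      G.ι A s * (G.ι A t * ρ.1 γ * (G.ι A t)⁻¹) * (G.ι A s)⁻¹
    simp [mul_assoc])

theorem Rep.smul_apply (t : TorusPt M A) (ρ : G.Rep π A) (γ : Γ) :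
    (t • ρ).1 γ = G.ι A t * ρ.1 γ * (G.ι A t)⁻¹ := rfl

theorem Rep.map_smul (f : A →ₐ[O] B) (t : TorusPt M A) (ρ : G.Rep π A) :
    Rep.map G f (t • ρ) = TorusPt.map f t • Rep.map G f ρ :=
  Subtype.ext (MonoidHom.ext fun γ => by
    rw [Rep.smul_apply, ι_map]
    change Pt.map H f (G.ι A t * ρ.1 γ * (G.ι A t)⁻¹) = _
    rw [map_mul, map_mul, map_inv]
    rfl)

variable (π) in
/-- The functor `A ↦ Rep(A)` of admissible representations. -/
def repFunctor : CommAlgCat.{u} O ⥤ Type u where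
  obj A := G.Rep π A
  map f := TypeCat.ofHom (Rep.map G f.hom)

/-- The map on sets of orbits induced by extension of scalars. -/
def orbitMap (f : A →ₐ[O] B) :
    MulAction.orbitRel.Quotient (TorusPt M A) (G.Rep π A) →
      MulAction.orbitRel.Quotient (TorusPt M B) (G.Rep π B) :=
  Quotient.map (Rep.map G f) (by
    rintro _ ρ ⟨t, rfl⟩
    exact ⟨TorusPt.map f t, (Rep.map_smul G f t ρ).symm⟩)

variable (π) in
/-- The presheaf quotient `A ↦ Rep(A) / 𝔇(M)(A)`. -/
def orbitFunctor : CommAlgCat.{u} O ⥤ Type u where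
  obj A := MulAction.orbitRel.Quotient (TorusPt M A) (G.Rep π A)
  map f := TypeCat.ofHom (orbitMap G f.hom)
  map_id A := by
    ext x
    induction x using Quotient.inductionOn
    rfl
  map_comp f g := by
    ext x
    induction x using Quotient.inductionOn
    rfl

variable (π) in
/-- The set of admissible `G`-pseudocharacters: those whose image under `Π : G → Δ` is the
pseudocharacter attached to `π`. -/
def PC (A : Type u) [CommRing A] [Algebra O A] : Type u :=
  {T : PseudoChar O H Γ A // T.push G.proj = PseudoChar.ofRep ((constPt O A).comp π)}

/-- Extension of scalars of admissible pseudocharacters. -/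
def PC.map (f : A →ₐ[O] B) (T : G.PC π A) : G.PC π B :=
  ⟨T.1.map f, by
    have h : (PseudoChar.ofRep ((constPt O A).comp π)).map f =
        PseudoChar.ofRep ((constPt O B).comp π) := by
      rw [PseudoChar.map_ofRep]
      congr 1
      exact MonoidHom.ext fun γ => map_constPt f (π γ)
    exact (congrArg (PseudoChar.map f) T.2).trans h⟩

/-- The admissible pseudocharacter attached to an admissible representation. -/
def PC.ofRep (ρ : G.Rep π A) : G.PC π A :=
  ⟨PseudoChar.ofRep ρ.1, by
    rw [PseudoChar.push_ofRep]
    congr 1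
    exact MonoidHom.ext ρ.2⟩

variable (π) in
/-- The functor `A ↦ PC(A)` of admissible pseudocharacters. -/
def pcFunctor : CommAlgCat.{u} O ⥤ Type u where
  obj A := G.PC π A
  map f := TypeCat.ofHom (PC.map G f.hom)

variable (π) in
/-- If `R` represents `Rep`, so that `R` is the coordinate ring of the scheme `Rep`, this is the
algebra of `G⁰`-invariant functions on `Rep`, i.e. the coordinate ring of the GIT quotient
`Rep // G⁰`.  A function `r` is invariant if `r(t • ρ) = r(ρ)` for all `O`-algebras `A`, all
`t ∈ G⁰(A)` and all `ρ ∈ Rep(A)`. -/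
def repInvariants {R : CommAlgCat.{u} O} (c : (G.repFunctor π).CorepresentableBy R) :
    Subalgebra O R where
  carrier := {r | ∀ (A : CommAlgCat.{u} O) (t : TorusPt M A) (ρ : G.Rep π A),
    (c.homEquiv.symm (t • ρ : G.Rep π A)).hom r = (c.homEquiv.symm ρ).hom r}
  mul_mem' hx hy A t ρ := by rw [map_mul, map_mul, hx A t ρ, hy A t ρ]
  add_mem' hx hy A t ρ := by rw [map_add, map_add, hx A t ρ, hy A t ρ]
  algebraMap_mem' r A t ρ := by rw [AlgHom.commutes, AlgHom.commutes]

end SplitGeneralisedTorus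

end Torus

/-! ### Cocycles -/

section Cocycles

variable {Γ Δ : Type u} [Group Γ] [Group Δ] (π : Γ →* Δ)
  (M : Type u) [AddCommGroup M] [DistribMulAction Δ M]

/-- The group `Z¹(Γ, 𝔇(M)(A))` of `1`-cocycles, where `Γ` acts on `𝔇(M)(A) = Hom(M, Aˣ)` through
`π : Γ → Δ`. -/
def Z1 (A : Type u) [CommRing A] : Subgroup (Γ → TorusPt M A) where
  carrier := {Φ | ∀ γ γ', Φ (γ * γ') = Φ γ * π γ • Φ γ'}
  one_mem' γ γ' := by simp
  mul_mem' {Φ Ψ} hΦ hΨ γ γ' := by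
    simp only [Pi.mul_apply, hΦ γ γ', hΨ γ γ', smul_mul']
    exact mul_mul_mul_comm _ _ _ _
  inv_mem' {Φ} hΦ γ γ' := by
    simp only [Pi.inv_apply, hΦ γ γ', smul_inv', mul_inv]

variable {M} in
/-- The coboundary `γ ↦ t · (γ t)⁻¹` of `t ∈ 𝔇(M)(A)`. -/
def coboundary {A : Type u} [CommRing A] : TorusPt M A →* Z1 π M A where
  toFun t := ⟨fun γ => t * (π γ • t)⁻¹, fun γ γ' => by
    simp [mul_smul, smul_mul', smul_inv', mul_assoc]⟩
  map_one' := by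
    apply Subtype.ext
    funext γ
    simp
  map_mul' s t := by
    apply Subtype.ext
    funext γ
    simp only [smul_mul', mul_inv]
    exact mul_mul_mul_comm _ _ _ _

/-- The group `B¹(Γ, 𝔇(M)(A))` of `1`-coboundaries. -/
def B1 (A : Type u) [CommRing A] : Subgroup (Z1 π M A) := (coboundary π).range

/-- The group `H¹(Γ, 𝔇(M)(A))`. -/
abbrev H1 (A : Type u) [CommRing A] : Type u := Z1 π M A ⧸ B1 π M A

variable {O : Type u} [CommRing O] {A B : Type u} [CommRing A] [Algebra O A] [CommRing B]
  [Algebra O B]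

variable {M} in
/-- The map on cocycles induced by `A → B`. -/
def Z1.map (f : A →ₐ[O] B) : Z1 π M A →* Z1 π M B where
  toFun Φ := ⟨fun γ => TorusPt.map f (Φ.1 γ), fun γ γ' => by
    change TorusPt.map f (Φ.1 (γ * γ')) = TorusPt.map f (Φ.1 γ) * π γ • TorusPt.map f (Φ.1 γ')
    rw [Φ.2 γ γ', map_mul, TorusPt.map_smul]⟩
  map_one' := Subtype.ext (funext fun _ => map_one (TorusPt.map f))
  map_mul' Φ Ψ := Subtype.ext (funext fun γ => map_mul (TorusPt.map f) (Φ.1 γ) (Ψ.1 γ))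

variable {M} in
/-- The map on `H¹` induced by `A → B`. -/
def H1.map (f : A →ₐ[O] B) : H1 π M A →* H1 π M B :=
  QuotientGroup.map _ _ (Z1.map π f) (by
    rintro _ ⟨t, rfl⟩
    refine ⟨TorusPt.map f t, Subtype.ext (funext fun γ => ?_)⟩
    change TorusPt.map f t * (π γ • TorusPt.map f t)⁻¹ = TorusPt.map f (t * (π γ • t)⁻¹)
    rw [map_mul, map_inv, TorusPt.map_smul])

variable (O) in
/-- The functor `A ↦ Z¹(Γ, 𝔇(M)(A))`. -/
def z1Functor : CommAlgCat.{u} O ⥤ Type u where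
  obj A := Z1 π M A
  map f := TypeCat.ofHom (Z1.map π f.hom)

variable (O) in
/-- The functor `A ↦ H¹(Γ, 𝔇(M)(A))`. -/
def h1Functor : CommAlgCat.{u} O ⥤ Type u where
  obj A := H1 π M A
  map f := TypeCat.ofHom (H1.map π f.hom)
  map_id A := by
    ext x
    induction x using QuotientGroup.induction_on
    rfl
  map_comp f g := by
    ext x
    induction x using QuotientGroup.induction_on
    rfl

/-! ### Group homology -/

/-- The differential `C₁(Γ, M) → C₀(Γ, M)` of the inhomogeneous chain complex,
`m·[γ] ↦ γ⁻¹ m - m`; the group `Γ` acts on `M` through `π`. -/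
def d₁ : (Γ →₀ M) →+ M :=
  Finsupp.liftAddHom fun γ => DistribSMul.toAddMonoidHom M (π γ)⁻¹ - AddMonoidHom.id M

/-- The differential `C₂(Γ, M) → C₁(Γ, M)` of the inhomogeneous chain complex,
`m·[γ, γ'] ↦ γ⁻¹m·[γ'] - m·[γγ'] + m·[γ]`. -/
def d₂ : (Γ × Γ →₀ M) →+ (Γ →₀ M) :=
  Finsupp.liftAddHom fun p =>
    (Finsupp.singleAddHom p.2).comp (DistribSMul.toAddMonoidHom M (π p.1)⁻¹) -
      Finsupp.singleAddHom (p.1 * p.2) + Finsupp.singleAddHom p.1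

/-- The homology group `H₁(Γ, M)`. -/
abbrev HomologyOne : Type u := (d₁ π M).ker ⧸ (d₂ π M).range.addSubgroupOf (d₁ π M).ker

end Cocycles

/-! ### The module `ℰ` -/

section ModuleE

variable {Γ Δ : Type u} [Group Γ] [Group Δ]

/-- A choice of a representative `c̄ ∈ Γ` of each coset `c ∈ Δ = Γ/ker π`, such that the trivial
coset is represented by `1`. -/
structure CosetReps (π : Γ →* Δ) where
  rep : Δ → Γ
  π_rep : ∀ c, π (rep c) = c
  rep_one : rep 1 = 1

variable (Δ) in
/-- The augmentation ideal `I_Δ` of the group ring `ℤ[Δ]`. -/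
abbrev AugIdeal : Submodule ℤ (Δ →₀ ℤ) :=
  LinearMap.ker (Finsupp.linearCombination ℤ fun _ : Δ => (1 : ℤ))

/-- The abelian group `Γ₂^ab`, written additively, where `Γ₂ = ker π`. -/
abbrev KerAb (π : Γ →* Δ) : Type u := Additive (Abelianization π.ker)

/-- The image in `Γ₂^ab` of an element of `Γ₂ = ker π`. -/
def kerMk (π : Γ →* Δ) (k : π.ker) : KerAb π := Additive.ofMul (Abelianization.of k)

/-- The abelian group underlying `ℰ`, namely `Γ₂^ab ⊕ I_Δ`. -/
abbrev ModE (π : Γ →* Δ) : Type u := KerAb π × AugIdeal Δ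

/-- Conjugation `k ↦ g k g⁻¹` on `Γ₂^ab`, for `g ∈ Γ`. -/
def conjKer (π : Γ →* Δ) (g : Γ) : KerAb π →ₗ[ℤ] KerAb π :=
  (MonoidHom.toAdditive
    (Abelianization.map (MulAut.conjNormal (H := π.ker) g).toMonoidHom)).toIntLinearMap

theorem conjKer_kerMk (π : Γ →* Δ) (g : Γ) (k : π.ker) :
    conjKer π g (kerMk π k) = kerMk π (MulAut.conjNormal g k) := rfl

theorem kerMk_mul (π : Γ →* Δ) (k l : π.ker) : kerMk π (k * l) = kerMk π k + kerMk π l := rfl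

theorem kerMk_induction (π : Γ →* Δ) {P : KerAb π → Prop} (h : ∀ k, P (kerMk π k)) (x : KerAb π) :
    P x := by
  obtain ⟨k, hk⟩ := QuotientGroup.mk_surjective (Additive.toMul x)
  have : x = kerMk π k := congrArg Additive.ofMul hk.symm
  exact this ▸ h k

theorem conjKer_mul (π : Γ →* Δ) (g h : Γ) (x : KerAb π) :
    conjKer π (g * h) x = conjKer π g (conjKer π h x) := by
  induction x using kerMk_induction with
  | h k => simp [conjKer_kerMk]

theorem conjKer_of_mem (π : Γ →* Δ) (g : Γ) (hg : g ∈ π.ker) (x : KerAb π) :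
    conjKer π g x = x := by
  induction x using kerMk_induction with
  | h k =>
    have : (MulAut.conjNormal g k : π.ker) = ⟨g, hg⟩ * k * ⟨g, hg⟩⁻¹ := by
      apply Subtype.ext
      simp [MulAut.conjNormal_apply]
    rw [conjKer_kerMk, this, kerMk_mul, kerMk_mul, add_right_comm, ← kerMk_mul, mul_inv_cancel]
    exact zero_add _

namespace CosetReps

variable {π : Γ →* Δ} (s : CosetReps π)

/-- The `2`-cocycle `κ(d, c) ∈ Γ₂^ab`, the image of `d̄ c̄ (dc)‾⁻¹`. -/
def κ (d c : Δ) : KerAb π :=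
  kerMk π ⟨s.rep d * s.rep c * (s.rep (d * c))⁻¹, by
    simp [MonoidHom.mem_ker, s.π_rep]⟩

/-- The additive extension `ℤ[Δ] → Γ₂^ab` of `c ↦ κ(d, c)`. As `κ(d, 1) = 0`, its restriction to
`I_Δ` sends `c - 1` to `κ(d, c)`. -/
def κLin (d : Δ) : (Δ →₀ ℤ) →ₗ[ℤ] KerAb π := Finsupp.linearCombination ℤ (s.κ d)

/-- Left multiplication by `d` on `I_Δ`. -/
def augMul (d : Δ) : AugIdeal Δ →ₗ[ℤ] AugIdeal Δ :=
  (Finsupp.lmapDomain ℤ ℤ (d * ·)).restrict (by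
    intro x hx
    rw [LinearMap.mem_ker] at hx ⊢
    rw [Finsupp.lmapDomain_apply, Finsupp.linearCombination_mapDomain]
    exact hx)

theorem κ_cocycle (d e c : Δ) :
    conjKer π (s.rep d) (s.κ e c) + s.κ d (e * c) = s.κ d e + s.κ (d * e) c := by
  rw [κ, κ, κ, κ, conjKer_kerMk, ← kerMk_mul, ← kerMk_mul]
  congr 1
  apply Subtype.ext
  simp [MulAut.conjNormal_apply, mul_assoc]

theorem κ_one_right (d : Δ) : s.κ d 1 = 0 := by
  have : (⟨s.rep d * s.rep 1 * (s.rep (d * 1))⁻¹, by simp [MonoidHom.mem_ker, s.π_rep]⟩ : π.ker) = 1 := by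
    apply Subtype.ext
    simp [s.rep_one]
  rw [κ, this]
  rfl

theorem κ_one_left (c : Δ) : s.κ 1 c = 0 := by
  have : (⟨s.rep 1 * s.rep c * (s.rep (1 * c))⁻¹, by simp [MonoidHom.mem_ker, s.π_rep]⟩ : π.ker) = 1 := by
    apply Subtype.ext
    simp [s.rep_one]
  rw [κ, this]
  rfl

theorem conjKer_rep_mul (d e : Δ) (x : KerAb π) :
    conjKer π (s.rep d) (conjKer π (s.rep e) x) = conjKer π (s.rep (d * e)) x := by
  have h : s.rep d * s.rep e =
      s.rep d * s.rep e * (s.rep (d * e))⁻¹ * s.rep (d * e) := by simp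
  rw [← conjKer_mul, h, conjKer_mul, conjKer_of_mem]
  simp [MonoidHom.mem_ker, s.π_rep]

theorem κLin_mul (d e : Δ) (x : AugIdeal Δ) :
    conjKer π (s.rep d) (s.κLin e x.1) + s.κLin d (augMul e x).1 = s.κLin (d * e) x.1 := by
  have key : ∀ y : Δ →₀ ℤ, conjKer π (s.rep d) (s.κLin e y) +
      s.κLin d (Finsupp.mapDomain (e * ·) y) =
      Finsupp.linearCombination ℤ (fun _ : Δ => (1 : ℤ)) y • s.κ d e + s.κLin (d * e) y := by
    intro y
    induction y using Finsupp.induction_linear with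
    | zero => simp
    | add f g hf hg =>
      simp only [map_add, Finsupp.mapDomain_add, add_smul]
      rw [add_add_add_comm, hf, hg, add_add_add_comm]
    | single c n =>
      simp only [κLin, Finsupp.linearCombination_single, Finsupp.mapDomain_single, map_smul]
      rw [← smul_add, κ_cocycle, smul_add, smul_eq_mul, mul_one]
  have h := key x.1
  rw [LinearMap.mem_ker.1 x.2, zero_smul, zero_add] at h
  exact h

/-- The `ℤ[Δ]`-module `ℰ`: the group `Γ₂^ab ⊕ I_Δ` with the action of `Δ` determined by
`d ∗ (k, c - 1) = (d k d⁻¹ · κ(d, c), dc - d)`. -/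
def repE : Representation ℤ Δ (ModE π) where
  toFun d :=
    { toFun := fun x => (conjKer π (s.rep d) x.1 + s.κLin d x.2.1, augMul d x.2)
      map_add' := fun x y => by
        refine Prod.ext ?_ ?_
        · simp only [Prod.fst_add, Prod.snd_add, map_add, Submodule.coe_add]
          exact add_add_add_comm _ _ _ _
        · simp
      map_smul' := fun n x => by
        refine Prod.ext ?_ ?_
        · simp only [Prod.smul_fst, Prod.smul_snd, map_smul, SetLike.val_smul, smul_add,
            RingHom.id_apply]
        · simp }
  map_one' := by
    refine LinearMap.ext fun x => Prod.ext ?_ ?_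
    · have h1 : s.κLin 1 x.2.1 = 0 := by
        have : s.κ 1 = fun _ => 0 := funext s.κ_one_left
        simp [κLin, this, Finsupp.linearCombination_apply]
      change conjKer π (s.rep 1) x.1 + s.κLin 1 x.2.1 = x.1
      rw [h1, s.rep_one, conjKer_of_mem π 1 (one_mem _), add_zero]
    · apply Subtype.ext
      change Finsupp.mapDomain (fun c => 1 * c) x.2.1 = x.2.1
      simp only [one_mul]
      exact Finsupp.mapDomain_id
  map_mul' d e := by
    refine LinearMap.ext fun x => Prod.ext ?_ ?_
    · change conjKer π (s.rep (d * e)) x.1 + s.κLin (d * e) x.2.1 =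
        conjKer π (s.rep d) (conjKer π (s.rep e) x.1 + s.κLin e x.2.1) +
          s.κLin d (augMul e x.2).1
      rw [map_add, add_assoc, κLin_mul, conjKer_rep_mul]
    · apply Subtype.ext
      change Finsupp.mapDomain (fun c => d * e * c) x.2.1 =
        Finsupp.mapDomain (d * ·) (Finsupp.mapDomain (e * ·) x.2.1)
      rw [← Finsupp.mapDomain_comp]
      congr 1
      funext c
      exact mul_assoc _ _ _

/-- The element `(γ · γ̄⁻¹, γ - 1)` of `ℰ = Γ₂^ab ⊕ I_Δ`, where `γ̄` is the chosen
representative of the coset of `γ`. -/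
def elt (γ : Γ) : ModE π :=
  (kerMk π ⟨γ * (s.rep (π γ))⁻¹, by simp [MonoidHom.mem_ker, s.π_rep]⟩,
    ⟨Finsupp.single (π γ) 1 - Finsupp.single 1 1, by simp⟩)

variable (M : Type u) [AddCommGroup M] [DistribMulAction Δ M]

/-- The coinvariants `(ℰ ⊗ M)_Δ` for the diagonal action of `Δ`. -/
abbrev Coinv : Type u :=
  (s.repE.tprod (Representation.ofDistribMulAction ℤ Δ M)).Coinvariants

variable {M} in
/-- The universal cocycle `Φ_nat(γ)(m) = [(γ · γ̄⁻¹, γ - 1) ⊗ m] ∈ (ℰ ⊗ M)_Δ`. -/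
def natCocycle (γ : Γ) (m : M) : s.Coinv M :=
  Representation.Coinvariants.mk _ (s.elt γ ⊗ₜ[ℤ] m)

end CosetReps

end ModuleE

/-! ### Sheaves for the fpqc topology -/

section Fpqc

variable {O : Type u} [CommRing O]

/-- A functor on `O`-algebras (that is, a presheaf on affine `O`-schemes) is an fpqc sheaf if
compatible families glue uniquely along every finite jointly surjective family of flat morphisms
`Spec Bᵢ → Spec A`. -/
def IsFpqcSheaf (F : CommAlgCat.{u} O ⥤ Type u) : Prop :=
  ∀ (A : CommAlgCat.{u} O) (n : ℕ) (B : Fin n → CommAlgCat.{u} O) (f : ∀ i, A ⟶ B i),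
    (∀ i, (f i).hom.toRingHom.Flat) →
    (∀ P : PrimeSpectrum A, ∃ i, P ∈ Set.range (PrimeSpectrum.comap (f i).hom.toRingHom)) →
    ∀ x : ∀ i, F.obj (B i),
      (∀ (i j : Fin n) (C : CommAlgCat.{u} O) (g : B i ⟶ C) (h : B j ⟶ C),
        f i ≫ g = f j ≫ h → F.map g (x i) = F.map h (x j)) →
      ∃! y : F.obj A, ∀ i, F.map (f i) y = x i

/-- `η : P → F` exhibits `F` as the fpqc sheafification of the presheaf `P`. -/
def IsFpqcSheafification {P F : CommAlgCat.{u} O ⥤ Type u} (η : P ⟶ F) : Prop :=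
  IsFpqcSheaf F ∧ ∀ F' : CommAlgCat.{u} O ⥤ Type u, IsFpqcSheaf F' →
    ∀ α : P ⟶ F', ∃! β : F ⟶ F', η ≫ β = α

variable (O) in
/-- The group algebra `O[W]` of an abelian group `W`, as an object of the category of commutative
`O`-algebras. -/
abbrev grpAlg (W : Type u) [AddCommGroup W] : CommAlgCat.{u} O :=
  CommAlgCat.of O (AddMonoidAlgebra O W)

end Fpqc

/-! ### Evaluation of natural transformations at points -/

section Evaluation

namespace SplitGeneralisedTorus

variable {O M Δ H Γ : Type u} [CommRing O] [AddCommGroup M] [Group Δ] [Finite Δ]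
  [CommRing H] [HopfAlgebra O H] [Group Γ] (G : SplitGeneralisedTorus O M Δ H) {π : Γ →* Δ}

/-- The admissible representation which is the image of the cocycle `Φ` under `b`. -/
def ofCocycle [DistribMulAction Δ M] (b : z1Functor π M O ⟶ G.repFunctor π)
    (A : CommAlgCat.{u} O) (Φ : Z1 π M A) : G.Rep π A :=
  b.app A Φ

/-- The admissible representation which corresponds to a point `ψ : R → A` of a representing
object. -/
def ofPoint {R : CommAlgCat.{u} O} (c : (G.repFunctor π).CorepresentableBy R)
    (A : CommAlgCat.{u} O) (ψ : R ⟶ A) : G.Rep π A :=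
  c.homEquiv ψ

/-- The orbit of an admissible representation. -/
def orbit (A : CommAlgCat.{u} O) (ρ : G.Rep π A) : (G.orbitFunctor π).obj A :=
  Quotient.mk (MulAction.orbitRel (TorusPt M A) (G.Rep π A)) ρ

/-- The point `R → A` which is the image of the orbit of `ρ` under `q : Rep/𝔇(M) → Spec R`. -/
def quotientPoint {R : CommAlgCat.{u} O} (q : G.orbitFunctor π ⟶ coyoneda.obj (Opposite.op R))
    (A : CommAlgCat.{u} O) (ρ : G.Rep π A) : R →ₐ[O] A :=
  (q.app A (G.orbit A ρ)).hom

end SplitGeneralisedTorus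

end Evaluation

end

end GenTorus

/-! Everything reduces to diagonalisable groups once `ρ₀` is used as a base point. Since the kernel
of Π is G⁰ = 𝔇(M), an admissible ρ has the form Φρ₀ with Φ : Γ → 𝔇(M)(A), and ρ is multiplicative
exactly when Φ is a cocycle; conjugating ρ by t multiplies Φ by the coboundary of t
(`twist_bijective`, `twistEquiv_coboundary_mul`).

Cocycles with values in Hom(M, W) are the homomorphisms from (ℰ ⊗ M)_Δ to W: the map γ ↦ `elt γ` is
a crossed homomorphism whose values generate ℰ (`elt_mul`, `closure_elt`), and every cocycle extends
along it (`coinvLift`). The group C₁/B₁ of chains modulo boundaries solves the same universal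
problem, because the relations d₂(m[γ, γ']) = 0 are the cocycle identity. Hence (ℰ ⊗ M)_Δ ≅ C₁/B₁;
the differential d₁ becomes a homomorphism ∂ : (ℰ ⊗ M)_Δ → M (`boundary`), and φ_nat identifies
H₁(Γ, M) with ker ∂.

So Rep is 𝔇((ℰ ⊗ M)_Δ), and 𝔇(M) acts on it by translation through the dual of -∂
(`charRepEquiv_symm_smul`). The quotient must be 𝔇(ker ∂) = 𝔇(H₁). As im ∂ lies in the lattice M it
is free, so ker ∂ is a direct summand and Rep → 𝔇(H₁) is surjective on A-points for every A. Two
points with the same image differ by a character of im ∂, which extends to M after a faithfully flat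
base change, because O[M] is free over O[im ∂]; this gives the fpqc quotient. Invariant functions
are those of weight zero for the grading of O[(ℰ ⊗ M)_Δ] by -∂, that is O[ker ∂]; this gives the GIT
quotient.

For a pseudocharacter Θ, admissibility forces the value 1 at (γ₁, …, γₙ) on the idempotent of the
component of Gⁿ over (πγ₁, …, πγₙ), so Θ sees only that component. Through `ρ₀` the component is
𝔇(Mⁿ), and conjugation by h scales the character (mᵢ) by h(-d₁(∑ mᵢ[γᵢ])), so the invariant
functions on it are spanned by the characters for which ∑ mᵢ[γᵢ] is a cycle. Thus Θ amounts to a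
function on cycles. It is multiplicative because Θ consists of ring homomorphisms, it depends only
on the chain because of the reindexing axiom, and it is trivial on boundaries because of the axiom
for f̂. The resulting character of H₁ determines Θ (`PC.ext_cycleVal`), and every character of H₁
arises from a representation by the splitting above. -/

namespace GenTorus

noncomputable section

/-! ### Characters of abelian groups and points of group algebras. -/

section TorusPoints

variable {O W V U A B : Type u} [CommRing O] [AddCommGroup W] [AddCommGroup V] [AddCommGroup U]
  [CommRing A] [Algebra O A] [CommRing B] [Algebra O B]

namespace TorusPt

theorem ext_val {s t : TorusPt W A} (h : ∀ w, s.val w = t.val w) : s = t :=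
  MonoidHom.ext fun w => h w.toAdd

theorem val_add (t : TorusPt W A) (v w : W) : t.val (v + w) = t.val v * t.val w :=
  MonoidHom.map_mul (show Multiplicative W →* Aˣ from t) _ _

theorem val_zero (t : TorusPt W A) : t.val 0 = 1 :=
  MonoidHom.map_one (show Multiplicative W →* Aˣ from t)

theorem val_neg (t : TorusPt W A) (w : W) : t.val (-w) = (t.val w)⁻¹ :=
  MonoidHom.map_inv (show Multiplicative W →* Aˣ from t) _

theorem val_sub (t : TorusPt W A) (v w : W) : t.val (v - w) = t.val v * (t.val w)⁻¹ := by
  rw [sub_eq_add_neg, val_add, val_neg]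

theorem mul_val (s t : TorusPt W A) (w : W) : (s * t).val w = s.val w * t.val w := rfl

theorem inv_val (t : TorusPt W A) (w : W) : t⁻¹.val w = (t.val w)⁻¹ := rfl

theorem map_val (f : A →ₐ[O] B) (t : TorusPt W A) (w : W) :
    ((TorusPt.map f t).val w : B) = f (t.val w) := rfl

/-- A character `W → Aˣ`, as a homomorphism of additive groups. -/
def toAddHom (t : TorusPt W A) : W →+ Additive Aˣ where
  toFun w := Additive.ofMul (t.val w)
  map_zero' := congrArg Additive.ofMul t.val_zero
  map_add' v w := congrArg Additive.ofMul (t.val_add v w)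

/-- The character `W → Aˣ` given by a homomorphism of additive groups. -/
def ofAddHom (f : W →+ Additive Aˣ) : TorusPt W A :=
  (show Multiplicative W →* Aˣ from AddMonoidHom.toMultiplicativeLeft f)

theorem ofAddHom_val (f : W →+ Additive Aˣ) (w : W) : (ofAddHom f).val w = (f w).toMul := rfl

theorem toAddHom_apply (t : TorusPt W A) (w : W) : t.toAddHom w = Additive.ofMul (t.val w) := rfl

theorem val_finsuppSum {ι N : Type*} [Zero N] (t : TorusPt W A) (z : ι →₀ N) (f : ι → N → W) :
    t.val (z.sum f) = z.prod fun i n => t.val (f i n) := by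
  have := map_finsuppSum t.toAddHom z f
  exact this

theorem val_sum {ι : Type*} (t : TorusPt W A) (z : Finset ι) (f : ι → W) :
    t.val (∑ i ∈ z, f i) = ∏ i ∈ z, t.val (f i) := by
  have := map_sum t.toAddHom f z
  exact this

/-- The pullback of characters along a homomorphism `V → W`. -/
def comap (f : V →+ W) (t : TorusPt W A) : TorusPt V A := ofAddHom (t.toAddHom.comp f)

theorem comap_val (f : V →+ W) (t : TorusPt W A) (v : V) : (comap f t).val v = t.val (f v) := rfl

variable (O) in
/-- The morphism of algebras `O[W] → A` given by a character `W → Aˣ`. -/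
def charHom (t : TorusPt W A) : AddMonoidAlgebra O W →ₐ[O] A := (TorusPt.toPt O t).ofConv

theorem charHom_single (t : TorusPt W A) (w : W) (r : O) :
    t.charHom O (AddMonoidAlgebra.single w r) = r • (t.val w : A) := by
  change AddMonoidAlgebra.lift O A W ((Units.coeHom A).comp t) (AddMonoidAlgebra.single w r) = _
  rw [AddMonoidAlgebra.lift_single]
  rfl

theorem charHom_single_one (t : TorusPt W A) (w : W) :
    t.charHom O (AddMonoidAlgebra.single w 1) = (t.val w : A) := by
  rw [charHom_single, one_smul]

variable (O W) in
/-- The universal character `W → O[W]ˣ`. -/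
def univ : TorusPt W (AddMonoidAlgebra O W) :=
  (show Multiplicative W →* (AddMonoidAlgebra O W)ˣ from
    (AddMonoidAlgebra.of O W).toHomUnits)

theorem univ_val (w : W) :
    ((univ O W).val w : AddMonoidAlgebra O W) = AddMonoidAlgebra.single w 1 := rfl

theorem charHom_ext {f g : AddMonoidAlgebra O W →ₐ[O] A}
    (h : ∀ w, f (AddMonoidAlgebra.single w 1) = g (AddMonoidAlgebra.single w 1)) : f = g :=
  AddMonoidAlgebra.algHom_ext h (Subsingleton.elim _ _)

variable (O) in
/-- Morphisms of algebras `O[W] → A` correspond to characters `W → Aˣ`. -/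
def charEquiv : TorusPt W A ≃ (AddMonoidAlgebra O W →ₐ[O] A) where
  toFun t := t.charHom O
  invFun ψ := TorusPt.map ψ (univ O W)
  left_inv t := ext_val fun w => Units.ext <| by
    rw [map_val, univ_val, charHom_single_one]
  right_inv ψ := charHom_ext fun w => by
    rw [charHom_single_one, map_val, univ_val]

theorem charEquiv_symm_val (ψ : AddMonoidAlgebra O W →ₐ[O] A) (w : W) :
    (((charEquiv O).symm ψ).val w : A) = ψ (AddMonoidAlgebra.single w 1) := rfl

theorem comp_charHom (f : A →ₐ[O] B) (t : TorusPt W A) :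
    f.comp (t.charHom O) = (TorusPt.map f t).charHom O :=
  charHom_ext fun w => by
    rw [AlgHom.comp_apply, charHom_single_one, charHom_single_one, map_val]

theorem charHom_comp_mapDomain (f : V →+ W) (t : TorusPt W A) :
    (t.charHom O).comp (AddMonoidAlgebra.mapDomainAlgHom O O f) = (comap f t).charHom O :=
  charHom_ext fun w => by
    rw [AlgHom.comp_apply, AddMonoidAlgebra.mapDomainAlgHom_apply, AddMonoidAlgebra.mapDomain_single,
      charHom_single_one, charHom_single_one, comap_val]

/-- Morphisms `O[W] ⟶ A` in the category of algebras correspond to characters `W → Aˣ`. -/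
def pointEquiv (A : CommAlgCat.{u} O) : (grpAlg O W ⟶ A) ≃ TorusPt W A where
  toFun ψ := (charEquiv O).symm ψ.hom
  invFun t := CommAlgCat.ofHom (t.charHom O)
  left_inv ψ := CommAlgCat.hom_ext ((charEquiv O).apply_symm_apply ψ.hom)
  right_inv t := (charEquiv O).symm_apply_apply t

end TorusPt

/-- An element of `O[V]` on which the homomorphisms induced by `v ↦ (v, D v)` and `v ↦ (v, 0)`
agree is homogeneous of weight zero for the grading by `D`. -/
theorem eq_zero_of_mem_support_of_graph (D : V →+ W) (x : AddMonoidAlgebra O V)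
    (h : AddMonoidAlgebra.mapDomainAlgHom O O ((AddMonoidHom.id V).prod D) x =
      AddMonoidAlgebra.mapDomainAlgHom O O ((AddMonoidHom.id V).prod 0) x)
    {v : V} (hv : v ∈ x.coeff.support) : D v = 0 := by
  by_contra hne
  -- Compare coefficients at (v, D v): the graph map is injective, so one side gives the coefficient
  -- of `x` at v, while the other side is supported on V × 0.
  have h1 := congrArg (fun y => y.coeff (v, D v)) h
  simp only [AddMonoidAlgebra.mapDomainAlgHom_apply, AddMonoidAlgebra.coeff_mapDomain] at h1
  have hinj : Function.Injective ((AddMonoidHom.id V).prod D) := fun a b hab =>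
    congrArg Prod.fst hab
  have e1 := Finsupp.mapDomain_apply hinj x.coeff v
  have e2 := Finsupp.mapDomain_of_notMem_range (f := (AddMonoidHom.id V).prod (0 : V →+ W)) x.coeff
    (v, D v) (by
      rintro ⟨a, ha⟩
      exact hne (congrArg Prod.snd ha).symm)
  rw [e2] at h1
  exact Finsupp.mem_support_iff.1 hv (e1.symm.trans h1)

end TorusPoints

/-! ### The universal cocycle, and (ℰ ⊗ M)_Δ as chains modulo boundaries. -/

section UniversalCocycle

variable {Γ Δ M W : Type u} [Group Γ] [Group Δ] {π : Γ →* Δ} [AddCommGroup M]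
  [DistribMulAction Δ M] [AddCommGroup W]

/-- The `1`-cocycles of `Γ` with values in `Hom(M, W)`. -/
def IsHomCocycle (π : Γ →* Δ) (f : Γ → M →+ W) : Prop :=
  ∀ γ γ' m, f (γ * γ') m = f γ m + f γ' ((π γ)⁻¹ • m)

theorem IsHomCocycle.map_one {f : Γ → M →+ W} (hf : IsHomCocycle π f) : f 1 = 0 := by
  ext m
  have := hf 1 1 m
  simpa using this

namespace CosetReps

variable (s : CosetReps π)

/-- The term κ in the action on ℰ is exactly what corrects the failure of coset representatives to
multiply: the Γ₂-part of γγ' is γγ̄⁻¹ · γ̄(γ'γ̄'⁻¹)γ̄⁻¹ · κ. -/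
theorem elt_mul (γ γ' : Γ) : s.elt (γ * γ') = s.elt γ + s.repE (π γ) (s.elt γ') := by
  refine Prod.ext ?_ ?_
  · change kerMk π _ = kerMk π _ + (conjKer π (s.rep (π γ)) (kerMk π _) +
      s.κLin (π γ) (Finsupp.single (π γ') 1 - Finsupp.single 1 1))
    have hκ : s.κLin (π γ) (Finsupp.single (π γ') 1 - Finsupp.single 1 1) =
        s.κ (π γ) (π γ') := by
      rw [map_sub, κLin, Finsupp.linearCombination_single, Finsupp.linearCombination_single,
        one_smul, one_smul, κ_one_right, sub_zero]
    rw [hκ, conjKer_kerMk, κ, ← kerMk_mul, ← kerMk_mul]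
    congr 1
    apply Subtype.ext
    simp [MulAut.conjNormal_apply, mul_assoc]
  · apply Subtype.ext
    change Finsupp.single (π (γ * γ')) (1 : ℤ) - Finsupp.single (1 : Δ) (1 : ℤ) =
      (Finsupp.single (π γ) (1 : ℤ) - Finsupp.single (1 : Δ) (1 : ℤ)) +
      Finsupp.lmapDomain ℤ ℤ (π γ * ·)
        (Finsupp.single (π γ') (1 : ℤ) - Finsupp.single (1 : Δ) (1 : ℤ))
    rw [map_sub, Finsupp.lmapDomain_apply, Finsupp.lmapDomain_apply, Finsupp.mapDomain_single,
      Finsupp.mapDomain_single]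
    simp

theorem natCocycle_add (γ : Γ) (m m' : M) :
    s.natCocycle γ (m + m') = s.natCocycle γ m + s.natCocycle γ m' := by
  simp only [natCocycle, TensorProduct.tmul_add, map_add]

/-- Apply the diagonal action of d, trivial on coinvariants, to x ⊗ d⁻¹m. This converts the action
on ℰ into the inverse action on M that occurs in the cocycle identity. -/
theorem mk_repE_tmul (d : Δ) (x : ModE π) (m : M) :
    Representation.Coinvariants.mk (s.repE.tprod (Representation.ofDistribMulAction ℤ Δ M))
        (s.repE d x ⊗ₜ[ℤ] m) =
      Representation.Coinvariants.mk _ (x ⊗ₜ[ℤ] (d⁻¹ • m)) := by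
  have := Representation.Coinvariants.mk_self_apply
    (s.repE.tprod (Representation.ofDistribMulAction ℤ Δ M)) d (x ⊗ₜ[ℤ] (d⁻¹ • m))
  rw [← this]
  congr 1
  rw [Representation.tprod_apply, TensorProduct.map_tmul, Representation.ofDistribMulAction_apply_apply,
    smul_inv_smul]

/-- The universal cocycle, as a family of homomorphisms. -/
def natHom (γ : Γ) : M →+ s.Coinv M := AddMonoidHom.mk' (s.natCocycle γ) (s.natCocycle_add γ)

theorem natHom_apply (γ : Γ) (m : M) : s.natHom γ m = s.natCocycle γ m := rfl

theorem isHomCocycle_natHom : IsHomCocycle π (s.natHom (M := M)) := by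
  intro γ γ' m
  simp only [natHom_apply, natCocycle]
  rw [elt_mul, TensorProduct.add_tmul, map_add, mk_repE_tmul]

section Lift

variable (f : Γ → M →+ W) (hf : IsHomCocycle π f)

/-- The restriction of a cocycle to `Γ₂^ab`. -/
def kerLift : KerAb π →+ (M →+ W) :=
  MonoidHom.toAdditiveLeft (Abelianization.lift (G := π.ker) (A := Multiplicative (M →+ W))
    { toFun := fun k => Multiplicative.ofAdd (f k.1)
      map_one' := congrArg Multiplicative.ofAdd hf.map_one
      map_mul' := fun k l => congrArg Multiplicative.ofAdd <| AddMonoidHom.ext fun m => by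
        have := hf k.1 l.1 m
        -- Elements of Γ₂ act trivially on M, so on Γ₂ the cocycle identity is additivity.
        rw [k.2, inv_one, one_smul] at this
        exact this })

theorem kerLift_kerMk (k : π.ker) : kerLift f hf (kerMk π k) = f k.1 := rfl

/-- The extension of a cocycle to `ℰ`. -/
def eltLift : ModE π →+ (M →+ W) :=
  AddMonoidHom.coprod (kerLift f hf)
    ((Finsupp.linearCombination ℤ fun c => f (s.rep c)).toAddMonoidHom.comp
      (AugIdeal Δ).subtype.toAddMonoidHom)

theorem eltLift_apply (x : ModE π) : s.eltLift f hf x =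
    kerLift f hf x.1 + Finsupp.linearCombination ℤ (fun c => f (s.rep c)) x.2.1 := rfl

theorem eltLift_elt (γ : Γ) : s.eltLift f hf (s.elt γ) = f γ := by
  rw [eltLift_apply]
  simp only [elt]
  rw [kerLift_kerMk, map_sub, Finsupp.linearCombination_single, Finsupp.linearCombination_single,
    one_smul, one_smul, s.rep_one, hf.map_one, sub_zero]
  ext m
  -- Factor γ = (γγ̄⁻¹)γ̄; the first factor lies in Γ₂ and acts trivially on M.
  have := hf (γ * (s.rep (π γ))⁻¹) (s.rep (π γ)) m
  rw [inv_mul_cancel_right, map_mul, map_inv, s.π_rep, mul_inv_cancel, inv_one, one_smul] at this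
  exact this.symm

theorem elt_ker (k : π.ker) : s.elt k.1 = (kerMk π k, 0) := by
  refine Prod.ext ?_ ?_
  · simp only [elt]
    congr 1
    apply Subtype.ext
    have : π k.1 = 1 := k.2
    simp [this, s.rep_one]
  · apply Subtype.ext
    have : π k.1 = 1 := k.2
    simp [elt, this]

theorem elt_rep (c : Δ) : (s.elt (s.rep c)).1 = 0 := by
  simp only [elt]
  have : (⟨s.rep c * (s.rep (π (s.rep c)))⁻¹, by simp [s.π_rep]⟩ : π.ker) = 1 := by
    apply Subtype.ext
    simp [s.π_rep]
  rw [this]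
  rfl

/-- For k in Γ₂ one has `elt k` = (k, 0), and `elt c̄` = (0, c - 1). The latter span I_Δ, since ∑
n_c c = ∑ n_c (c - 1) when ∑ n_c = 0. -/
theorem closure_elt : AddSubgroup.closure (Set.range s.elt) = ⊤ := by
  rw [eq_top_iff]
  rintro ⟨k, x⟩ -
  have h1 : ((k, 0) : ModE π) ∈ AddSubgroup.closure (Set.range s.elt) := by
    induction k using kerMk_induction with
    | h k => exact AddSubgroup.subset_closure ⟨k.1, s.elt_ker k⟩
  have h2 : ((0, x) : ModE π) ∈ AddSubgroup.closure (Set.range s.elt) := by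
    have hx : ((0, x) : ModE π) = x.1.sum fun c n => n • s.elt (s.rep c) := by
      refine Prod.ext ?_ (Subtype.ext ?_)
      · rw [Finsupp.sum, Prod.fst_sum]
        simp [s.elt_rep]
      · have hsum : x.1.sum (fun _ n => n) = 0 := by
          have := LinearMap.mem_ker.1 x.2
          rw [Finsupp.linearCombination_apply] at this
          simpa only [smul_eq_mul, mul_one] using this
        rw [Finsupp.sum, Prod.snd_sum, AddSubmonoidClass.coe_finsetSum]
        simp only [elt, s.π_rep, Prod.smul_snd, SetLike.val_smul, smul_sub, Finset.sum_sub_distrib]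
        have e1 : ∑ c ∈ x.1.support, x.1 c • Finsupp.single c (1 : ℤ) = x.1 := by
          simpa [Finsupp.sum] using Finsupp.sum_single x.1
        rw [e1, ← Finset.sum_smul]
        change x.1 = x.1 - (x.1.sum fun _ n => n) • _
        rw [hsum, zero_smul, sub_zero]
    rw [hx]
    exact sum_mem fun c _ => zsmul_mem (AddSubgroup.subset_closure (Set.mem_range_self (s.rep c))) _
  have : ((k, x) : ModE π) = (k, 0) + (0, x) := by simp
  rw [this]
  exact add_mem h1 h2

/-- It suffices to take x = `elt γ`. There `elt_mul` and the cocycle identity for f both expand the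
value f(d̄γ), and the common summand f(d̄) cancels. -/
theorem eltLift_repE (d : Δ) (x : ModE π) (m : M) :
    s.eltLift f hf (s.repE d x) m = s.eltLift f hf x (d⁻¹ • m) := by
  have hx : x ∈ AddSubgroup.closure (Set.range s.elt) := by rw [closure_elt]; trivial
  induction hx using AddSubgroup.closure_induction with
  | mem x hx =>
    obtain ⟨γ, rfl⟩ := hx
    have h1 := s.elt_mul (s.rep d) γ
    rw [s.π_rep] at h1
    have h2 := congrArg (fun y => s.eltLift f hf y m) h1
    simp only [map_add, eltLift_elt, AddMonoidHom.add_apply] at h2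
    rw [hf, s.π_rep, add_left_cancel_iff] at h2
    rw [eltLift_elt, h2]
  | zero => simp
  | add x y _ _ hx hy => simp only [map_add, AddMonoidHom.add_apply, hx, hy]
  | neg x _ hx => simp only [map_neg, AddMonoidHom.neg_apply, hx]

/-- The homomorphism `(ℰ ⊗ M)_Δ → W` which corresponds to a cocycle with values in
`Hom(M, W)`. -/
def coinvLift : s.Coinv M →+ W :=
  (Representation.Coinvariants.lift _
    (TensorProduct.lift (LinearMap.mk₂ ℤ (fun x m => s.eltLift f hf x m)
      (fun _ _ _ => by simp) (fun _ _ _ => by simp) (fun _ _ _ => by simp)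
      (fun _ _ _ => by simp)))
    (fun d => TensorProduct.ext' fun x m => by
      rw [LinearMap.comp_apply, Representation.tprod_apply, TensorProduct.map_tmul,
        TensorProduct.lift.tmul, TensorProduct.lift.tmul, LinearMap.mk₂_apply,
        LinearMap.mk₂_apply, eltLift_repE, Representation.ofDistribMulAction_apply_apply,
        inv_smul_smul])).toAddMonoidHom

theorem coinvLift_natCocycle (γ : Γ) (m : M) : s.coinvLift f hf (s.natCocycle γ m) = f γ m := by
  change s.eltLift f hf (s.elt γ) m = f γ m
  rw [eltLift_elt]

end Lift

/-- Uniqueness in the universal property: as the `elt γ` generate ℰ, the values of the universal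
cocycle generate the coinvariants. -/
theorem coinv_hom_ext {f g : s.Coinv M →+ W}
    (h : ∀ γ m, f (s.natCocycle γ m) = g (s.natCocycle γ m)) : f = g := by
  refine AddMonoidHom.ext fun y => ?_
  induction y using Representation.Coinvariants.induction_on with
  | h y =>
    induction y using TensorProduct.induction_on with
    | zero => simp
    | add x y hx hy => rw [map_add, map_add, map_add, hx, hy]
    | tmul x m =>
      have hx : x ∈ AddSubgroup.closure (Set.range s.elt) := by rw [closure_elt]; trivial
      induction hx using AddSubgroup.closure_induction with
      | mem x hx =>
        obtain ⟨γ, rfl⟩ := hx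
        exact h γ m
      | zero => simp
      | add x y _ _ hx hy => simp only [TensorProduct.add_tmul, map_add, hx, hy]
      | neg x _ hx => simp only [TensorProduct.neg_tmul, map_neg, hx]

variable (M) in
/-- The homomorphism `C₁(Γ, M) → (ℰ ⊗ M)_Δ` given by the universal cocycle. -/
def chainHom : (Γ →₀ M) →+ s.Coinv M := Finsupp.liftAddHom s.natHom

theorem chainHom_apply (z : Γ →₀ M) : s.chainHom M z = z.sum fun γ m => s.natCocycle γ m := rfl

theorem chainHom_single (γ : Γ) (m : M) :
    s.chainHom M (Finsupp.single γ m) = s.natCocycle γ m :=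
  Finsupp.liftAddHom_apply_single _ _ _

theorem d₁_single (γ : Γ) (m : M) : d₁ π M (Finsupp.single γ m) = (π γ)⁻¹ • m - m :=
  Finsupp.liftAddHom_apply_single _ _ _

theorem d₂_single (γ γ' : Γ) (m : M) : d₂ π M (Finsupp.single (γ, γ') m) =
    Finsupp.single γ' ((π γ)⁻¹ • m) - Finsupp.single (γ * γ') m + Finsupp.single γ m :=
  Finsupp.liftAddHom_apply_single _ _ _

theorem chainHom_comp_d₂ : (s.chainHom M).comp (d₂ π M) = 0 := by
  refine Finsupp.addHom_ext fun p m => ?_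
  obtain ⟨γ, γ'⟩ := p
  rw [AddMonoidHom.comp_apply, d₂_single, map_add, map_sub, chainHom_single, chainHom_single,
    chainHom_single, AddMonoidHom.zero_apply, ← natHom_apply, ← natHom_apply, ← natHom_apply,
    s.isHomCocycle_natHom γ γ' m]
  abel

/-- The cocycle which corresponds to the homomorphism `(ℰ ⊗ M)_Δ → C₁(Γ, M) / B₁(Γ, M)`. -/
def chainCocycle (π : Γ →* Δ) (γ : Γ) : M →+ (Γ →₀ M) ⧸ (d₂ π M).range :=
  (QuotientAddGroup.mk' _).comp (Finsupp.singleAddHom γ)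

/-- The cocycle identity for γ ↦ (m ↦ m[γ]) is the vanishing of d₂(m[γ, γ']) in the quotient. -/
theorem isHomCocycle_chainCocycle : IsHomCocycle π (chainCocycle (M := M) π) := by
  intro γ γ' m
  have : (QuotientAddGroup.mk' (d₂ π M).range) (d₂ π M (Finsupp.single (γ, γ') m)) = 0 :=
    (QuotientAddGroup.eq_zero_iff _).2 ⟨_, rfl⟩
  rw [d₂_single, map_add, map_sub, sub_add_eq_add_sub, sub_eq_zero] at this
  exact this.symm.trans (add_comm _ _)

/-- The universal property yields a map back to chains modulo boundaries which undoes `chainHom`;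
hence the kernel of `chainHom` contains nothing but boundaries. -/
theorem coinvLift_chainHom (z : Γ →₀ M) :
    s.coinvLift _ isHomCocycle_chainCocycle (s.chainHom M z) =
      QuotientAddGroup.mk' (d₂ π M).range z := by
  have : (s.coinvLift _ isHomCocycle_chainCocycle).comp (s.chainHom M) =
      QuotientAddGroup.mk' (d₂ π M).range := by
    refine Finsupp.addHom_ext fun γ m => ?_
    rw [AddMonoidHom.comp_apply, chainHom_single, coinvLift_natCocycle]
    rfl
  exact DFunLike.congr_fun this z

theorem chainHom_eq_zero_iff (z : Γ →₀ M) : s.chainHom M z = 0 ↔ z ∈ (d₂ π M).range := by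
  constructor
  · intro h
    have := s.coinvLift_chainHom z
    rw [h, map_zero] at this
    exact (QuotientAddGroup.eq_zero_iff _).1 this.symm
  · rintro ⟨y, rfl⟩
    exact DFunLike.congr_fun s.chainHom_comp_d₂ y

/-- The projection onto the cokernel kills the universal cocycle, so it vanishes by `coinv_hom_ext`.
-/
theorem chainHom_surjective : Function.Surjective (s.chainHom M) := by
  have h : (QuotientAddGroup.mk' (s.chainHom M).range) = 0 := s.coinv_hom_ext fun γ m => by
    rw [AddMonoidHom.zero_apply]
    exact (QuotientAddGroup.eq_zero_iff _).2 ⟨_, s.chainHom_single γ m⟩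
  intro y
  exact (QuotientAddGroup.eq_zero_iff y).1 (DFunLike.congr_fun h y)

/-- The cocycle `γ ↦ (m ↦ γ⁻¹ m - m)`. -/
def boundaryCocycle (π : Γ →* Δ) (γ : Γ) : M →+ M :=
  DistribSMul.toAddMonoidHom M (π γ)⁻¹ - AddMonoidHom.id M

theorem isHomCocycle_boundaryCocycle : IsHomCocycle π (boundaryCocycle (M := M) π) := by
  intro γ γ' m
  simp [boundaryCocycle, mul_smul]

variable (M) in
/-- The homomorphism `(ℰ ⊗ M)_Δ → M` induced by the differential `C₁(Γ, M) → C₀(Γ, M)`. -/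
def boundary : s.Coinv M →+ M := s.coinvLift _ isHomCocycle_boundaryCocycle

theorem boundary_natCocycle (γ : Γ) (m : M) :
    s.boundary M (s.natCocycle γ m) = (π γ)⁻¹ • m - m := s.coinvLift_natCocycle _ _ γ m

theorem boundary_chainHom (z : Γ →₀ M) : s.boundary M (s.chainHom M z) = d₁ π M z := by
  have : (s.boundary M).comp (s.chainHom M) = d₁ π M := by
    refine Finsupp.addHom_ext fun γ m => ?_
    rw [AddMonoidHom.comp_apply, chainHom_single, boundary_natCocycle, d₁_single]
  exact DFunLike.congr_fun this z

variable (M) in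
/-- The homomorphism `φ_nat : H₁(Γ, M) → (ℰ ⊗ M)_Δ`. -/
def homologyHom : HomologyOne π M →+ s.Coinv M :=
  QuotientAddGroup.lift _ ((s.chainHom M).comp (d₁ π M).ker.subtype) fun z hz =>
    (s.chainHom_eq_zero_iff z.1).2 (AddSubgroup.mem_addSubgroupOf.1 hz)

theorem homologyHom_mk (z : (d₁ π M).ker) :
    s.homologyHom M (QuotientAddGroup.mk z) = s.chainHom M z.1 := rfl

theorem homologyHom_injective : Function.Injective (s.homologyHom M) := by
  refine (injective_iff_map_eq_zero _).2 fun y => ?_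
  obtain ⟨z, rfl⟩ := QuotientAddGroup.mk_surjective y
  intro h
  exact (QuotientAddGroup.eq_zero_iff _).2
    (AddSubgroup.mem_addSubgroupOf.2 ((s.chainHom_eq_zero_iff z.1).1 h))

/-- Under (ℰ ⊗ M)_Δ ≅ C₁/B₁ the map `boundary` is induced by d₁, whose kernel modulo boundaries is
H₁. -/
theorem range_homologyHom : (s.homologyHom M).range = (s.boundary M).ker := by
  ext x
  constructor
  · rintro ⟨y, rfl⟩
    obtain ⟨z, rfl⟩ := QuotientAddGroup.mk_surjective y
    rw [AddMonoidHom.mem_ker, homologyHom_mk, boundary_chainHom]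
    exact z.2
  · intro hx
    obtain ⟨z, rfl⟩ := s.chainHom_surjective x
    rw [AddMonoidHom.mem_ker, boundary_chainHom] at hx
    exact ⟨QuotientAddGroup.mk ⟨z, hx⟩, rfl⟩

/-- If `M` is a free abelian group of finite rank, then `φ_nat` has a retraction. -/
theorem exists_retraction [Module.Free ℤ M] [Module.Finite ℤ M] :
    ∃ r : s.Coinv M →+ HomologyOne π M, ∀ y, r (s.homologyHom M y) = y := by
  let D : s.Coinv M →ₗ[ℤ] M := (s.boundary M).toIntLinearMap
  -- The range of `D` is a subgroup of a lattice, hence free and projective, so `D` splits over its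
  -- range. The retraction is then x ↦ x - σ(D x), which lands in ker ∂ = H₁.
  obtain ⟨σ, hσ⟩ := Module.projective_lifting_property D.rangeRestrict LinearMap.id
    D.surjective_rangeRestrict
  have hσ' : ∀ x, s.boundary M (σ (D.rangeRestrict x)) = s.boundary M x := fun x =>
    congrArg Subtype.val (DFunLike.congr_fun hσ (D.rangeRestrict x))
  let e := AddMonoidHom.ofInjective (s.homologyHom_injective (M := M))
  let p : s.Coinv M →+ (s.homologyHom M).range :=
    (AddMonoidHom.id _ - (σ.comp D.rangeRestrict).toAddMonoidHom).codRestrict _ fun x => by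
      rw [range_homologyHom, AddMonoidHom.mem_ker, AddMonoidHom.sub_apply, map_sub, sub_eq_zero]
      exact (hσ' x).symm
  refine ⟨e.symm.toAddMonoidHom.comp p, fun y => ?_⟩
  rw [AddMonoidHom.comp_apply]
  refine (AddEquiv.symm_apply_eq e).2 (Subtype.ext ?_)
  have h0 : s.boundary M (s.homologyHom M y) = 0 :=
    (s.range_homologyHom (M := M)).le ⟨y, rfl⟩
  have h1 : D.rangeRestrict (s.homologyHom M y) = 0 := Subtype.ext h0
  change s.homologyHom M y - σ (D.rangeRestrict (s.homologyHom M y)) = s.homologyHom M y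
  rw [h1, map_zero, sub_zero]

end CosetReps

end UniversalCocycle

/-! ### Faithfully flat descent for representable functors. -/

section FpqcDescent

/-- Replaces a finite fpqc covering by the single faithfully flat algebra ∏ Bᵢ: a finite product of
flat algebras is flat, and joint surjectivity on spectra becomes surjectivity. -/
theorem faithfullyFlat_pi {A : Type u} [CommRing A] {n : ℕ} {B : Fin n → Type u}
    [∀ i, CommRing (B i)] [∀ i, Algebra A (B i)] (hflat : ∀ i, Module.Flat A (B i))
    (hsurj : ∀ P : PrimeSpectrum A,
      ∃ i, P ∈ Set.range (PrimeSpectrum.comap (algebraMap A (B i)))) :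
    Module.FaithfullyFlat A (∀ i, B i) := by
  have : Module.Flat A (∀ i, B i) :=
    Module.Flat.of_linearEquiv (DFinsupp.linearEquivFunOnFintype (R := A) (M := B)).symm
  refine Module.FaithfullyFlat.of_comap_surjective fun P => ?_
  obtain ⟨i, Q, hQ⟩ := hsurj P
  exact ⟨PrimeSpectrum.comap (Pi.evalRingHom B i) Q, hQ⟩

/-- Exactness of `A → ∏ Bᵢ ⇉ ∏ Bᵢ ⊗ Bⱼ` for a faithfully flat family. -/
theorem exists_algebraMap_eq_of_pi {A : Type u} [CommRing A] {n : ℕ} {B : Fin n → Type u}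
    [∀ i, CommRing (B i)] [∀ i, Algebra A (B i)] [Module.FaithfullyFlat A (∀ i, B i)]
    (x : ∀ i, B i) (hx : ∀ i j, (x i ⊗ₜ[A] (1 : B j)) = (1 : B i) ⊗ₜ[A] x j) :
    ∃ a : A, algebraMap A (∀ i, B i) a = x := by
  refine (Algebra.IsEffective.of_faithfullyFlat A (∀ i, B i) x).1 ?_
  rw [Algebra.TensorProduct.includeLeftSubRight_apply, sub_eq_zero]
  -- The ring (∏ Bᵢ) ⊗ (∏ Bⱼ) is assembled from the Bᵢ ⊗ Bⱼ, so the descent condition may be checked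
  -- on each pair (i, j).
  have key : ∀ y z : ∀ i, B i, y ⊗ₜ[A] z = ∑ i, ∑ j,
      TensorProduct.map (LinearMap.single A B i) (LinearMap.single A B j) (y i ⊗ₜ[A] z j) := by
    intro y z
    simp only [TensorProduct.map_tmul, LinearMap.single_apply]
    simp_rw [← TensorProduct.tmul_sum, ← TensorProduct.sum_tmul, Finset.univ_sum_single]
  rw [key x 1, key 1 x]
  simp only [Pi.one_apply, hx]

/-- The local data form a morphism R → ∏ Bᵢ. Compatibility, tested on C = Bᵢ ⊗ Bⱼ, places its values
in the equaliser, which is A by descent; injectivity of A → ∏ Bᵢ gives uniqueness. -/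
theorem isFpqcSheaf_coyoneda {O : Type u} [CommRing O] (R : CommAlgCat.{u} O) :
    IsFpqcSheaf (coyoneda.obj (Opposite.op R)) := by
  intro A n B f hflat hsurj x hx
  let (i : Fin n) : Algebra A (B i) := (f i).hom.toRingHom.toAlgebra
  have (i : Fin n) : IsScalarTower O A (B i) := IsScalarTower.of_algHom (f i).hom
  have hff : Module.FaithfullyFlat A (∀ i, B i) := faithfullyFlat_pi (fun i => hflat i) hsurj
  have hinj : Function.Injective (algebraMap A (∀ i, B i)) :=
    FaithfulSMul.algebraMap_injective A (∀ i, B i)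
  let F : A →ₐ[O] (∀ i, B i) := AlgHom.pi fun i => (f i).hom
  let X : R →ₐ[O] (∀ i, B i) := AlgHom.pi fun i => (x i : R ⟶ B i).hom
  have hX : ∀ r, X r ∈ F.range := by
    intro r
    refine exists_algebraMap_eq_of_pi (X r) fun i j => ?_
    let C : CommAlgCat.{u} O := CommAlgCat.of O (B i ⊗[A] B j)
    let g : B i ⟶ C := CommAlgCat.ofHom
      ((Algebra.TensorProduct.includeLeft : B i →ₐ[A] B i ⊗[A] B j).restrictScalars O)
    let h : B j ⟶ C := CommAlgCat.ofHom
      ((Algebra.TensorProduct.includeRight : B j →ₐ[A] B i ⊗[A] B j).restrictScalars O)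
    have hgh : f i ≫ g = f j ≫ h := by
      ext a
      change (algebraMap A (B i) a) ⊗ₜ[A] (1 : B j) = (1 : B i) ⊗ₜ[A] (algebraMap A (B j) a)
      rw [Algebra.algebraMap_eq_smul_one, Algebra.algebraMap_eq_smul_one, TensorProduct.smul_tmul]
    have := hx i j C g h hgh
    exact congrArg (fun k : R ⟶ C => k.hom r) this
  let e := AlgEquiv.ofInjective F hinj
  have hsymm : ∀ r, F (e.symm ⟨X r, hX r⟩) = X r := fun r =>
    congrArg Subtype.val (e.apply_symm_apply ⟨X r, hX r⟩)
  let y : R →ₐ[O] A := e.symm.toAlgHom.comp (X.codRestrict F.range hX)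
  refine ⟨CommAlgCat.ofHom y, fun i => ?_, fun y' hy' => ?_⟩
  · change CommAlgCat.ofHom y ≫ f i = x i
    ext r
    exact congrFun (hsymm r) i
  · refine CommAlgCat.hom_ext (AlgHom.ext fun r => ?_)
    apply hinj
    refine (funext fun i => ?_ : F ((y' : R ⟶ A).hom r) = X r).trans (hsymm r).symm
    exact congrArg (fun k : R ⟶ B i => k.hom r) (hy' i)

/-- A faithfully flat morphism is a covering with one member, so the uniqueness part of the sheaf
condition applies. -/
theorem IsFpqcSheaf.eq_of_faithfullyFlat {O : Type u} [CommRing O] {F : CommAlgCat.{u} O ⥤ Type u}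
    (hF : IsFpqcSheaf F) {A B : CommAlgCat.{u} O} (f : A ⟶ B)
    (hf : f.hom.toRingHom.FaithfullyFlat) {y z : F.obj A} (h : F.map f y = F.map f z) : y = z := by
  have hs := (RingHom.FaithfullyFlat.iff_flat_and_comap_surjective.1 hf)
  obtain ⟨w, -, hw⟩ := hF A 1 (fun _ => B) (fun _ => f) (fun _ => hs.1) (fun P => ⟨0, hs.2 P⟩)
    (fun _ => F.map f y) (fun _ _ C g h hgh => by
      simp only [← CategoryTheory.comp_apply, ← F.map_comp, hgh])
  exact (hw y fun _ => rfl).trans (hw z fun _ => h.symm).symm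

end FpqcDescent

/-! ### Extending characters from a subgroup after faithfully flat base change. -/

section ExtendCharacters

variable {O M A : Type u} [CommRing O] [AddCommGroup M] [CommRing A] [Algebra O A]

open AddMonoidAlgebra in
/-- The group algebra `O[M]` is faithfully flat over `O[N]` for a subgroup `N` of `M`. -/
theorem faithfullyFlat_mapDomain_subtype (N : AddSubgroup M) :
    (mapDomainAlgHom O O N.subtype).toRingHom.FaithfullyFlat := by
  classical
  let F : AddMonoidAlgebra O N →+* AddMonoidAlgebra O M := (mapDomainAlgHom O O N.subtype).toRingHom
  let : Algebra (AddMonoidAlgebra O N) (AddMonoidAlgebra O M) := F.toAlgebra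
  have hF : ∀ n r, F (single n r) = single (n : M) r := fun n r => mapDomain_single
  -- Coset representatives form a basis of O[M] over O[N]: each element of M is uniquely n + σ q, so
  -- `T` merely redistributes coefficients and is bijective.
  let σ : M ⧸ N → M := Quotient.out
  have hσ : ∀ q, (QuotientAddGroup.mk (σ q) : M ⧸ N) = q := fun q => Quotient.out_eq q
  let T := Finsupp.linearCombination (AddMonoidAlgebra O N)
    (fun q : M ⧸ N => (single (σ q) 1 : AddMonoidAlgebra O M))
  have hcoeff : ∀ (a : (M ⧸ N) →₀ AddMonoidAlgebra O N) (q : M ⧸ N) (n : N),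
      (T a).coeff (n + σ q) = (a q).coeff n := by
    intro a q n
    induction a using Finsupp.induction_linear with
    | zero => simp
    | add a b ha hb => simp [ha, hb]
    | single q' a =>
      rw [Finsupp.linearCombination_single]
      change (F a * single (σ q') 1).coeff (n + σ q) = _
      induction a using AddMonoidAlgebra.induction_linear with
      | zero => simp
      | add a b ha hb => rw [F.map_add, add_mul, coeff_add, Finsupp.add_apply, ha, hb]; simp
      | single n' r =>
        rw [hF, single_mul_single, mul_one, coeff_single, Finsupp.single_apply]
        by_cases hq : q' = q
        · subst hq
          simp [Finsupp.single_apply]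
        · rw [Finsupp.single_eq_of_ne (Ne.symm hq), if_neg]
          · simp
          · intro h
            apply hq
            rw [← hσ q, ← hσ q']
            have := congrArg (QuotientAddGroup.mk : M → M ⧸ N) h
            rw [QuotientAddGroup.mk_add, QuotientAddGroup.mk_add,
              (QuotientAddGroup.eq_zero_iff (n' : M)).2 n'.2,
              (QuotientAddGroup.eq_zero_iff (n : M)).2 n.2, zero_add, zero_add] at this
            exact this
  have hbij : Function.Bijective T := by
    constructor
    · refine (injective_iff_map_eq_zero T).2 fun a ha => ?_
      ext q n
      rw [← hcoeff, ha]
      simp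
    · intro x
      induction x using AddMonoidAlgebra.induction_linear with
      | zero => exact ⟨0, map_zero _⟩
      | add x y hx hy =>
        obtain ⟨a, rfl⟩ := hx
        obtain ⟨b, rfl⟩ := hy
        exact ⟨a + b, map_add _ _ _⟩
      | single m r =>
        have hm : m - σ (QuotientAddGroup.mk m) ∈ N := by
          rw [← QuotientAddGroup.eq_zero_iff, QuotientAddGroup.mk_sub, hσ, sub_self]
        refine ⟨Finsupp.single (QuotientAddGroup.mk m) (single ⟨_, hm⟩ r), ?_⟩
        rw [Finsupp.linearCombination_single]
        change F _ * _ = _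
        rw [hF, single_mul_single, mul_one, sub_add_cancel]
  have e := LinearEquiv.ofBijective T hbij
  have : Module.FaithfullyFlat (AddMonoidAlgebra O N) (AddMonoidAlgebra O M) :=
    Module.FaithfullyFlat.of_linearEquiv _ _ e.symm
  exact RingHom.faithfullyFlat_algebraMap_iff.2 this

/-- A character of a subgroup `N` of `M` extends to `M` after a faithfully flat base change. -/
theorem TorusPt.exists_extension (N : AddSubgroup M) (v : TorusPt N A) :
    ∃ (B : Type u) (_ : CommRing B) (_ : Algebra O B) (f : A →ₐ[O] B) (t : TorusPt M B),
      f.toRingHom.FaithfullyFlat ∧ ∀ n : N, t.val n = (TorusPt.map f v).val n := by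
  let : Algebra (AddMonoidAlgebra O N) (AddMonoidAlgebra O M) :=
    (AddMonoidAlgebra.mapDomainAlgHom O O N.subtype).toRingHom.toAlgebra
  let : Algebra (AddMonoidAlgebra O N) A := (v.charHom O).toRingHom.toAlgebra
  have hff : Module.FaithfullyFlat (AddMonoidAlgebra O N) (AddMonoidAlgebra O M) :=
    RingHom.faithfullyFlat_algebraMap_iff.1 (faithfullyFlat_mapDomain_subtype N)
  have : IsScalarTower O (AddMonoidAlgebra O N) A := IsScalarTower.of_algHom (v.charHom O)
  have : IsScalarTower O (AddMonoidAlgebra O N) (AddMonoidAlgebra O M) :=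
    IsScalarTower.of_algHom (AddMonoidAlgebra.mapDomainAlgHom O O N.subtype)
  -- `B` is the universal algebra over which the given character extends: the fibre of 𝔇(M) → 𝔇(N)
  -- over the point v. It is faithfully flat over A by base change.
  let B := A ⊗[AddMonoidAlgebra O N] AddMonoidAlgebra O M
  let f : A →ₐ[O] B :=
    (Algebra.TensorProduct.includeLeft : A →ₐ[A] B).restrictScalars O
  let g : AddMonoidAlgebra O M →ₐ[O] B :=
    (Algebra.TensorProduct.includeRight : AddMonoidAlgebra O M →ₐ[AddMonoidAlgebra O N] B).restrictScalars O
  refine ⟨B, inferInstance, inferInstance, f, TorusPt.map g (TorusPt.univ O M), ?_, fun n => ?_⟩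
  · have : Module.FaithfullyFlat A B := inferInstance
    exact RingHom.faithfullyFlat_algebraMap_iff.2 this
  · apply Units.ext
    rw [TorusPt.map_val, TorusPt.map_val, TorusPt.univ_val]
    have h1 : (algebraMap (AddMonoidAlgebra O N) (AddMonoidAlgebra O M))
        (AddMonoidAlgebra.single n 1) = AddMonoidAlgebra.single (n : M) 1 :=
      AddMonoidAlgebra.mapDomain_single
    have h2 : (algebraMap (AddMonoidAlgebra O N) A) (AddMonoidAlgebra.single n 1) = v.val n :=
      v.charHom_single_one n
    rw [← h1, ← h2]
    change (1 : A) ⊗ₜ _ = _ ⊗ₜ (1 : AddMonoidAlgebra O M)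
    rw [Algebra.algebraMap_eq_smul_one, Algebra.algebraMap_eq_smul_one, TensorProduct.smul_tmul]

end ExtendCharacters

/-! ### Cocycles as points of 𝔇((ℰ ⊗ M)_Δ). -/

section CocyclePoints

variable {Γ Δ M A B O : Type u} [Group Γ] [Group Δ] {π : Γ →* Δ} [AddCommGroup M]
  [DistribMulAction Δ M] [CommRing O] [CommRing A] [CommRing B] [Algebra O A] [Algebra O B]

theorem isHomCocycle_of_mem_Z1 (Φ : Z1 π M A) : IsHomCocycle π fun γ => (Φ.1 γ).toAddHom :=
  fun γ γ' m => congrArg (fun t : TorusPt M A => Additive.ofMul (t.val m)) (Φ.2 γ γ')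

namespace CosetReps

variable (s : CosetReps π)

/-- Characters of `(ℰ ⊗ M)_Δ` correspond to cocycles. -/
def cocycleEquiv : TorusPt (s.Coinv M) A ≃ Z1 π M A where
  toFun t := ⟨fun γ => TorusPt.comap (s.natHom γ) t, fun γ γ' => TorusPt.ext_val fun m => by
    rw [TorusPt.mul_val, TorusPt.smul_val, TorusPt.comap_val, TorusPt.comap_val,
      TorusPt.comap_val, s.isHomCocycle_natHom, TorusPt.val_add]⟩
  invFun Φ := TorusPt.ofAddHom (s.coinvLift _ (isHomCocycle_of_mem_Z1 Φ))
  left_inv t := congrArg TorusPt.ofAddHom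
    (s.coinv_hom_ext (g := t.toAddHom) fun γ m => s.coinvLift_natCocycle _ _ γ m)
  right_inv Φ := Subtype.ext <| funext fun γ => TorusPt.ext_val fun m =>
    congrArg Additive.toMul (s.coinvLift_natCocycle _ (isHomCocycle_of_mem_Z1 Φ) γ m)

theorem cocycleEquiv_val (t : TorusPt (s.Coinv M) A) (γ : Γ) (m : M) :
    ((s.cocycleEquiv t).1 γ).val m = t.val (s.natCocycle γ m) := rfl

theorem cocycleEquiv_mul (t t' : TorusPt (s.Coinv M) A) :
    s.cocycleEquiv (t * t') = s.cocycleEquiv t * s.cocycleEquiv t' := rfl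

theorem cocycleEquiv_symm_val_natCocycle (Φ : Z1 π M A) (γ : Γ) (m : M) :
    (s.cocycleEquiv.symm Φ).val (s.natCocycle γ m) = (Φ.1 γ).val m := by
  rw [← cocycleEquiv_val, Equiv.apply_symm_apply]

theorem cocycleEquiv_symm_val_chainHom (Φ : Z1 π M A) (z : Γ →₀ M) :
    (s.cocycleEquiv.symm Φ).val (s.chainHom M z) = z.prod fun γ m => (Φ.1 γ).val m := by
  rw [chainHom_apply, TorusPt.val_finsuppSum]
  simp only [cocycleEquiv_symm_val_natCocycle]

/-- The sign appears because t · (γt)⁻¹ takes the value t(m - γ⁻¹m) at m, whereas the differential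
sends m[γ] to γ⁻¹m - m. -/
theorem cocycleEquiv_boundary (t : TorusPt M A) :
    s.cocycleEquiv (TorusPt.comap (-s.boundary M) t) = coboundary π t := by
  refine Subtype.ext <| funext fun γ => TorusPt.ext_val fun m => ?_
  rw [cocycleEquiv_val, TorusPt.comap_val, AddMonoidHom.neg_apply, boundary_natCocycle, neg_sub,
    TorusPt.val_sub]
  rfl

theorem cocycleEquiv_symm_coboundary_mul (t : TorusPt M A) (Φ : Z1 π M A) :
    s.cocycleEquiv.symm (coboundary π t * Φ) =
      TorusPt.comap (-s.boundary M) t * s.cocycleEquiv.symm Φ := by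
  rw [Equiv.symm_apply_eq, cocycleEquiv_mul, Equiv.apply_symm_apply, cocycleEquiv_boundary]

end CosetReps

end CocyclePoints

/-! ### Admissible representations as twists of ρ₀ by cocycles. -/

namespace SplitGeneralisedTorus

variable {O M Δ H Γ A B : Type u} [CommRing O] [AddCommGroup M] [Group Δ] [Finite Δ]
  [CommRing H] [HopfAlgebra O H] [Group Γ] {G : SplitGeneralisedTorus O M Δ H} {π : Γ →* Δ}
  [CommRing A] [Algebra O A] [CommRing B] [Algebra O B]

theorem ι_injective : Function.Injective (G.ι A) := G.incl_injective A

theorem exists_ι_eq {g : Pt O H A} (hg : G.Proj A g = 1) : ∃ t, G.ι A t = g := by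
  have h1 : g ∈ identityComponent O H A := (G.proj_eq_one_iff A g).1 hg
  rw [← G.range_incl A] at h1
  exact h1

theorem PC.map_ofRep (f : A →ₐ[O] B) (ρ : G.Rep π A) :
    PC.map G f (PC.ofRep G ρ) = PC.ofRep G (Rep.map G f ρ) :=
  Subtype.ext (PseudoChar.map_ofRep f ρ.1)

/-- The extension of scalars `Γ → G(A)` of a representation over `O`. -/
def baseHom (ρ₀ : G.Rep π O) (A : Type u) [CommRing A] [Algebra O A] : Γ →* Pt O H A :=
  (Pt.map H (Algebra.ofId O A)).comp ρ₀.1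

theorem Proj_baseHom (ρ₀ : G.Rep π O) (γ : Γ) :
    G.Proj A (baseHom ρ₀ A γ) = constPt O A (π γ) := (Rep.map G (Algebra.ofId O A) ρ₀).2 γ

theorem map_baseHom (ρ₀ : G.Rep π O) (f : A →ₐ[O] B) (γ : Γ) :
    Pt.map H f (baseHom ρ₀ A γ) = baseHom ρ₀ B γ := by
  apply ofConv_injective
  ext x
  exact f.commutes _

variable [DistribMulAction Δ M]

variable (hG : G.IsConjugationAction) (ρ₀ : G.Rep π O)

include hG

theorem baseHom_mul_ι (γ : Γ) (t : TorusPt M A) :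
    baseHom ρ₀ A γ * G.ι A t = G.ι A (π γ • t) * baseHom ρ₀ A γ := by
  rw [← hG A (baseHom ρ₀ A γ) (π γ) (Proj_baseHom ρ₀ γ) t, inv_mul_cancel_right]

/-- Moving ρ₀(γ) past t' costs the action of πγ on t'. This makes multiplicativity of Φρ₀ equivalent
to the cocycle identity for Φ. -/
theorem ι_mul_baseHom_mul (t t' : TorusPt M A) (γ γ' : Γ) :
    (G.ι A t * baseHom ρ₀ A γ) * (G.ι A t' * baseHom ρ₀ A γ') =
      G.ι A (t * π γ • t') * baseHom ρ₀ A (γ * γ') := by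
  rw [map_mul, map_mul, mul_assoc, ← mul_assoc (baseHom ρ₀ A γ), baseHom_mul_ι hG, mul_assoc,
    mul_assoc]

theorem conj_ι_mul_baseHom (h t : TorusPt M A) (γ : Γ) :
    G.ι A h * (G.ι A t * baseHom ρ₀ A γ) * (G.ι A h)⁻¹ =
      G.ι A (h * (π γ • h)⁻¹ * t) * baseHom ρ₀ A γ := by
  rw [← map_inv, mul_assoc, mul_assoc, baseHom_mul_ι hG, ← mul_assoc, ← mul_assoc, ← map_mul,
    ← map_mul, smul_inv', mul_right_comm]

/-- The admissible representation `Φ ρ₀` attached to a cocycle `Φ`. -/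
def twist (Φ : Z1 π M A) : G.Rep π A :=
  ⟨MonoidHom.mk' (fun γ => G.ι A (Φ.1 γ) * baseHom ρ₀ A γ) fun γ γ' => by
      rw [Φ.2 γ γ', ι_mul_baseHom_mul hG],
    fun γ => by rw [MonoidHom.mk'_apply, map_mul, Proj_ι, one_mul, Proj_baseHom]⟩

/-- For admissible ρ the quotient ρ(γ)ρ₀(γ)⁻¹ lies in ker Π = 𝔇(M)(A), and cancelling ρ₀(γγ') in the
multiplicativity of ρ leaves the cocycle identity. -/
theorem twist_bijective : Function.Bijective (twist hG ρ₀ (A := A)) := by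
  constructor
  · intro Φ Ψ h
    exact Subtype.ext <| funext fun γ => ι_injective (G := G) <|
      mul_right_cancel (DFunLike.congr_fun (congrArg Subtype.val h) γ)
  · rintro ⟨ρ, hρ⟩
    have h1 : ∀ γ, ∃ t, G.ι A t = ρ γ * (baseHom ρ₀ A γ)⁻¹ := fun γ => exists_ι_eq (by
      rw [map_mul, map_inv, hρ, Proj_baseHom, mul_inv_cancel])
    choose t ht using h1
    have ht' : ∀ γ, ρ γ = G.ι A (t γ) * baseHom ρ₀ A γ := fun γ => by
      rw [ht, inv_mul_cancel_right]
    refine ⟨⟨t, fun γ γ' => ι_injective (G := G) ?_⟩,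
      Subtype.ext <| MonoidHom.ext fun γ => (ht' γ).symm⟩
    have h2 := ρ.map_mul γ γ'
    rw [ht', ht', ht', ι_mul_baseHom_mul hG] at h2
    exact mul_right_cancel h2

/-- The bijection `Φ ↦ Φ ρ₀` between cocycles and admissible representations. -/
def twistEquiv (A : Type u) [CommRing A] [Algebra O A] : Z1 π M A ≃ G.Rep π A :=
  Equiv.ofBijective (twist hG ρ₀) (twist_bijective hG ρ₀)

theorem map_twistEquiv (f : A →ₐ[O] B) (Φ : Z1 π M A) :
    Rep.map G f (twistEquiv hG ρ₀ A Φ) = twistEquiv hG ρ₀ B (Z1.map π f Φ) := by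
  refine Subtype.ext <| MonoidHom.ext fun γ => ?_
  change Pt.map H f (G.ι A (Φ.1 γ) * baseHom ρ₀ A γ) =
    G.ι B (TorusPt.map f (Φ.1 γ)) * baseHom ρ₀ B γ
  rw [map_mul, map_baseHom, ← ι_map]

theorem twistEquiv_coboundary_mul (t : TorusPt M A) (Φ : Z1 π M A) :
    twistEquiv hG ρ₀ A (coboundary π t * Φ) = t • twistEquiv hG ρ₀ A Φ :=
  Subtype.ext <| MonoidHom.ext fun γ => (conj_ι_mul_baseHom hG ρ₀ t (Φ.1 γ) γ).symm

/-- The natural bijection between `Z¹` and the set of admissible representations. -/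
def twistIso : z1Functor π M O ≅ G.repFunctor π :=
  NatIso.ofComponents (fun A => (twistEquiv hG ρ₀ A).toIso) fun f => by
    ext Φ
    exact (map_twistEquiv hG ρ₀ f.hom Φ).symm

theorem ofCocycle_twistIso (A : CommAlgCat.{u} O) (Φ : Z1 π M A) :
    G.ofCocycle (twistIso hG ρ₀).hom A Φ = twistEquiv hG ρ₀ A Φ := rfl

/-- The bijection between `H¹` and the set of orbits of admissible representations. -/
def orbitEquiv (A : Type u) [CommRing A] [Algebra O A] :
    H1 π M A ≃ MulAction.orbitRel.Quotient (TorusPt M A) (G.Rep π A) :=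
  Quotient.congr (twistEquiv hG ρ₀ A) fun Φ Ψ => by
    rw [QuotientGroup.leftRel_apply]
    change _ ↔ _ ∈ MulAction.orbit _ _
    constructor
    · rintro ⟨t, ht⟩
      -- The coset relation reads Φ⁻¹Ψ = ∂t, whereas the orbit relation asks for an element carrying
      -- Ψ to Φ; hence the inverse.
      refine ⟨t⁻¹, ?_⟩
      change t⁻¹ • _ = _
      rw [← twistEquiv_coboundary_mul, map_inv, ht]
      congr 1
      rw [mul_inv_rev, inv_inv, inv_mul_cancel_comm]
    · rintro ⟨t, ht⟩
      refine ⟨t⁻¹, ?_⟩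
      change t • _ = _ at ht
      rw [← twistEquiv_coboundary_mul] at ht
      rw [← (twistEquiv hG ρ₀ A).injective ht, map_inv, mul_inv_rev, inv_mul_cancel_comm]

/-- The natural bijection between `H¹` and the set of orbits of admissible representations. -/
def orbitIso : h1Functor π M O ≅ G.orbitFunctor π :=
  NatIso.ofComponents (fun A => (orbitEquiv hG ρ₀ A).toIso) fun f => by
    ext x
    induction x using QuotientGroup.induction_on with
    | H Φ => exact congrArg (Quotient.mk _) (map_twistEquiv hG ρ₀ f.hom Φ).symm

/-! ### The scheme Rep = 𝔇((ℰ ⊗ M)_Δ) and its quotients by 𝔇(M). -/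

variable (s : CosetReps π)

/-- The bijection between characters of `(ℰ ⊗ M)_Δ` and admissible representations. -/
def charRepEquiv (A : Type u) [CommRing A] [Algebra O A] : TorusPt (s.Coinv M) A ≃ G.Rep π A :=
  s.cocycleEquiv.trans (twistEquiv hG ρ₀ A)

theorem map_charRepEquiv (f : A →ₐ[O] B) (t : TorusPt (s.Coinv M) A) :
    Rep.map G f (charRepEquiv hG ρ₀ s A t) = charRepEquiv hG ρ₀ s B (TorusPt.map f t) :=
  map_twistEquiv hG ρ₀ f _

/-- In terms of characters, conjugation is translation along the homomorphism 𝔇(M) → 𝔇((ℰ ⊗ M)_Δ)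
dual to -∂. Both quotient statements rest on this. -/
theorem charRepEquiv_symm_smul (t : TorusPt M A) (ρ : G.Rep π A) :
    (charRepEquiv hG ρ₀ s A).symm (t • ρ) =
      TorusPt.comap (-s.boundary M) t * (charRepEquiv hG ρ₀ s A).symm ρ := by
  obtain ⟨Φ, rfl⟩ := (twistEquiv hG ρ₀ A).surjective ρ
  simp only [charRepEquiv, Equiv.symm_trans_apply]
  rw [← twistEquiv_coboundary_mul, Equiv.symm_apply_apply, Equiv.symm_apply_apply,
    s.cocycleEquiv_symm_coboundary_mul]

/-- The functor of admissible representations is represented by `O[(ℰ ⊗ M)_Δ]`. -/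
def repCorepresentableBy : (G.repFunctor π).CorepresentableBy (grpAlg O (s.Coinv M)) where
  homEquiv {A} := (TorusPt.pointEquiv A).trans (charRepEquiv hG ρ₀ s A)
  homEquiv_comp {A B} g f := by
    change charRepEquiv hG ρ₀ s B (TorusPt.map g.hom ((TorusPt.charEquiv O).symm f.hom)) =
      Rep.map G g.hom (charRepEquiv hG ρ₀ s A ((TorusPt.charEquiv O).symm f.hom))
    rw [map_charRepEquiv]

theorem repCorepresentableBy_homEquiv_symm {A : CommAlgCat.{u} O} (ρ : G.Rep π A) :
    ((repCorepresentableBy hG ρ₀ s).homEquiv.symm ρ).hom =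
      ((charRepEquiv hG ρ₀ s A).symm ρ).charHom O := rfl

/-- The character of `H₁(Γ, M)` attached to an admissible representation. -/
def homologyChar (ρ : G.Rep π A) : TorusPt (HomologyOne π M) A :=
  TorusPt.comap (s.homologyHom M) ((charRepEquiv hG ρ₀ s A).symm ρ)

/-- Translations come from characters composed with ∂, and these are trivial on H₁ = ker ∂. -/
theorem homologyChar_smul (t : TorusPt M A) (ρ : G.Rep π A) :
    homologyChar hG ρ₀ s (t • ρ) = homologyChar hG ρ₀ s ρ := by
  refine TorusPt.ext_val fun y => ?_
  have h0 : s.boundary M (s.homologyHom M y) = 0 :=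
    (s.range_homologyHom (M := M)).le ⟨y, rfl⟩
  rw [homologyChar, homologyChar, charRepEquiv_symm_smul, TorusPt.comap_val, TorusPt.comap_val,
    TorusPt.mul_val, TorusPt.comap_val, AddMonoidHom.neg_apply, h0, neg_zero, TorusPt.val_zero,
    one_mul]

theorem homologyChar_map (f : A →ₐ[O] B) (ρ : G.Rep π A) :
    homologyChar hG ρ₀ s (Rep.map G f ρ) = TorusPt.map f (homologyChar hG ρ₀ s ρ) := by
  obtain ⟨t, rfl⟩ := (charRepEquiv hG ρ₀ s A).surjective ρ
  rw [homologyChar, homologyChar, map_charRepEquiv, Equiv.symm_apply_apply, Equiv.symm_apply_apply]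
  rfl

theorem homologyChar_twistEquiv_mk (Φ : Z1 π M A) (z : (d₁ π M).ker) :
    (homologyChar hG ρ₀ s (twistEquiv hG ρ₀ A Φ)).val (QuotientAddGroup.mk z) =
      z.1.prod fun γ m => (Φ.1 γ).val m := by
  rw [homologyChar, TorusPt.comap_val, s.homologyHom_mk, charRepEquiv, Equiv.symm_trans_apply,
    Equiv.symm_apply_apply, s.cocycleEquiv_symm_val_chainHom]

/-- The natural map from the presheaf of orbits to `Spec O[H₁(Γ, M)]`. -/
def quotientMap : G.orbitFunctor π ⟶
    coyoneda.obj (Opposite.op (grpAlg O (HomologyOne π M))) where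
  app A := TypeCat.ofHom fun x : MulAction.orbitRel.Quotient (TorusPt M A) (G.Rep π A) =>
    Quotient.lift (fun ρ => (CommAlgCat.ofHom ((homologyChar hG ρ₀ s ρ).charHom O) :
        grpAlg O (HomologyOne π M) ⟶ A)) (by
      rintro _ ρ ⟨t, rfl⟩
      change CommAlgCat.ofHom ((homologyChar hG ρ₀ s (t • ρ)).charHom O) = _
      rw [homologyChar_smul]) x
  naturality A B f := by
    ext x
    induction x using Quotient.inductionOn with
    | h ρ =>
      change CommAlgCat.ofHom ((homologyChar hG ρ₀ s (Rep.map G f.hom ρ)).charHom O) =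
        CommAlgCat.ofHom ((homologyChar hG ρ₀ s ρ).charHom O) ≫ f
      rw [homologyChar_map, ← TorusPt.comp_charHom]
      rfl

theorem quotientPoint_quotientMap (A : CommAlgCat.{u} O) (ρ : G.Rep π A) :
    G.quotientPoint (quotientMap hG ρ₀ s) A ρ = (homologyChar hG ρ₀ s ρ).charHom O := rfl

/-- As H₁ is a direct summand of (ℰ ⊗ M)_Δ, each of its characters extends over A itself, so no
covering is needed. -/
theorem quotientMap_surjective (A : CommAlgCat.{u} O)
    (ψ : grpAlg O (HomologyOne π M) ⟶ A) :
    ∃ ρ : G.Rep π A, (quotientMap hG ρ₀ s).app A (G.orbit A ρ) = ψ := by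
  have := G.free
  have := G.finite
  obtain ⟨r, hr⟩ := s.exists_retraction (M := M)
  let t := TorusPt.comap r ((TorusPt.charEquiv O).symm ψ.hom)
  refine ⟨charRepEquiv hG ρ₀ s A t, CommAlgCat.hom_ext ?_⟩
  refine TorusPt.charHom_ext fun y => ?_
  change (homologyChar hG ρ₀ s _).charHom O _ = _
  rw [TorusPt.charHom_single_one, homologyChar, Equiv.symm_apply_apply, TorusPt.comap_val,
    TorusPt.comap_val, hr, TorusPt.charEquiv_symm_val]

/-- Representations with the same image in `Spec O[H₁(Γ, M)]` are conjugate after a faithfully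
flat base change. -/
theorem exists_smul_eq_of_homologyChar_eq (ρ σ : G.Rep π A)
    (h : homologyChar hG ρ₀ s ρ = homologyChar hG ρ₀ s σ) :
    ∃ (B : Type u) (_ : CommRing B) (_ : Algebra O B) (f : A →ₐ[O] B) (t : TorusPt M B),
      f.toRingHom.FaithfullyFlat ∧ t • Rep.map G f σ = Rep.map G f ρ := by
  set a := (charRepEquiv hG ρ₀ s A).symm ρ with ha
  set b := (charRepEquiv hG ρ₀ s A).symm σ with hb
  -- The ratio of the two characters is trivial on ker ∂, so it descends to a character `v` of im ∂
  -- ⊆ M.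
  have hker : ∀ x, s.boundary M x = 0 → (a * b⁻¹).val x = 1 := by
    intro x hx
    obtain ⟨y, rfl⟩ := (s.range_homologyHom (M := M)).ge hx
    have := congrArg (fun t => t.val y) h
    simp only [homologyChar, TorusPt.comap_val] at this
    rw [TorusPt.mul_val, TorusPt.inv_val, ha, hb, this, mul_inv_cancel]
  let e := QuotientAddGroup.quotientKerEquivRange (s.boundary M)
  let v₀ : s.Coinv M ⧸ (s.boundary M).ker →+ Additive Aˣ :=
    QuotientAddGroup.lift _ (a * b⁻¹).toAddHom fun x hx => congrArg Additive.ofMul (hker x hx)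
  let v : TorusPt (s.boundary M).range A := TorusPt.ofAddHom (v₀.comp e.symm.toAddMonoidHom)
  have hv : ∀ x, v.val ⟨s.boundary M x, x, rfl⟩ = (a * b⁻¹).val x := by
    intro x
    have : e.symm ⟨s.boundary M x, x, rfl⟩ = QuotientAddGroup.mk x :=
      (AddEquiv.symm_apply_eq e).2 rfl
    exact congrArg (fun y => (v₀ y).toMul) this
  obtain ⟨B, _, _, f, t, hf, ht⟩ := TorusPt.exists_extension (O := O) _ v
  -- The inverse compensates for the sign in -∂.
  refine ⟨B, _, _, f, t⁻¹, hf, (charRepEquiv hG ρ₀ s B).symm.injective ?_⟩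
  have hρ : Rep.map G f ρ = charRepEquiv hG ρ₀ s B (TorusPt.map f a) := by
    rw [← map_charRepEquiv, ha, Equiv.apply_symm_apply]
  have hσ : Rep.map G f σ = charRepEquiv hG ρ₀ s B (TorusPt.map f b) := by
    rw [← map_charRepEquiv, hb, Equiv.apply_symm_apply]
  rw [charRepEquiv_symm_smul, hρ, hσ, Equiv.symm_apply_apply, Equiv.symm_apply_apply]
  refine TorusPt.ext_val fun x => ?_
  have h1 := ht ⟨s.boundary M x, x, rfl⟩
  have h2 : (TorusPt.map f v).val ⟨s.boundary M x, x, rfl⟩ =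
      (TorusPt.map f (a * b⁻¹)).val x := Units.ext (congrArg (fun y : Aˣ => f y) (hv x))
  rw [h2] at h1
  rw [TorusPt.mul_val, TorusPt.comap_val, AddMonoidHom.neg_apply, TorusPt.val_neg,
    TorusPt.inv_val, inv_inv]
  change t.val (s.boundary M x) = _ at h1
  rw [h1, map_mul, map_inv, TorusPt.mul_val, TorusPt.inv_val, inv_mul_cancel_right]

/-- The map is surjective on A-points for each A, and orbits with equal image coincide over a
faithfully flat extension. A morphism to a sheaf therefore takes equal values on them and factors
uniquely. -/
theorem isFpqcSheafification_quotientMap : IsFpqcSheafification (quotientMap hG ρ₀ s) := by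
  refine ⟨isFpqcSheaf_coyoneda _, fun F' hF' α => ?_⟩
  have hwd : ∀ (A : CommAlgCat.{u} O) (ρ σ : G.Rep π A),
      (quotientMap hG ρ₀ s).app A (G.orbit A ρ) = (quotientMap hG ρ₀ s).app A (G.orbit A σ) →
      α.app A (G.orbit A ρ) = α.app A (G.orbit A σ) := by
    intro A ρ σ h
    have h1 : homologyChar hG ρ₀ s ρ = homologyChar hG ρ₀ s σ := by
      apply (TorusPt.charEquiv O).injective
      exact congrArg (fun k : grpAlg O (HomologyOne π M) ⟶ A => k.hom) h
    obtain ⟨B, _, _, f, t, hf, ht⟩ := exists_smul_eq_of_homologyChar_eq hG ρ₀ s ρ σ h1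
    let f' : A ⟶ CommAlgCat.of O B := CommAlgCat.ofHom f
    refine hF'.eq_of_faithfullyFlat f' hf ?_
    have hnat : ∀ τ : G.Rep π A, F'.map f' (α.app A (G.orbit A τ)) =
        α.app (CommAlgCat.of O B) (G.orbit (CommAlgCat.of O B) (Rep.map G f τ)) := fun τ =>
      (α.naturality_apply f' (G.orbit A τ)).symm
    rw [hnat, hnat, ← ht]
    congr 1
    exact Quotient.sound ⟨t, rfl⟩
  -- The factorisation is defined through arbitrary preimages; `hwd` makes it independent of them,
  -- whence its naturality.
  choose l hl using quotientMap_surjective hG ρ₀ s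
  have hβ : ∀ (A : CommAlgCat.{u} O) (ρ : G.Rep π A),
      α.app A (G.orbit A (l A ((quotientMap hG ρ₀ s).app A (G.orbit A ρ)))) =
        α.app A (G.orbit A ρ) := fun A ρ => hwd A _ _ (hl A _)
  refine ⟨⟨fun A => TypeCat.ofHom fun ψ => α.app A (G.orbit A (l A ψ)), fun A B f => ?_⟩, ?_, ?_⟩
  · ext ψ
    obtain ⟨ρ, rfl⟩ := quotientMap_surjective hG ρ₀ s A ψ
    change α.app B (G.orbit B (l B ((coyoneda.obj (Opposite.op (grpAlg O (HomologyOne π M)))).map f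
      ((quotientMap hG ρ₀ s).app A (G.orbit A ρ))))) =
      F'.map f (α.app A (G.orbit A (l A ((quotientMap hG ρ₀ s).app A (G.orbit A ρ)))))
    rw [hβ, ← (quotientMap hG ρ₀ s).naturality_apply f, ← α.naturality_apply f]
    exact hβ B (Rep.map G f.hom ρ)
  · ext A x
    induction x using Quotient.inductionOn with
    | h ρ => exact hβ A ρ
  · intro β h
    ext A ψ
    obtain ⟨ρ, rfl⟩ := quotientMap_surjective hG ρ₀ s A ψ
    refine Eq.trans ?_ (hβ A ρ).symm
    rw [← h]
    rfl

/-- Invariance under all translations dual to -∂ means weight zero for the grading by -∂, that is,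
support in ker ∂ = im φ_nat. -/
theorem range_mapDomain_homologyHom :
    (AddMonoidAlgebra.mapDomainAlgHom O O (s.homologyHom M)).range =
      G.repInvariants π (repCorepresentableBy hG ρ₀ s) := by
  ext x
  constructor
  · rintro ⟨y, rfl⟩ A t ρ
    rw [repCorepresentableBy_homEquiv_symm, repCorepresentableBy_homEquiv_symm]
    have h := congrArg (fun k => k.charHom O y) (homologyChar_smul hG ρ₀ s t ρ)
    simp only [homologyChar, ← TorusPt.charHom_comp_mapDomain] at h
    exact h
  · intro hx
    have hsupp : ∀ v ∈ x.coeff.support, s.boundary M v = 0 := by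
      intro v hv
      refine neg_eq_zero.1
        (eq_zero_of_mem_support_of_graph (-s.boundary M) x ?_ hv)
      -- Invariance is tested on the universal case: `V` is the coordinate ring of Rep × 𝔇(M), with
      -- its tautological representation and torus point. The two evaluations become the
      -- homomorphisms v ↦ (v, -∂v) and v ↦ (v, 0).
      let V := AddMonoidAlgebra O (s.Coinv M × M)
      let T : TorusPt (s.Coinv M × M) V := TorusPt.univ O _
      have h := hx (CommAlgCat.of O V) (TorusPt.comap (AddMonoidHom.inr _ _) T)
        (charRepEquiv hG ρ₀ s V (TorusPt.comap (AddMonoidHom.inl _ _) T))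
      rw [repCorepresentableBy_homEquiv_symm, repCorepresentableBy_homEquiv_symm,
        charRepEquiv_symm_smul, Equiv.symm_apply_apply] at h
      have e1 : AddMonoidAlgebra.mapDomainAlgHom O O ((AddMonoidHom.id _).prod (-s.boundary M)) =
          (TorusPt.comap (-s.boundary M) (TorusPt.comap (AddMonoidHom.inr _ _) T) *
            TorusPt.comap (AddMonoidHom.inl _ _) T).charHom O := by
        refine TorusPt.charHom_ext fun w => ?_
        rw [TorusPt.charHom_single_one, TorusPt.mul_val, TorusPt.comap_val, TorusPt.comap_val,
          TorusPt.comap_val, ← TorusPt.val_add, TorusPt.univ_val,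
          AddMonoidAlgebra.mapDomainAlgHom_apply, AddMonoidAlgebra.mapDomain_single]
        simp
      have e2 : AddMonoidAlgebra.mapDomainAlgHom O O ((AddMonoidHom.id (s.Coinv M)).prod
          (0 : s.Coinv M →+ M)) = (TorusPt.comap (AddMonoidHom.inl _ _) T).charHom O := by
        refine TorusPt.charHom_ext fun w => ?_
        rw [TorusPt.charHom_single_one, TorusPt.comap_val, TorusPt.univ_val,
          AddMonoidAlgebra.mapDomainAlgHom_apply, AddMonoidAlgebra.mapDomain_single]
        simp
      rw [e1, e2]
      exact h
    have hinj := s.homologyHom_injective (M := M)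
    refine ⟨AddMonoidAlgebra.comapDomain _ hinj x, ?_⟩
    refine AddMonoidAlgebra.mapDomain_comapDomain (fun v hv => ?_) hinj
    exact (s.range_homologyHom (M := M)).ge (hsupp v hv)

end SplitGeneralisedTorus

/-! ### Points and identity component of a constant group scheme. -/

section ConstantGroup

variable {O Δ A : Type u} [CommRing O] [CommRing A] [Algebra O A]

theorem ConstAlg.mul_ind (f : ConstAlg O Δ) (c : Δ) : f * ind c = ev c f • ind c := by
  classical
  apply ext_ev
  intro r
  rw [map_mul, map_smul, ev_ind]
  split_ifs with h
  · rw [h, smul_eq_mul]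
  · simp

theorem ConstAlg.isIdempotentElem_ind (c : Δ) : IsIdempotentElem (ind c : ConstAlg O Δ) := by
  classical
  rw [IsIdempotentElem, ind_mul_ind, if_pos rfl]

variable [Group Δ] [Finite Δ]

/-- Multiplying f by the indicator of c leaves only f(c), so a point with value 1 on that indicator
must be evaluation at c. -/
theorem eq_constPt_of_apply_ind (x : Pt O (ConstAlg O Δ) A) (c : Δ)
    (h : x.ofConv (ConstAlg.ind c) = 1) : x = constPt O A c := by
  apply ofConv_injective
  ext f
  have h1 := congrArg x.ofConv (ConstAlg.mul_ind f c)
  rw [map_mul, map_smul, h, mul_one] at h1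
  rw [h1, ← Algebra.algebraMap_eq_smul_one]
  rfl

theorem constPt_apply_ind (c : Δ) : (constPt O A c).ofConv (ConstAlg.ind c) = 1 := by
  classical
  change algebraMap O A (ConstAlg.ev c (ConstAlg.ind c)) = 1
  rw [ConstAlg.ev_ind, if_pos rfl, map_one]

theorem mem_basicOpen_fibrePt {H K : Type u} [CommRing H] [HopfAlgebra O H] [Field K] [Algebra O K]
    (x : Pt O H K) (c : H) :
    fibrePt x ∈ PrimeSpectrum.basicOpen ((1 : K) ⊗ₜ[O] c) ↔ x.ofConv c ≠ 0 := by
  rw [PrimeSpectrum.mem_basicOpen]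
  change ¬ Algebra.TensorProduct.lift (AlgHom.id O K) x.ofConv (fun _ _ => Commute.all _ _)
    ((1 : K) ⊗ₜ[O] c) = 0 ↔ _
  rw [Algebra.TensorProduct.lift_tmul, map_one, one_mul]

/-- The identity component of a constant group scheme is trivial. -/
theorem eq_one_of_mem_identityComponent_const {h : Pt O (ConstAlg O Δ) A}
    (hh : h ∈ identityComponent O (ConstAlg O Δ) A) : h = 1 := by
  rw [← map_one (constPt O A (Δ := Δ))]
  apply eq_constPt_of_apply_ind
  have hidem : IsIdempotentElem (h.ofConv (ConstAlg.ind 1)) :=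
    (ConstAlg.isIdempotentElem_ind 1).map h.ofConv
  -- Otherwise this idempotent vanishes at some geometric point of A. There the locus where the
  -- indicator of 1 is nonzero is clopen and contains the identity, hence also h: a contradiction. A
  -- unit idempotent is 1.
  have hunit : IsUnit (h.ofConv (ConstAlg.ind 1)) := by
    by_contra hn
    obtain ⟨m, hm, ham⟩ := exists_max_ideal_of_mem_nonunits hn
    let := Ideal.Quotient.field m
    let K := AlgebraicClosure (A ⧸ m)
    let φ : A →ₐ[O] K := (IsScalarTower.toAlgHom O (A ⧸ m) K).comp (Ideal.Quotient.mkₐ O m)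
    have hclopen : IsClopen (PrimeSpectrum.basicOpen
        ((1 : K) ⊗ₜ[O] (ConstAlg.ind 1 : ConstAlg O Δ))).carrier := by
      refine PrimeSpectrum.isClopen_iff.2 ⟨_, ?_, rfl⟩
      rw [IsIdempotentElem, Algebra.TensorProduct.tmul_mul_tmul, one_mul,
        ConstAlg.isIdempotentElem_ind]
    have h1 : fibrePt (1 : Pt O (ConstAlg O Δ) K) ∈ PrimeSpectrum.basicOpen
        ((1 : K) ⊗ₜ[O] (ConstAlg.ind 1 : ConstAlg O Δ)) := by
      rw [mem_basicOpen_fibrePt, ← map_one (constPt O K (Δ := Δ)), constPt_apply_ind]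
      exact one_ne_zero
    have h2 := hclopen.connectedComponent_subset h1 (hh K φ)
    refine (mem_basicOpen_fibrePt _ _).1 h2 ?_
    change algebraMap (A ⧸ m) K (Ideal.Quotient.mk m (h.ofConv (ConstAlg.ind 1))) = 0
    rw [Ideal.Quotient.eq_zero_iff_mem.2 ham, map_zero]
  exact hunit.mul_left_cancel (hidem.trans (mul_one _).symm)

end ConstantGroup

/-! ### The universal point of Gⁿ, characters of Mⁿ, and chains attached to tuples. -/

section CoordinateRings

variable {O H : Type u} [CommRing O] [CommRing H] [HopfAlgebra O H]

/-- The tuple of projections is the universal point of Gⁿ. This allows a function to be recovered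
from its values at points. -/
theorem evalAt_coordPt (n : ℕ) : evalAt (coordPt O H n) = AlgHom.id O (CoordPow O H n) := by
  apply AlgHom.toLinearMap_injective
  apply PiTensorProduct.ext
  ext x
  change evalAt (coordPt O H n) (PiTensorProduct.tprod O x) = PiTensorProduct.tprod O x
  rw [evalAt_tprod]
  change ∏ i, PiTensorProduct.tprodMonoidHom O (Pi.mulSingle i (x i)) = _
  rw [← map_prod, Finset.univ_prod_mulSingle]
  rfl

end CoordinateRings

section TorusPowers

variable {O M A B : Type u} [CommRing O] [AddCommGroup M] [CommRing A] [Algebra O A]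
  [CommRing B] [Algebra O B] {n : ℕ}

/-- The character `(mᵢ) ↦ ∏ tᵢ(mᵢ)` of `Mⁿ`. -/
def TorusPt.pi (t : Fin n → TorusPt M A) : TorusPt (Fin n → M) A :=
  TorusPt.ofAddHom (∑ i, (t i).toAddHom.comp (Pi.evalAddMonoidHom _ i))

theorem TorusPt.pi_val (t : Fin n → TorusPt M A) (m : Fin n → M) :
    (TorusPt.pi t).val m = ∏ i, (t i).val (m i) := by
  rw [TorusPt.pi, TorusPt.ofAddHom_val, AddMonoidHom.finsetSum_apply]
  exact toMul_sum _ _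

theorem TorusPt.map_pi (f : A →ₐ[O] B) (t : Fin n → TorusPt M A) :
    TorusPt.map f (TorusPt.pi t) = TorusPt.pi fun i => TorusPt.map f (t i) :=
  TorusPt.ext_val fun m => Units.ext <| by
    rw [TorusPt.map_val, TorusPt.pi_val, TorusPt.pi_val, Units.coe_prod, Units.coe_prod, map_prod]
    rfl

theorem TorusPt.pi_comap_single {W : Type u} [AddCommGroup W] (t : TorusPt W A)
    (f : Fin n → M →+ W) (m : Fin n → M) :
    (TorusPt.pi fun i => TorusPt.comap (f i) t).val m = t.val (∑ i, f i (m i)) := by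
  rw [TorusPt.pi_val, TorusPt.val_sum]
  rfl

end TorusPowers

section TupleChains

variable {Γ Δ M : Type u} [AddCommGroup M] {n : ℕ} (γ : Fin n → Γ)

/-- The chain `∑ᵢ mᵢ [γᵢ]`. -/
def tupleChain : (Fin n → M) →+ (Γ →₀ M) :=
  ∑ i, (Finsupp.singleAddHom (γ i)).comp (Pi.evalAddMonoidHom _ i)

theorem tupleChain_apply (m : Fin n → M) :
    tupleChain γ m = ∑ i, Finsupp.single (γ i) (m i) := by
  rw [tupleChain, AddMonoidHom.finsetSum_apply]
  rfl

variable [Group Γ] [Group Δ] [DistribMulAction Δ M]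

theorem d₁_tupleChain (π : Γ →* Δ) (m : Fin n → M) :
    d₁ π M (tupleChain γ m) = ∑ i, ((π (γ i))⁻¹ • m i - m i) := by
  rw [tupleChain_apply, map_sum]
  simp only [CosetReps.d₁_single]

/-- Computes the weight of the character (mᵢ) under simultaneous conjugation: it is -d₁ of the chain
∑ mᵢ[γᵢ], so invariance is the cycle condition. -/
theorem TorusPt.pi_coboundary_val {A : Type u} [CommRing A] (π : Γ →* Δ) (h : TorusPt M A)
    (t : Fin n → TorusPt M A) (m : Fin n → M) :
    (TorusPt.pi fun i => h * (π (γ i) • h)⁻¹ * t i).val m =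
      h.val (-d₁ π M (tupleChain γ m)) * (TorusPt.pi t).val m := by
  rw [TorusPt.pi_val, TorusPt.pi_val, d₁_tupleChain, ← Finset.sum_neg_distrib, TorusPt.val_sum,
    ← Finset.prod_mul_distrib]
  refine Finset.prod_congr rfl fun i _ => ?_
  rw [neg_sub, TorusPt.val_sub]
  rfl

end TupleChains

/-! ### Components of Gⁿ over Δⁿ and their invariant functions. -/

namespace SplitGeneralisedTorus

variable {O M Δ H Γ A B : Type u} [CommRing O] [AddCommGroup M] [Group Δ] [Finite Δ]
  [CommRing H] [HopfAlgebra O H] [Group Γ] {G : SplitGeneralisedTorus O M Δ H} {π : Γ →* Δ}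
  [CommRing A] [Algebra O A] [CommRing B] [Algebra O B] {n : ℕ}

section Idempotents

variable (G π) in
/-- The idempotent of `O[Gⁿ]` which cuts out the component of `Gⁿ` over
`(π γ₁, …, π γₙ) ∈ Δⁿ`. -/
def componentIdem (γ : Fin n → Γ) : CoordPow O H n :=
  PiTensorProduct.tprod O fun i => G.proj (ConstAlg.ind (π (γ i)))

theorem evalAt_componentIdem (γ : Fin n → Γ) (g : Fin n → Pt O H A) :
    evalAt g (componentIdem G π γ) =
      ∏ i, (G.Proj A (g i)).ofConv (ConstAlg.ind (π (γ i))) := evalAt_tprod _ _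

theorem isIdempotentElem_componentIdem (γ : Fin n → Γ) :
    IsIdempotentElem (componentIdem G π γ) := by
  rw [IsIdempotentElem, componentIdem, PiTensorProduct.tprod_mul_tprod]
  congr 1
  ext1 i
  rw [Pi.mul_apply, ← map_mul, ConstAlg.isIdempotentElem_ind]

theorem evalAt_componentIdem_of_Proj {γ : Fin n → Γ} {g : Fin n → Pt O H A}
    (hg : ∀ i, G.Proj A (g i) = constPt O A (π (γ i))) :
    evalAt g (componentIdem G π γ) = 1 := by
  rw [evalAt_componentIdem]
  exact Finset.prod_eq_one fun i _ => by rw [hg, constPt_apply_ind]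

/-- Each factor of a product equal to 1 is a unit, and a unit idempotent is 1. -/
theorem Proj_eq_of_evalAt_componentIdem {γ : Fin n → Γ} {g : Fin n → Pt O H A}
    (hg : evalAt g (componentIdem G π γ) = 1) (i : Fin n) :
    G.Proj A (g i) = constPt O A (π (γ i)) := by
  rw [evalAt_componentIdem] at hg
  refine eq_constPt_of_apply_ind _ _ ?_
  have hu : IsUnit ((G.Proj A (g i)).ofConv (ConstAlg.ind (π (γ i)))) :=
    isUnit_of_dvd_one (hg ▸ Finset.dvd_prod_of_mem _ (Finset.mem_univ i))
  exact (IsIdempotentElem.iff_eq_one_of_isUnit hu).1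
    ((ConstAlg.isIdempotentElem_ind _).map (G.Proj A (g i)).ofConv)

theorem tprod_ind_mem_invariants (c : Fin n → Δ) :
    PiTensorProduct.tprod O (fun i => ConstAlg.ind (c i)) ∈
      invariants O (ConstAlg O Δ) n := by
  intro A _ _ h hh g
  rw [eq_one_of_mem_identityComponent_const hh]
  simp

theorem pullback_tprod_ind (γ : Fin n → Γ) :
    (pullback G.proj n ⟨_, tprod_ind_mem_invariants fun i => π (γ i)⟩).1 =
      componentIdem G π γ := by
  change evalAt (fun i => Pt.push G.proj (coordPt O H n i)) (PiTensorProduct.tprod O _) = _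
  have h := DFunLike.congr_fun (evalAt_coordPt (O := O) (H := H) n) (componentIdem G π γ)
  rw [componentIdem, evalAt_tprod] at h
  rw [evalAt_tprod]
  exact h

theorem componentIdem_mem_invariants (γ : Fin n → Γ) :
    componentIdem G π γ ∈ invariants O H n :=
  pullback_tprod_ind (G := G) (π := π) γ ▸ Subtype.prop _

/-- The idempotent is pulled back from Δⁿ, where admissibility prescribes the value: the indicator
of (πγ₁, …, πγₙ) evaluated at that very tuple. -/
theorem PC.Θ_componentIdem (T : G.PC π A) (γ : Fin (n + 1) → Γ) :
    T.1.Θ n ⟨componentIdem G π γ, componentIdem_mem_invariants γ⟩ γ = 1 := by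
  have h := congrArg (fun S => S.Θ n ⟨_, tprod_ind_mem_invariants fun i => π (γ i)⟩ γ) T.2
  have h1 : pullback G.proj (n + 1) ⟨_, tprod_ind_mem_invariants fun i => π (γ i)⟩ =
      ⟨componentIdem G π γ, componentIdem_mem_invariants γ⟩ := Subtype.ext (pullback_tprod_ind γ)
  change T.1.Θ n (pullback G.proj (n + 1) _) γ = evalAt _ (PiTensorProduct.tprod O _) at h
  rw [h1, evalAt_tprod] at h
  rw [h]
  exact Finset.prod_eq_one fun i _ => constPt_apply_ind _

end Idempotents

section GenericPoint

variable (ρ₀ : G.Rep π O)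

/-- The generic point of the component of `Gⁿ` over `(π γ₁, …, π γₙ)`, with coordinates in
`O[Mⁿ]`. -/
def genericPt (γ : Fin n → Γ) (i : Fin n) : Pt O H (AddMonoidAlgebra O (Fin n → M)) :=
  G.ι _ (TorusPt.comap (AddMonoidHom.single (fun _ : Fin n => M) i) (TorusPt.univ O _)) *
    baseHom ρ₀ _ (γ i)

/-- Evaluation of functions on `Gⁿ` at the generic point of a component. -/
def evalGeneric (γ : Fin n → Γ) : CoordPow O H n →ₐ[O] AddMonoidAlgebra O (Fin n → M) :=
  evalAt (genericPt ρ₀ γ)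

theorem map_ι_mul_baseHom (f : A →ₐ[O] B) (t : TorusPt M A) (γ : Γ) :
    Pt.map H f (G.ι A t * baseHom ρ₀ A γ) = G.ι B (TorusPt.map f t) * baseHom ρ₀ B γ := by
  rw [map_mul, map_baseHom, ι_map]

theorem Proj_ι_mul_baseHom (t : TorusPt M A) (γ : Γ) :
    G.Proj A (G.ι A t * baseHom ρ₀ A γ) = constPt O A (π γ) := by
  rw [map_mul, Proj_ι, one_mul, Proj_baseHom]

theorem map_charHom_univ_single (t : Fin n → TorusPt M A) (i : Fin n) :
    TorusPt.map ((TorusPt.pi t).charHom O)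
      (TorusPt.comap (AddMonoidHom.single (fun _ : Fin n => M) i) (TorusPt.univ O _)) = t i := by
  refine TorusPt.ext_val fun m => Units.ext ?_
  rw [TorusPt.map_val, TorusPt.comap_val, TorusPt.univ_val, TorusPt.charHom_single_one,
    TorusPt.pi_val, Finset.prod_eq_single i]
  · simp
  · intro j _ hj
    rw [AddMonoidHom.single_apply, Pi.single_eq_of_ne hj, TorusPt.val_zero]
  · simp

/-- A tuple over (πγ₁, …, πγₙ) written through ρ₀ is the specialisation of the generic point along
the character (tᵢ) of Mⁿ. -/
theorem evalAt_ι_mul_baseHom (γ : Fin n → Γ) (t : Fin n → TorusPt M A) (f : CoordPow O H n) :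
    evalAt (fun i => G.ι A (t i) * baseHom ρ₀ A (γ i)) f =
      (TorusPt.pi t).charHom O (evalGeneric ρ₀ γ f) := by
  rw [evalGeneric, ← AlgHom.comp_apply, algHom_comp_evalAt]
  congr 2
  ext1 i
  rw [genericPt, map_ι_mul_baseHom, map_charHom_univ_single]

theorem evalGeneric_componentIdem (γ : Fin n → Γ) :
    evalGeneric ρ₀ γ (componentIdem G π γ) = 1 :=
  evalAt_componentIdem_of_Proj fun _ => Proj_ι_mul_baseHom _ _ _

theorem exists_eq_ι_mul_baseHom {γ : Fin n → Γ} {g : Fin n → Pt O H A}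
    (hg : evalAt g (componentIdem G π γ) = 1) :
    ∃ t : Fin n → TorusPt M A, ∀ i, g i = G.ι A (t i) * baseHom ρ₀ A (γ i) := by
  have h1 : ∀ i, ∃ t, G.ι A t = g i * (baseHom ρ₀ A (γ i))⁻¹ := fun i => exists_ι_eq (by
    rw [map_mul, map_inv, Proj_eq_of_evalAt_componentIdem hg, Proj_baseHom, mul_inv_cancel])
  choose t ht using h1
  exact ⟨t, fun i => by rw [ht, inv_mul_cancel_right]⟩

end GenericPoint

section Components

variable (ρ₀ : G.Rep π O)

/-- Equality of elements of `εA` can be checked in `A / (1 - ε)`. -/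
theorem eq_of_mk_eq_of_mul_eq {ε a b : A} (ha : ε * a = a) (hb : ε * b = b)
    (h : Ideal.Quotient.mkₐ O (Ideal.span {1 - ε}) a = Ideal.Quotient.mkₐ O (Ideal.span {1 - ε}) b)
    (hε : IsIdempotentElem ε) : a = b := by
  obtain ⟨c, hc⟩ := Ideal.mem_span_singleton'.1 (Ideal.Quotient.eq.1 h)
  have h1 : ε * (a - b) = 0 := by
    rw [← hc, mul_left_comm, mul_sub, mul_one, hε.eq, sub_self, mul_zero]
  rw [mul_sub, ha, hb, sub_eq_zero] at h1
  exact h1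

theorem mk_eq_one (ε : A) : Ideal.Quotient.mkₐ O (Ideal.span {1 - ε}) ε = 1 :=
  (Ideal.Quotient.eq.2 (Ideal.mem_span_singleton_self _)).symm.trans (map_one _)

variable (γ : Fin n → Γ)

/-- A function on a component of `Gⁿ` is determined by its value at the generic point. -/
theorem componentIdem_mul_eq_of_evalGeneric_eq {f f' : CoordPow O H n}
    (h : evalGeneric ρ₀ γ f = evalGeneric ρ₀ γ f') :
    componentIdem G π γ * f = componentIdem G π γ * f' := by
  have he := isIdempotentElem_componentIdem (G := G) (π := π) γ
  refine eq_of_mk_eq_of_mul_eq (O := O) (ε := componentIdem G π γ)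
    (by rw [← mul_assoc, he.eq]) (by rw [← mul_assoc, he.eq]) ?_ he
  -- Modulo 1 - ε the universal tuple of Gⁿ lies on the component, so it is a specialisation of the
  -- generic point, and the image of a function under `mk` depends only on its generic value.
  set mk := Ideal.Quotient.mkₐ O (Ideal.span {1 - componentIdem G π γ}) with hmk
  have hev : ∀ x, mk x = evalAt (fun i => Pt.map H mk (coordPt O H n i)) x := fun x => by
    rw [← algHom_comp_evalAt, evalAt_coordPt]
    rfl
  obtain ⟨t, ht⟩ := exists_eq_ι_mul_baseHom ρ₀ (γ := γ)
    (g := fun i => Pt.map H mk (coordPt O H n i)) (by rw [← hev, hmk, mk_eq_one])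
  have ht' : (fun i => Pt.map H mk (coordPt O H n i)) =
      fun i => G.ι _ (t i) * baseHom ρ₀ _ (γ i) := funext ht
  rw [map_mul, map_mul, hev f, hev f', ht', evalAt_ι_mul_baseHom, evalAt_ι_mul_baseHom, h]

/-- With `componentIdem_mul_eq_of_evalGeneric_eq` this identifies the functions on the component
with O[Mⁿ]. The tautological tuple over O[Gⁿ]/(1 - ε) has a torus part, and the character m of that
part is the desired function. -/
theorem exists_evalGeneric_eq_single (m : Fin n → M) : ∃ f : CoordPow O H n,
    componentIdem G π γ * f = f ∧ evalGeneric ρ₀ γ f = AddMonoidAlgebra.single m 1 := by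
  have he := isIdempotentElem_componentIdem (G := G) (π := π) γ
  set mk := Ideal.Quotient.mkₐ O (Ideal.span {1 - componentIdem G π γ}) with hmk
  have hev : ∀ x, mk x = evalAt (fun i => Pt.map H mk (coordPt O H n i)) x := fun x => by
    rw [← algHom_comp_evalAt, evalAt_coordPt]
    rfl
  obtain ⟨t, ht⟩ := exists_eq_ι_mul_baseHom ρ₀ (γ := γ)
    (g := fun i => Pt.map H mk (coordPt O H n i)) (by rw [← hev, hmk, mk_eq_one])
  -- Evaluation at the generic point factors through the component, and it takes the torus part `t`
  -- of the tautological tuple to the universal characters, since 𝔇(M) → G is injective on points.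
  let k := Ideal.Quotient.liftₐ (Ideal.span {1 - componentIdem G π γ}) (evalGeneric ρ₀ γ)
    (fun a ha => by
      obtain ⟨c, rfl⟩ := Ideal.mem_span_singleton'.1 ha
      rw [map_mul, map_sub, map_one, evalGeneric_componentIdem, sub_self, mul_zero])
  have hk : k.comp mk = evalGeneric ρ₀ γ := AlgHom.ext fun x => rfl
  have hkt : ∀ i, TorusPt.map k (t i) =
      TorusPt.comap (AddMonoidHom.single (fun _ : Fin n => M) i) (TorusPt.univ O _) := by
    intro i
    apply ι_injective (G := G)
    apply mul_right_cancel (b := baseHom ρ₀ _ (γ i))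
    rw [← map_ι_mul_baseHom, ← ht]
    change Pt.map H (k.comp mk) (coordPt O H n i) = genericPt ρ₀ γ i
    rw [hk, evalGeneric, map_evalAt_coordPt]
  obtain ⟨f₀, hf₀⟩ := Ideal.Quotient.mkₐ_surjective O (Ideal.span {1 - componentIdem G π γ})
    ((TorusPt.pi t).val m)
  refine ⟨componentIdem G π γ * f₀, by rw [← mul_assoc, he.eq], ?_⟩
  rw [map_mul, evalGeneric_componentIdem, one_mul, ← hk, AlgHom.comp_apply]
  change k (Ideal.Quotient.mkₐ O _ f₀) = _
  rw [hf₀, ← TorusPt.map_val, TorusPt.map_pi, funext hkt, TorusPt.pi_comap_single,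
    TorusPt.univ_val]
  congr 1
  exact Finset.univ_sum_single m

/-- The value of an admissible pseudocharacter at `(γ₁, …, γₙ)` only depends on the restriction of
functions to the component over `(π γ₁, …, π γₙ)`. -/
theorem PC.Θ_eq_of_evalGeneric_eq (T : G.PC π A) (γ : Fin (n + 1) → Γ) {f f' : invariants O H (n + 1)}
    (h : evalGeneric ρ₀ γ f.1 = evalGeneric ρ₀ γ f'.1) : T.1.Θ n f γ = T.1.Θ n f' γ := by
  have h1 : (⟨componentIdem G π γ, componentIdem_mem_invariants γ⟩ : invariants O H (n + 1)) * f =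
      ⟨componentIdem G π γ, componentIdem_mem_invariants γ⟩ * f' :=
    Subtype.ext (componentIdem_mul_eq_of_evalGeneric_eq ρ₀ γ h)
  have h2 := congrArg (fun y => T.1.Θ n y γ) h1
  simp only [map_mul, Pi.mul_apply] at h2
  rwa [PC.Θ_componentIdem, one_mul, one_mul] at h2

variable [DistribMulAction Δ M]

variable (hG : G.IsConjugationAction)

include hG

/-- A function on a component of `Gⁿ` whose generic value is the character of a cycle is
invariant. -/
theorem mem_invariants_of_evalGeneric_eq_single {f : CoordPow O H n} {m : Fin n → M}
    (hf : componentIdem G π γ * f = f) (hm : evalGeneric ρ₀ γ f = AddMonoidAlgebra.single m 1)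
    (hd : d₁ π M (tupleChain γ m) = 0) : f ∈ invariants O H n := by
  intro A _ _ h hh g
  rw [← G.range_incl A] at hh
  obtain ⟨τ, rfl⟩ := hh
  change evalAt (fun i => G.ι A τ * g i * (G.ι A τ)⁻¹) f = _
  -- Conjugation by G⁰ does not change Π, so the idempotent has the same value ε at both tuples. As
  -- f is supported on the component, both sides are multiples of ε and may be compared modulo 1 -
  -- ε, where the tuple lies on the component.
  set ε := evalAt g (componentIdem G π γ) with hε
  have hε' : evalAt (fun i => G.ι A τ * g i * (G.ι A τ)⁻¹) (componentIdem G π γ) = ε := by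
    rw [hε, evalAt_componentIdem, evalAt_componentIdem]
    refine Finset.prod_congr rfl fun i _ => ?_
    rw [map_mul, map_mul, map_inv, Proj_ι, one_mul, inv_one, mul_one]
  refine eq_of_mk_eq_of_mul_eq (O := O) (ε := ε) ?_ ?_ ?_
    ((isIdempotentElem_componentIdem γ).map (evalAt g))
  · rw [← hε', ← map_mul, hf]
  · rw [hε, ← map_mul, hf]
  · set mk := Ideal.Quotient.mkₐ O (Ideal.span {1 - ε}) with hmk
    rw [← AlgHom.comp_apply, ← AlgHom.comp_apply, algHom_comp_evalAt, algHom_comp_evalAt]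
    obtain ⟨t, ht⟩ := exists_eq_ι_mul_baseHom ρ₀ (γ := γ) (g := fun i => Pt.map H mk (g i)) (by
      rw [← algHom_comp_evalAt, AlgHom.comp_apply, ← hε, hmk, mk_eq_one])
    have hc : ∀ i, Pt.map H mk (G.ι A τ * g i * (G.ι A τ)⁻¹) =
        G.ι _ (TorusPt.map mk τ * (π (γ i) • TorusPt.map mk τ)⁻¹ * t i) * baseHom ρ₀ _ (γ i) := by
      intro i
      rw [map_mul, map_mul, map_inv, ← ι_map, ht, conj_ι_mul_baseHom hG ρ₀]
    simp only [hc, ht]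
    rw [evalAt_ι_mul_baseHom, evalAt_ι_mul_baseHom, hm, TorusPt.charHom_single_one,
      TorusPt.charHom_single_one, TorusPt.pi_coboundary_val, hd, neg_zero, TorusPt.val_zero, one_mul]

/-- The generic value of an invariant function is a combination of characters of cycles. -/
theorem d₁_eq_zero_of_mem_support {f : CoordPow O H n} (hf : f ∈ invariants O H n)
    {m : Fin n → M} (hm : m ∈ (evalGeneric ρ₀ γ f).coeff.support) :
    d₁ π M (tupleChain γ m) = 0 := by
  refine neg_eq_zero.1 (eq_zero_of_mem_support_of_graph (-(d₁ π M).comp (tupleChain γ))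
    (evalGeneric ρ₀ γ f) ?_ hm)
  -- The universal case: the generic point of the component, conjugated by the generic point of
  -- 𝔇(M).
  let V := AddMonoidAlgebra O ((Fin n → M) × M)
  let T : TorusPt ((Fin n → M) × M) V := TorusPt.univ O _
  let τ : TorusPt M V := TorusPt.comap (AddMonoidHom.inr _ _) T
  let t : Fin n → TorusPt M V := fun i =>
    TorusPt.comap ((AddMonoidHom.inl (Fin n → M) M).comp (AddMonoidHom.single (fun _ => M) i)) T
  have h := hf V (G.ι V τ) (G.range_incl V ▸ ⟨τ, rfl⟩)
    (fun i => G.ι V (t i) * baseHom ρ₀ V (γ i))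
  simp only [conj_ι_mul_baseHom hG ρ₀] at h
  rw [evalAt_ι_mul_baseHom, evalAt_ι_mul_baseHom] at h
  have ht : ∀ w, (TorusPt.pi t).val w = T.val (w, 0) := fun w => by
    rw [TorusPt.pi_comap_single]
    congr 1
    simp only [AddMonoidHom.comp_apply]
    rw [← map_sum]
    exact congrArg (fun v => (v, (0 : M))) (Finset.univ_sum_single w)
  have e1 : AddMonoidAlgebra.mapDomainAlgHom O O ((AddMonoidHom.id (Fin n → M)).prod
      (-(d₁ π M).comp (tupleChain γ))) =
      (TorusPt.pi fun i => τ * (π (γ i) • τ)⁻¹ * t i).charHom O := by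
    refine TorusPt.charHom_ext fun w => ?_
    rw [TorusPt.charHom_single_one, TorusPt.pi_coboundary_val, ht, TorusPt.comap_val, ← TorusPt.val_add,
      TorusPt.univ_val, AddMonoidAlgebra.mapDomainAlgHom_apply, AddMonoidAlgebra.mapDomain_single]
    simp
  have e2 : AddMonoidAlgebra.mapDomainAlgHom O O ((AddMonoidHom.id (Fin n → M)).prod
      (0 : (Fin n → M) →+ M)) = (TorusPt.pi t).charHom O := by
    refine TorusPt.charHom_ext fun w => ?_
    rw [TorusPt.charHom_single_one, ht,
      TorusPt.univ_val, AddMonoidAlgebra.mapDomainAlgHom_apply, AddMonoidAlgebra.mapDomain_single]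
    simp
  rw [e1, e2]
  exact h

end Components

end SplitGeneralisedTorus

/-! ### Representing chains by tuples of group elements. -/

section TupleChains

variable {Γ M : Type u} [AddCommGroup M] {n k : ℕ}

/-- The push-forward of a tuple along a map of index sets. -/
def pushTuple (ζ : Fin n → Fin k) (m : Fin n → M) : Fin k → M := ∑ i, Pi.single (ζ i) (m i)

theorem tupleChain_single (γ : Fin k → Γ) (j : Fin k) (x : M) :
    tupleChain γ (Pi.single j x) = Finsupp.single (γ j) x := by
  rw [tupleChain_apply, Finset.sum_eq_single j]
  · simp
  · intro i _ hi
    rw [Pi.single_eq_of_ne hi, Finsupp.single_zero]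
  · simp

theorem tupleChain_pushTuple (γ : Fin k → Γ) (ζ : Fin n → Fin k) (m : Fin n → M) :
    tupleChain γ (pushTuple ζ m) = tupleChain (fun i => γ (ζ i)) m := by
  rw [pushTuple, map_sum, tupleChain_apply]
  simp only [tupleChain_single]

theorem tupleChain_apply_of_injective {γ : Fin n → Γ} (hγ : Function.Injective γ) (m : Fin n → M)
    (i : Fin n) : tupleChain γ m (γ i) = m i := by
  classical
  rw [tupleChain_apply, Finsupp.finsetSum_apply, Finset.sum_eq_single i]
  · simp
  · intro j _ hj
    exact Finsupp.single_eq_of_ne (hγ.ne hj).symm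
  · simp

theorem tupleChain_injective {γ : Fin n → Γ} (hγ : Function.Injective γ) :
    Function.Injective (tupleChain (M := M) γ) := fun m m' h => funext fun i => by
  rw [← tupleChain_apply_of_injective hγ m i, h, tupleChain_apply_of_injective hγ]

theorem tupleChain_comp {γ : Fin n → Γ} (hγ : Function.Injective γ) (z : Γ →₀ M)
    (hz : ∀ x ∈ z.support, x ∈ Set.range γ) : tupleChain γ (fun i => z (γ i)) = z := by
  classical
  ext x
  by_cases hx : x ∈ Set.range γ
  · obtain ⟨i, rfl⟩ := hx
    rw [tupleChain_apply_of_injective hγ]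
  · have h1 : z x = 0 := by
      by_contra h
      exact hx (hz x (Finsupp.mem_support_iff.2 h))
    rw [h1, tupleChain_apply, Finsupp.finsetSum_apply]
    refine Finset.sum_eq_zero fun i _ => Finsupp.single_eq_of_ne ?_
    rintro rfl
    exact hx ⟨i, rfl⟩

theorem exists_enumeration (S : Set Γ) (hS : S.Finite) (hne : S.Nonempty) :
    ∃ (n : ℕ) (γ : Fin (n + 1) → Γ), Function.Injective γ ∧ Set.range γ = S := by
  have := hS.to_subtype
  have := hne.to_subtype
  obtain ⟨n, ⟨e⟩⟩ := Finite.exists_equiv_fin S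
  cases n with
  | zero => exact (e (Classical.arbitrary S)).elim0
  | succ n =>
    refine ⟨n, fun i => (e.symm i).1, fun i j h => e.symm.injective (Subtype.ext h), ?_⟩
    ext x
    constructor
    · rintro ⟨i, rfl⟩
      exact (e.symm i).2
    · intro hx
      exact ⟨e ⟨x, hx⟩, by simp⟩

/-- Two chains are carried by a common tuple of distinct elements. -/
theorem exists_common_tuple [Inhabited Γ] (z z' : Γ →₀ M) :
    ∃ (n : ℕ) (γ : Fin (n + 1) → Γ) (m m' : Fin (n + 1) → M), tupleChain γ m = z ∧
      tupleChain γ m' = z' := by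
  -- Inserting `default` keeps the tuple nonempty even for zero chains, as pseudocharacters start
  -- with one variable.
  obtain ⟨n, γ, hγ, hr⟩ := exists_enumeration
    (insert default ((z.support : Set Γ) ∪ z'.support))
    (((Finset.finite_toSet _).union (Finset.finite_toSet _)).insert _) ⟨default, Or.inl rfl⟩
  exact ⟨n, γ, _, _, tupleChain_comp hγ z fun x hx => hr.ge (Or.inr (Or.inl hx)),
    tupleChain_comp hγ z' fun x hx => hr.ge (Or.inr (Or.inr hx))⟩

end TupleChains

/-! ### From pseudocharacters to characters of H₁. -/

namespace SplitGeneralisedTorus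

variable {O M Δ H Γ A B : Type u} [CommRing O] [AddCommGroup M] [Group Δ] [Finite Δ]
  [CommRing H] [HopfAlgebra O H] [Group Γ] {G : SplitGeneralisedTorus O M Δ H} {π : Γ →* Δ}
  [CommRing A] [Algebra O A] [CommRing B] [Algebra O B] {n k : ℕ}
  [DistribMulAction Δ M] (hG : G.IsConjugationAction) (ρ₀ : G.Rep π O)

/-- The invariant function `(g₁, …, gₙ) ↦ ∏ mᵢ(gᵢ ρ₀(γᵢ)⁻¹)` on the component of `Gⁿ` over
`(π γ₁, …, π γₙ)`, attached to a cycle `∑ mᵢ [γᵢ]`. -/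
def cycleFun (γ : Fin n → Γ) (m : Fin n → M) (hd : d₁ π M (tupleChain γ m) = 0) :
    invariants O H n :=
  ⟨(exists_evalGeneric_eq_single ρ₀ γ m).choose,
    mem_invariants_of_evalGeneric_eq_single ρ₀ γ hG
      (exists_evalGeneric_eq_single ρ₀ γ m).choose_spec.1
      (exists_evalGeneric_eq_single ρ₀ γ m).choose_spec.2 hd⟩

/-- The choice made in `cycleFun` is harmless: by `PC.Θ_eq_of_evalGeneric_eq` the generic value
alone determines the value of Θ at γ. -/
theorem evalGeneric_cycleFun (γ : Fin n → Γ) (m : Fin n → M)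
    (hd : d₁ π M (tupleChain γ m) = 0) :
    evalGeneric ρ₀ γ (cycleFun hG ρ₀ γ m hd).1 = AddMonoidAlgebra.single m 1 :=
  (exists_evalGeneric_eq_single ρ₀ γ m).choose_spec.2

namespace PC

variable (T : G.PC π A)

/-- The value at `(γ₁, …, γₙ)` of the function attached to a cycle `∑ mᵢ [γᵢ]`. -/
def cycleVal (γ : Fin (n + 1) → Γ) (m : Fin (n + 1) → M) (hd : d₁ π M (tupleChain γ m) = 0) : A :=
  T.1.Θ n (cycleFun hG ρ₀ γ m hd) γ

theorem cycleVal_add (γ : Fin (n + 1) → Γ) (m m' : Fin (n + 1) → M)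
    (hd : d₁ π M (tupleChain γ m) = 0) (hd' : d₁ π M (tupleChain γ m') = 0)
    (hs : d₁ π M (tupleChain γ (m + m')) = 0) :
    cycleVal hG ρ₀ T γ (m + m') hs = cycleVal hG ρ₀ T γ m hd * cycleVal hG ρ₀ T γ m' hd' := by
  rw [cycleVal, cycleVal, cycleVal, ← Pi.mul_apply, ← map_mul]
  apply Θ_eq_of_evalGeneric_eq ρ₀
  rw [evalGeneric_cycleFun, Subalgebra.coe_mul, map_mul, evalGeneric_cycleFun,
    evalGeneric_cycleFun, AddMonoidAlgebra.single_mul_single, mul_one]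

theorem cycleVal_zero (γ : Fin (n + 1) → Γ) (hd : d₁ π M (tupleChain γ 0) = 0) :
    cycleVal hG ρ₀ T γ 0 hd = 1 := by
  have h1 : T.1.Θ n 1 γ = 1 := by rw [map_one, Pi.one_apply]
  rw [cycleVal, ← h1]
  apply Θ_eq_of_evalGeneric_eq ρ₀
  rw [evalGeneric_cycleFun, Subalgebra.coe_one, map_one]
  rfl

/-- The reindexing axiom: repeated entries of a tuple may be merged by adding their coefficients. -/
theorem cycleVal_pushTuple (γ : Fin (k + 1) → Γ) (ζ : Fin (n + 1) → Fin (k + 1))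
    (m : Fin (n + 1) → M) (hd : d₁ π M (tupleChain (fun i => γ (ζ i)) m) = 0)
    (hd' : d₁ π M (tupleChain γ (pushTuple ζ m)) = 0) :
    cycleVal hG ρ₀ T γ (pushTuple ζ m) hd' = cycleVal hG ρ₀ T (fun i => γ (ζ i)) m hd := by
  rw [cycleVal, cycleVal, ← T.1.reindex' n k ζ]
  apply Θ_eq_of_evalGeneric_eq ρ₀
  rw [evalGeneric_cycleFun]
  change _ = evalAt (genericPt ρ₀ γ) (reindex ζ _).1
  rw [evalAt_reindex]
  change _ = evalAt (fun i => G.ι _ _ * baseHom ρ₀ _ (γ (ζ i))) _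
  rw [evalAt_ι_mul_baseHom, evalGeneric_cycleFun, TorusPt.charHom_single_one,
    TorusPt.pi_comap_single, TorusPt.univ_val]
  rfl

/-- Both tuples are reindexings of one tuple `ω` of distinct elements. Over `ω` the coefficients are
determined by the chain, so the pushed-forward tuples coincide. -/
theorem cycleVal_eq_of_tupleChain_eq (γ : Fin (n + 1) → Γ) (m : Fin (n + 1) → M)
    (γ' : Fin (k + 1) → Γ) (m' : Fin (k + 1) → M) (hd : d₁ π M (tupleChain γ m) = 0)
    (hd' : d₁ π M (tupleChain γ' m') = 0) (h : tupleChain γ m = tupleChain γ' m') :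
    cycleVal hG ρ₀ T γ m hd = cycleVal hG ρ₀ T γ' m' hd' := by
  obtain ⟨l, ω, hω, hr⟩ := exists_enumeration (Set.range γ ∪ Set.range γ')
    ((Set.finite_range γ).union (Set.finite_range γ')) ⟨γ 0, Or.inl ⟨0, rfl⟩⟩
  have h1 : ∀ i, ∃ j, ω j = γ i := fun i => hr.ge (Or.inl ⟨i, rfl⟩)
  have h2 : ∀ i, ∃ j, ω j = γ' i := fun i => hr.ge (Or.inr ⟨i, rfl⟩)
  choose ζ hζ using h1
  choose ζ' hζ' using h2
  obtain rfl : (fun i => ω (ζ i)) = γ := funext hζ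
  obtain rfl : (fun i => ω (ζ' i)) = γ' := funext hζ'
  have hp : pushTuple ζ m = pushTuple ζ' m' := tupleChain_injective hω (by
    rw [tupleChain_pushTuple, tupleChain_pushTuple, h])
  rw [← cycleVal_pushTuple hG ρ₀ T ω ζ m hd (by rwa [tupleChain_pushTuple]),
    ← cycleVal_pushTuple hG ρ₀ T ω ζ' m' hd' (by rwa [tupleChain_pushTuple])]
  simp only [hp]

theorem exists_tuple (z : Γ →₀ M) :
    ∃ (n : ℕ) (γ : Fin (n + 1) → Γ) (m : Fin (n + 1) → M), tupleChain γ m = z := by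
  have : Inhabited Γ := ⟨1⟩
  obtain ⟨n, γ, m, -, h, -⟩ := exists_common_tuple z 0
  exact ⟨n, γ, m, h⟩

/-- The value of an admissible pseudocharacter at a cycle. -/
theorem exists_cycleHom : ∃ v : TorusPt (d₁ π M).ker A, ∀ (n : ℕ) (γ : Fin (n + 1) → Γ)
    (m : Fin (n + 1) → M) (hd : d₁ π M (tupleChain γ m) = 0),
    (v.val ⟨tupleChain γ m, hd⟩ : A) = cycleVal hG ρ₀ T γ m hd := by
  have : Inhabited Γ := ⟨1⟩
  choose N γ m h using exists_tuple (Γ := Γ) (M := M)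
  have hd : ∀ z : (d₁ π M).ker, d₁ π M (tupleChain (γ z.1) (m z.1)) = 0 := fun z => by
    rw [h]
    exact z.2
  -- Multiplicativity is checked on a tuple carrying both cycles. As the source is a group, the
  -- values of `F` are automatically units.
  let F : Multiplicative (d₁ π M).ker →* A :=
    { toFun := fun z => cycleVal hG ρ₀ T (γ z.toAdd.1) (m z.toAdd.1) (hd z.toAdd)
      map_one' := by
        rw [cycleVal_eq_of_tupleChain_eq hG ρ₀ T _ _ (fun _ : Fin 1 => (1 : Γ)) (0 : Fin 1 → M)
          _ (by simp) (by rw [h, map_zero]; rfl), cycleVal_zero]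
      map_mul' := fun z w => by
        obtain ⟨k, δ, a, b, ha, hb⟩ := exists_common_tuple z.toAdd.1 w.toAdd.1
        have ha' : d₁ π M (tupleChain δ a) = 0 := by rw [ha]; exact z.toAdd.2
        have hb' : d₁ π M (tupleChain δ b) = 0 := by rw [hb]; exact w.toAdd.2
        have hab : d₁ π M (tupleChain δ (a + b)) = 0 := by rw [map_add, map_add, ha', hb', zero_add]
        rw [cycleVal_eq_of_tupleChain_eq hG ρ₀ T _ _ δ (a + b) _ hab
            (by rw [h, map_add, ha, hb]; rfl),
          cycleVal_eq_of_tupleChain_eq hG ρ₀ T _ _ δ a (hd z.toAdd) ha' (by rw [h, ha]),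
          cycleVal_eq_of_tupleChain_eq hG ρ₀ T _ _ δ b (hd w.toAdd) hb' (by rw [h, hb]),
          cycleVal_add] }
  refine ⟨(show Multiplicative (d₁ π M).ker →* Aˣ from F.toHomUnits), fun n δ m hm => ?_⟩
  exact cycleVal_eq_of_tupleChain_eq hG ρ₀ T _ _ δ m _ hm (h _)

/-- An admissible pseudocharacter is trivial on boundaries `∂(m [γ, δ])`. -/
theorem cycleVal_boundary (γ γ' : Γ) (m : M)
    (hd : d₁ π M (tupleChain ![γ, γ', γ * γ'] ![m, (π γ)⁻¹ • m, -m]) = 0) :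
    cycleVal hG ρ₀ T ![γ, γ', γ * γ'] ![m, (π γ)⁻¹ • m, -m] hd = 1 := by
  have h1 : T.1.Θ 1 1 ![γ, γ'] = 1 := by rw [map_one, Pi.one_apply]
  -- The triple arises from (γ, γ', γ, γ') by multiplying the last two entries, and that quadruple
  -- is a reindexing of (γ, γ'). The two axioms thus reduce the claim to an identity of functions of
  -- two variables.
  have h2 : (![γ, γ', γ * γ'] : Fin 3 → Γ) = mulLast ![γ, γ', γ, γ'] := by
    ext i
    fin_cases i <;> rfl
  have h3 : (![γ, γ', γ, γ'] : Fin 4 → Γ) = fun i => ![γ, γ'] ((![0, 1, 0, 1] : Fin 4 → Fin 2) i) := by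
    ext i
    fin_cases i <;> rfl
  rw [cycleVal, ← h1]
  have h4 := T.1.hat' 2 (cycleFun hG ρ₀ ![γ, γ', γ * γ'] ![m, (π γ)⁻¹ • m, -m] hd) ![γ, γ', γ, γ']
  rw [← h2, h3, ← T.1.reindex'] at h4
  rw [← h4]
  apply Θ_eq_of_evalGeneric_eq ρ₀
  rw [Subalgebra.coe_one, map_one]
  change evalAt (genericPt ρ₀ ![γ, γ']) (reindex _ _).1 = 1
  rw [evalAt_reindex, evalAt_hat]
  set U := TorusPt.univ O (Fin 2 → M) with hU
  let t : Fin 2 → TorusPt M _ := fun i =>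
    TorusPt.comap (AddMonoidHom.single (fun _ : Fin 2 => M) i) U
  -- The product of the two generic entries has torus part t₀ · γt₁; the value of this at -m cancels
  -- t₀(m) · t₁(γ⁻¹m).
  have h5 : mulLast (fun i => genericPt ρ₀ ![γ, γ'] ((![0, 1, 0, 1] : Fin 4 → Fin 2) i)) =
      fun i => G.ι _ ((![t 0, t 1, t 0 * π γ • t 1] : Fin 3 → TorusPt M _) i) *
        baseHom ρ₀ _ ((![γ, γ', γ * γ'] : Fin 3 → Γ) i) := by
    ext1 i
    fin_cases i
    · rfl
    · rfl
    · exact ι_mul_baseHom_mul hG ρ₀ (t 0) (t 1) γ γ'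
  rw [h5, evalAt_ι_mul_baseHom, evalGeneric_cycleFun, TorusPt.charHom_single_one, TorusPt.pi_val,
    Fin.prod_univ_three]
  refine Units.val_eq_one.2 ?_
  change (t 0).val m * (t 1).val ((π γ)⁻¹ • m) * (t 0 * π γ • t 1).val (-m) = 1
  rw [TorusPt.val_neg, TorusPt.mul_val, TorusPt.smul_val, mul_inv_cancel]

/-- The boundaries are generated by the d₂(m[γ, γ']), on which `cycleVal_boundary` applies, so the
character of cycles descends to H₁. -/
theorem exists_homologyChar (s : CosetReps π) : ∃ v : TorusPt (HomologyOne π M) A,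
    ∀ (n : ℕ) (γ : Fin (n + 1) → Γ) (m : Fin (n + 1) → M) (hd : d₁ π M (tupleChain γ m) = 0),
    (v.val (QuotientAddGroup.mk ⟨tupleChain γ m, hd⟩) : A) = cycleVal hG ρ₀ T γ m hd := by
  obtain ⟨v, hv⟩ := exists_cycleHom hG ρ₀ T
  -- The identity d₁ ∘ d₂ = 0 holds because d₁ factors through `chainHom`, which kills boundaries.
  have hdd : ∀ y, d₂ π M y ∈ (d₁ π M).ker := fun y => by
    have h := DFunLike.congr_fun (s.chainHom_comp_d₂ (M := M)) y
    rw [AddMonoidHom.comp_apply, AddMonoidHom.zero_apply] at h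
    rw [AddMonoidHom.mem_ker, ← s.boundary_chainHom, h, map_zero]
  have hzero : v.toAddHom.comp ((d₂ π M).codRestrict _ hdd) = 0 := by
    refine Finsupp.addHom_ext fun p m => ?_
    obtain ⟨γ, γ'⟩ := p
    have hc : d₂ π M (Finsupp.single (γ, γ') m) =
        tupleChain ![γ, γ', γ * γ'] ![m, (π γ)⁻¹ • m, -m] := by
      rw [CosetReps.d₂_single, tupleChain_apply, Fin.sum_univ_three]
      change _ = Finsupp.single γ m + Finsupp.single γ' ((π γ)⁻¹ • m) +
        Finsupp.single (γ * γ') (-m)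
      rw [Finsupp.single_neg]
      abel
    have hd : d₁ π M (tupleChain ![γ, γ', γ * γ'] ![m, (π γ)⁻¹ • m, -m]) = 0 := by
      rw [← hc]
      exact hdd _
    have he : (d₂ π M).codRestrict _ hdd (Finsupp.single (γ, γ') m) = ⟨_, hd⟩ := Subtype.ext hc
    rw [AddMonoidHom.comp_apply, he, AddMonoidHom.zero_apply, TorusPt.toAddHom_apply]
    have : v.val ⟨_, hd⟩ = 1 := Units.ext <| by
      rw [hv 2 _ _ hd, cycleVal_boundary, Units.val_one]
    rw [this]
    rfl
  refine ⟨TorusPt.ofAddHom (QuotientAddGroup.lift _ v.toAddHom ?_), fun n γ m hd => hv n γ m hd⟩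
  rintro ⟨z, hz⟩ hz'
  obtain ⟨y, hy⟩ := AddSubgroup.mem_addSubgroupOf.1 hz'
  obtain rfl : d₂ π M y = z := hy
  exact DFunLike.congr_fun hzero y

/-- On the component over (πγ₁, …, πγₙ) every invariant function is an O-linear combination of
functions attached to cycles, by `d₁_eq_zero_of_mem_support`, and Θ at γ sees nothing outside that
component. -/
theorem ext_cycleVal {T T' : G.PC π A} (h : ∀ (n : ℕ) (γ : Fin (n + 1) → Γ) (m : Fin (n + 1) → M)
    (hd : d₁ π M (tupleChain γ m) = 0), cycleVal hG ρ₀ T γ m hd = cycleVal hG ρ₀ T' γ m hd) :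
    T = T' := by
  refine Subtype.ext (PseudoChar.ext (funext fun n => AlgHom.ext fun f => funext fun γ => ?_))
  set x := evalGeneric ρ₀ γ f.1 with hx
  -- Expand the generic value of f in characters and replace each by its invariant function; f'
  -- agrees with f on the relevant component only, which suffices.
  let f' : invariants O H (n + 1) := ∑ m : x.coeff.support, x.coeff m.1 •
    cycleFun hG ρ₀ γ m.1 (d₁_eq_zero_of_mem_support ρ₀ γ hG f.2 m.2)
  have hf' : evalGeneric ρ₀ γ f.1 = evalGeneric ρ₀ γ f'.1 := by
    have hval : f'.1 = ∑ m : x.coeff.support, x.coeff m.1 •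
        (cycleFun hG ρ₀ γ m.1 (d₁_eq_zero_of_mem_support ρ₀ γ hG f.2 m.2)).1 := by
      simp only [f', AddSubmonoidClass.coe_finsetSum]
      rfl
    rw [hval, map_sum, ← hx]
    simp only [map_smul, evalGeneric_cycleFun, AddMonoidAlgebra.smul_single, smul_eq_mul, mul_one]
    conv_lhs => rw [← AddMonoidAlgebra.sum_coeff_single x]
    exact (Finset.sum_coe_sort x.coeff.support
      fun m => AddMonoidAlgebra.single m (x.coeff m)).symm
  rw [Θ_eq_of_evalGeneric_eq ρ₀ T γ hf', Θ_eq_of_evalGeneric_eq ρ₀ T' γ hf']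
  simp only [f', map_sum, map_smul, Finset.sum_apply, Pi.smul_apply]
  exact Finset.sum_congr rfl fun m _ => congrArg _ (h n γ m.1 _)

/-- Evaluating the character (mᵢ) on the torus parts Φ(γᵢ) gives ∏ Φ(γᵢ)(mᵢ), the pairing of cocycle
and cycle. -/
theorem cycleVal_ofRep (s : CosetReps π) (ρ : G.Rep π A) (γ : Fin (n + 1) → Γ)
    (m : Fin (n + 1) → M) (hd : d₁ π M (tupleChain γ m) = 0) :
    cycleVal hG ρ₀ (PC.ofRep G ρ) γ m hd =
      (homologyChar hG ρ₀ s ρ).val (QuotientAddGroup.mk ⟨tupleChain γ m, hd⟩) := by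
  obtain ⟨Φ, rfl⟩ := (twistEquiv hG ρ₀ A).surjective ρ
  rw [homologyChar, TorusPt.comap_val, s.homologyHom_mk, charRepEquiv, Equiv.symm_trans_apply,
    Equiv.symm_apply_apply]
  change evalAt (fun i => G.ι A (Φ.1 (γ i)) * baseHom ρ₀ A (γ i)) (cycleFun hG ρ₀ γ m hd).1 = _
  rw [evalAt_ι_mul_baseHom, evalGeneric_cycleFun, TorusPt.charHom_single_one, TorusPt.pi_val]
  change _ = ((s.cocycleEquiv.symm Φ).val (s.chainHom M (tupleChain γ m)) : A)
  congr 1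
  rw [tupleChain_apply, map_sum, TorusPt.val_sum]
  refine Finset.prod_congr rfl fun i _ => ?_
  rw [s.chainHom_single, s.cocycleEquiv_symm_val_natCocycle]

theorem ofRep_eq_ofRep_of_homologyChar_eq (s : CosetReps π) {ρ σ : G.Rep π A}
    (h : homologyChar hG ρ₀ s ρ = homologyChar hG ρ₀ s σ) : PC.ofRep G ρ = PC.ofRep G σ :=
  ext_cycleVal hG ρ₀ fun n γ m hd => by rw [cycleVal_ofRep hG ρ₀ s, cycleVal_ofRep hG ρ₀ s, h]

end PC

/-! ### Representability of PC by O[H₁(Γ, M)]. -/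

section Representability

variable (s : CosetReps π) {r : s.Coinv M →+ HomologyOne π M}
  (hr : ∀ y, r (s.homologyHom M y) = y)

include hr in
theorem homologyChar_charRepEquiv_comap (v : TorusPt (HomologyOne π M) A) :
    homologyChar hG ρ₀ s (charRepEquiv hG ρ₀ s A (TorusPt.comap r v)) = v := by
  refine TorusPt.ext_val fun y => ?_
  rw [homologyChar, Equiv.symm_apply_apply, TorusPt.comap_val, TorusPt.comap_val, hr]

variable (r) in
/-- The admissible pseudocharacter attached to a character of `H₁(Γ, M)`. -/
def pcOfChar (v : TorusPt (HomologyOne π M) A) : G.PC π A :=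
  PC.ofRep G (charRepEquiv hG ρ₀ s A (TorusPt.comap r v))

include hr in
theorem cycleVal_pcOfChar (v : TorusPt (HomologyOne π M) A) (γ : Fin (n + 1) → Γ)
    (m : Fin (n + 1) → M) (hd : d₁ π M (tupleChain γ m) = 0) :
    PC.cycleVal hG ρ₀ (pcOfChar hG ρ₀ s r v) γ m hd =
      v.val (QuotientAddGroup.mk ⟨tupleChain γ m, hd⟩) := by
  rw [pcOfChar, PC.cycleVal_ofRep hG ρ₀ s, homologyChar_charRepEquiv_comap hG ρ₀ s hr]

-- The cycle values recover the character, which gives injectivity. Conversely, the cycle values of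
-- any T form a character v of H₁ by `PC.exists_homologyChar`, and T equals the pseudocharacter
-- attached to v by `PC.ext_cycleVal`. In particular T comes from a representation over the same A.
include hr in
theorem pcOfChar_bijective : Function.Bijective (pcOfChar hG ρ₀ s r (A := A)) := by
  constructor
  · intro v w h
    refine TorusPt.ext_val fun y => Units.ext ?_
    obtain ⟨⟨z, hz⟩, rfl⟩ := QuotientAddGroup.mk_surjective y
    obtain ⟨n, γ, m, rfl⟩ := PC.exists_tuple z
    exact (cycleVal_pcOfChar hG ρ₀ s hr v γ m hz).symm.trans
      ((congrArg (fun T => PC.cycleVal hG ρ₀ T γ m hz) h).trans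
        (cycleVal_pcOfChar hG ρ₀ s hr w γ m hz))
  · intro T
    obtain ⟨v, hv⟩ := PC.exists_homologyChar hG ρ₀ T s
    exact ⟨v, PC.ext_cycleVal hG ρ₀ fun n γ m hd => by
      rw [cycleVal_pcOfChar hG ρ₀ s hr, hv]⟩

/-- The bijection between characters of `H₁(Γ, M)` and admissible pseudocharacters. -/
def charPCEquiv (A : Type u) [CommRing A] [Algebra O A] :
    TorusPt (HomologyOne π M) A ≃ G.PC π A :=
  Equiv.ofBijective (pcOfChar hG ρ₀ s r) (pcOfChar_bijective hG ρ₀ s hr)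

/-- The functor of admissible pseudocharacters is represented by `O[H₁(Γ, M)]`. -/
def pcCorepresentableBy : (G.pcFunctor π).CorepresentableBy (grpAlg O (HomologyOne π M)) where
  homEquiv {A} := (TorusPt.pointEquiv A).trans (charPCEquiv hG ρ₀ s hr A)
  homEquiv_comp {A B} g f := by
    change PC.ofRep G (charRepEquiv hG ρ₀ s B (TorusPt.map g.hom
        (TorusPt.comap r ((TorusPt.charEquiv O).symm f.hom)))) =
      PC.map G g.hom (PC.ofRep G (charRepEquiv hG ρ₀ s A
        (TorusPt.comap r ((TorusPt.charEquiv O).symm f.hom))))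
    rw [PC.map_ofRep, map_charRepEquiv]

/-- The representation rebuilt through r from the restriction of ψ to H₁ need not be the one given
by ψ, but both have the same character on H₁ and hence the same pseudocharacter. -/
theorem pcCorepresentableBy_homEquiv_comp (A : CommAlgCat.{u} O)
    (ψ : grpAlg O (s.Coinv M) ⟶ A) :
    (pcCorepresentableBy hG ρ₀ s hr).homEquiv
        (CommAlgCat.ofHom (AddMonoidAlgebra.mapDomainAlgHom O O (s.homologyHom M)) ≫ ψ) =
      PC.ofRep G (G.ofPoint (repCorepresentableBy hG ρ₀ s) A ψ) := by
  change PC.ofRep G (charRepEquiv hG ρ₀ s A (TorusPt.comap r ((TorusPt.charEquiv O).symm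
      (ψ.hom.comp (AddMonoidAlgebra.mapDomainAlgHom O O (s.homologyHom M)))))) =
    PC.ofRep G (charRepEquiv hG ρ₀ s A ((TorusPt.charEquiv O).symm ψ.hom))
  refine PC.ofRep_eq_ofRep_of_homologyChar_eq hG ρ₀ s ?_
  rw [homologyChar_charRepEquiv_comap hG ρ₀ s hr, homologyChar, Equiv.symm_apply_apply]
  refine TorusPt.ext_val fun y => Units.ext ?_
  rw [TorusPt.comap_val, TorusPt.charEquiv_symm_val, TorusPt.charEquiv_symm_val,
    AlgHom.comp_apply, AddMonoidAlgebra.mapDomainAlgHom_apply, AddMonoidAlgebra.mapDomain_single]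

end Representability

end SplitGeneralisedTorus

end

end GenTorus

/-! ### The main theorem. -/

theorem mainTheorem4 {O H M Δ Γ : Type u} [CommRing O] [ConnectedSpace (PrimeSpectrum O)]
    [CommRing H] [HopfAlgebra O H] [AddCommGroup M] [Group Δ] [Finite Δ] [DistribMulAction Δ M]
    [Group Γ] (G : GenTorus.SplitGeneralisedTorus O M Δ H) (hG : G.IsConjugationAction)
    (π : Γ →* Δ) (hπ : Function.Surjective π) (s : GenTorus.CosetReps π) (ρ₀ : G.Rep π O) :
    ∃ (b : GenTorus.z1Functor π M O ≅ G.repFunctor π)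
      (h : GenTorus.h1Functor π M O ≅ G.orbitFunctor π)
      (c : (G.repFunctor π).CorepresentableBy (GenTorus.grpAlg O (s.Coinv M)))
      (φ : GenTorus.HomologyOne π M →+ s.Coinv M)
      (q : G.orbitFunctor π ⟶
        coyoneda.obj (Opposite.op (GenTorus.grpAlg O (GenTorus.HomologyOne π M))))
      (d : (G.pcFunctor π).CorepresentableBy (GenTorus.grpAlg O (GenTorus.HomologyOne π M))),
      -- `b` is the natural bijection `Φ ↦ Φ ρ₀`
      (∀ (A : CommAlgCat.{u} O) (Φ : GenTorus.Z1 π M A) (γ : Γ),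
        (G.ofCocycle b.hom A Φ).1 γ =
          G.ι A (Φ.1 γ) * GenTorus.Pt.map H (Algebra.ofId O A) (ρ₀.1 γ)) ∧
      -- `b` is equivariant for `𝔇(M)(A)`
      (∀ (A : CommAlgCat.{u} O) (t : GenTorus.TorusPt M A) (Φ : GenTorus.Z1 π M A),
        G.ofCocycle b.hom A (GenTorus.coboundary π t * Φ) = t • G.ofCocycle b.hom A Φ) ∧
      -- `h` is the induced bijection between `H¹` and the set of orbits
      (∀ (A : CommAlgCat.{u} O) (Φ : GenTorus.Z1 π M A),
        h.hom.app A (QuotientGroup.mk Φ : GenTorus.H1 π M A) =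
          G.orbit A (G.ofCocycle b.hom A Φ)) ∧
      -- `Rep` is represented by `O[(ℰ ⊗ M)_Δ]`, via `b` and the universal cocycle
      (∀ (A : CommAlgCat.{u} O) (ψ : GenTorus.grpAlg O (s.Coinv M) ⟶ A),
        ∃ Φ : GenTorus.Z1 π M A,
          (∀ (γ : Γ) (m : M), ((Φ.1 γ).val m : A) =
            ψ.hom (AddMonoidAlgebra.single (s.natCocycle γ m) 1)) ∧
          G.ofPoint c A ψ = G.ofCocycle b.hom A Φ) ∧
      -- `φ` is the homomorphism `φ_nat : H₁(Γ, M) → (ℰ ⊗ M)_Δ`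
      (∀ z : (GenTorus.d₁ π M).ker,
        φ (QuotientAddGroup.mk z) = z.1.sum fun γ m => s.natCocycle γ m) ∧
      -- `q` is given by the pairing of cocycles with cycles, and it makes `Spec O[H₁(Γ, M)]` the
      -- fpqc quotient of `Rep` by `𝔇(M)`
      (∀ (A : CommAlgCat.{u} O) (Φ : GenTorus.Z1 π M A) (z : (GenTorus.d₁ π M).ker),
        G.quotientPoint q A (G.ofCocycle b.hom A Φ)
            (AddMonoidAlgebra.single (QuotientAddGroup.mk z) 1) =
          ((z.1.prod fun γ m => (Φ.1 γ).val m : Aˣ) : A)) ∧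
      GenTorus.IsFpqcSheafification q ∧
      -- it is a GIT quotient: `φ_nat` identifies `O[H₁(Γ, M)]` with the algebra of invariants
      Function.Injective (AddMonoidAlgebra.mapDomainAlgHom O O φ) ∧
      (AddMonoidAlgebra.mapDomainAlgHom O O φ).range = G.repInvariants π c ∧
      -- `PC` is represented by `O[H₁(Γ, M)]`, compatibly with the map `ρ ↦ Θ_ρ` from `Rep`
      (∀ (A : CommAlgCat.{u} O) (ψ : GenTorus.grpAlg O (s.Coinv M) ⟶ A),
        d.homEquiv (CommAlgCat.ofHom (AddMonoidAlgebra.mapDomainAlgHom O O φ) ≫ ψ) =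
          GenTorus.SplitGeneralisedTorus.PC.ofRep G (G.ofPoint c A ψ)) := by
  have := G.free
  have := G.finite
  obtain ⟨r, hr⟩ := s.exists_retraction (M := M)
  refine ⟨GenTorus.SplitGeneralisedTorus.twistIso hG ρ₀,
    GenTorus.SplitGeneralisedTorus.orbitIso hG ρ₀,
    GenTorus.SplitGeneralisedTorus.repCorepresentableBy hG ρ₀ s, s.homologyHom M,
    GenTorus.SplitGeneralisedTorus.quotientMap hG ρ₀ s,
    GenTorus.SplitGeneralisedTorus.pcCorepresentableBy hG ρ₀ s hr,
    fun A Φ γ => rfl,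
    fun A t Φ => GenTorus.SplitGeneralisedTorus.twistEquiv_coboundary_mul hG ρ₀ t Φ,
    fun A Φ => rfl,
    fun A ψ => ⟨s.cocycleEquiv ((GenTorus.TorusPt.charEquiv O).symm ψ.hom),
      fun γ m => rfl, rfl⟩,
    fun z => rfl, fun A Φ z => ?_,
    GenTorus.SplitGeneralisedTorus.isFpqcSheafification_quotientMap hG ρ₀ s,
    AddMonoidAlgebra.mapDomain_injective s.homologyHom_injective,
    GenTorus.SplitGeneralisedTorus.range_mapDomain_homologyHom hG ρ₀ s,
    fun A ψ => GenTorus.SplitGeneralisedTorus.pcCorepresentableBy_homEquiv_comp hG ρ₀ s hr A ψ⟩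
  rw [GenTorus.SplitGeneralisedTorus.quotientPoint_quotientMap,
    GenTorus.TorusPt.charHom_single_one,
    GenTorus.SplitGeneralisedTorus.ofCocycle_twistIso,
    GenTorus.SplitGeneralisedTorus.homologyChar_twistEquiv_mk]
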